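/- Let $\mathbf T^X$ be the set of finite types generated from the ground types $0$ (natural numbers) and $X$ by $\rho,\tau\mapsto(\rho\to\tau)$. Let $\widehat{\mathrm{PA}}{}^\omega{\upharpoonright}[X,\langle\cdot,\cdot\rangle]$ be the following theory in classical many-sorted logic over $\mathbf T^X$, whose only prime formulas are equations of type $0$. Its constants are $0$, the successor $S$, the combinators $\Pi_{\rho,\tau}$, $\Sigma_{\delta,\rho,\tau}$, the recursors with values in the ground types $0$ and $X$ (but none with values in function types), and $0_X,+_X,-_X,\cdot_X,\|\cdot\|_X,\langle\cdot,\cdot\rangle_X$, where real numbers are represented by type-$(0\to0)$ functions coding Cauchy sequences of rationals with rate $2^{-n}$. Equality at $X$ is defined by $x=_Xy:\equiv\|x-_Xy\|_X=_{\mathbb R}0$ and equality at function types is defined pointwise. The axioms and rules are: the equality axioms for type $0$, the successor axioms, the defining equations of the combinators and recursors, quantifier-free induction, quantifier-free choice $\mathrm{QF\text{-}AC}^{\rho,\tau}$: $\forall x^\rho\exists y^\tau A_0(x,y)\to\exists Y^{\rho\to\tau}\forall x^\rho A_0(x,Yx)$ for all types $\rho,\tau$, the quantifier-free extensionality rule (from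 a theorem $A_0\to s=_\rho t$ infer $A_0\to r[s]=_\tau r[t]$; $A_0$ quantifier-free), and the axioms saying that $X$ is a real vector space with norm $\|\cdot\|_X$ and scalar product $\langle\cdot,\cdot\rangle_X$ satisfying $\langle x,x\rangle=\|x\|^2$ (completeness of $X$ is not needed and not assumed). Let $\Pi^0_1\text{-}\mathrm{CP}$ be the collection schema $\forall n\le k\,\exists m\,A(n,m)\to\exists M\,\forall n\le k\,\exists m\le M\,A(n,m)$ for formulas $A(n,m)\equiv\forall z^0A_0(n,m,z)$, $A_0$ quantifier-free (with parameters of arbitrary type). For a sequence $(x_i)$ in $X$ let $\mathrm{BW}_{\mathrm{weak}}((x_i))$ be the statement: if $(x_i)$ is bounded in norm, then there are a point $x\in X$ and a strictly increasing $h\colon\mathbb N\to\mathbb N$ such that $\lim_{i\to\infty}\langle y,x_{h(i)}\rangle=\langle y,x\rangle$ for all $y\in X$. For a term $t$ of type $0\to0\to0\to0$ let $\Pi^0_2\text{-}\mathrm{CA}(t)$ be the statement $\exists g\,\forall n\,\bigl(g(n)=0\leftrightarrow\forall x\,\exists y\;t\,x\,y\,n=0\bigr)$. **Theorem.** For every term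 $t$ of type $0\to0\to0\to0$ (possibly with free variables), \[ \widehat{\mathrm{PA}}{}^\omega{\upharpoonright}[X,\langle\cdot,\cdot\rangle]+\Pi^0_1\text{-}\mathrm{CP}\;\vdash\; \Bigl(\exists (e_i)_{i\in\mathbb N}\,\forall i,j\;\langle e_i,e_j\rangle=_{\mathbb R}\delta_{ij}\Bigr)\to \exists (x_i)_{i\in\mathbb N}\Bigl((x_i)\text{ is bounded}\wedge\bigl(\mathrm{BW}_{\mathrm{weak}}((x_i))\to\Pi^0_2\text{-}\mathrm{CA}(t)\bigr)\Bigr). \] Moreover, the sequence can be computed primitive recursively and uniformly from $t$ and $(e_i)$: there is a closed term $F$ of the theory such that, for all terms $t$ of type $0\to0\to0\to0$ and $e$ of type $0\to X$, the theory $\widehat{\mathrm{PA}}{}^\omega{\upharpoonright}[X,\langle\cdot,\cdot\rangle]+\Pi^0_1\text{-}\mathrm{CP}$ proves that if $\forall i,j\;\langle e_i,e_j\rangle=_{\mathbb R}\delta_{ij}$, then $(Fte)_i$ is a bounded sequence in $X$ and $\mathrm{BW}_{\mathrm{weak}}(Fte)\to\Pi^0_2\text{-}\mathrm{CA}(t)$.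 -/

import Mathlib

namespace FinTypeArith

/-! ## Syntax: finite types over `0` and `X`, combinatory terms, formulas -/

/-- The finite types over the two ground types `nat` (the type `0` of natural numbers) and `X`
(the abstract space). -/
inductive Ty : Type
  | nat : Ty
  | X : Ty
  | arr : Ty → Ty → Ty

infixr:60 " ⇒ " => Ty.arr

/-- The type `1` of number-theoretic functions; its elements also serve as names of reals. -/
abbrev Ty.fn : Ty := Ty.nat ⇒ Ty.nat

abbrev Ctx : Type := List Ty

/-- Typed de Bruijn variables. -/
inductive Var : Ctx → Ty → Type
  | vz {Γ : Ctx} {ρ : Ty} : Var (ρ :: Γ) ρ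
  | vs {Γ : Ctx} {ρ τ : Ty} : Var Γ ρ → Var (τ :: Γ) ρ

/-- The constants. `recN` and `recX` are the recursors with values in the two ground types; with
the combinators they define the predicative (Kleene-Feferman) recursors of every finite type.
There is no recursor with values in a function type. -/
inductive Cst : Ty → Type
  | zero : Cst .nat
  | succ : Cst (.nat ⇒ .nat)
  | K (ρ τ : Ty) : Cst (ρ ⇒ τ ⇒ ρ)
  | S (δ ρ τ : Ty) : Cst ((δ ⇒ ρ ⇒ τ) ⇒ (δ ⇒ ρ) ⇒ δ ⇒ τ)
  | recN : Cst (.nat ⇒ .nat ⇒ (.nat ⇒ .nat ⇒ .nat) ⇒ .nat)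
  | recX : Cst (.nat ⇒ .X ⇒ (.X ⇒ .nat ⇒ .X) ⇒ .X)
  | zeroX : Cst .X
  | addX : Cst (.X ⇒ .X ⇒ .X)
  | negX : Cst (.X ⇒ .X)
  | smulX : Cst (.fn ⇒ .X ⇒ .X)
  | normX : Cst (.X ⇒ .fn)
  | innerX : Cst (.X ⇒ .X ⇒ .fn)

inductive Tm (Γ : Ctx) : Ty → Type
  | var {ρ : Ty} : Var Γ ρ → Tm Γ ρ
  | con {ρ : Ty} : Cst ρ → Tm Γ ρ
  | app {ρ τ : Ty} : Tm Γ (ρ ⇒ τ) → Tm Γ ρ → Tm Γ τ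

infixl:80 " ⬝ " => Tm.app

/-- Formulas of classical many-sorted logic. The only prime formulas are equations of type `0`. -/
inductive Fm : Ctx → Type
  | eq {Γ : Ctx} : Tm Γ .nat → Tm Γ .nat → Fm Γ
  | bot {Γ : Ctx} : Fm Γ
  | imp {Γ : Ctx} : Fm Γ → Fm Γ → Fm Γ
  | all {Γ : Ctx} (ρ : Ty) : Fm (ρ :: Γ) → Fm Γ

infixr:35 " ⇛ " => Fm.imp

def Tm.subst {Γ Δ : Ctx} (σ : ∀ ρ, Var Γ ρ → Tm Δ ρ) : {τ : Ty} → Tm Γ τ → Tm Δ τ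
  | _, .var v => σ _ v
  | _, .con c => .con c
  | _, .app f a => .app (f.subst σ) (a.subst σ)

def Tm.wk {Γ : Ctx} {ρ τ : Ty} (t : Tm Γ τ) : Tm (ρ :: Γ) τ :=
  t.subst fun _ v => .var (.vs v)

def emptySubst {Γ : Ctx} : ∀ τ, Var [] τ → Tm Γ τ := nofun

/-- A closed term, read in an arbitrary context. -/
def Tm.cl {Γ : Ctx} {τ : Ty} (t : Tm [] τ) : Tm Γ τ :=
  t.subst emptySubst

def liftSubst {Γ Δ : Ctx} (ρ : Ty) (σ : ∀ τ, Var Γ τ → Tm Δ τ) :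
    ∀ τ, Var (ρ :: Γ) τ → Tm (ρ :: Δ) τ
  | _, .vz => .var .vz
  | _, .vs v => (σ _ v).wk

/-- The substitution `x₀ := s`, all other variables being lowered by one. -/
def instSubst {Γ : Ctx} {ρ : Ty} (s : Tm Γ ρ) : ∀ τ, Var (ρ :: Γ) τ → Tm Γ τ
  | _, .vz => s
  | _, .vs v => .var v

/-- The substitution `x₀ := s` where `s` may contain `x₀`, all other variables being kept. -/
def replSubst {Γ : Ctx} {ρ : Ty} (s : Tm (ρ :: Γ) ρ) : ∀ τ, Var (ρ :: Γ) τ → Tm (ρ :: Γ) τ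
  | _, .vz => s
  | _, .vs v => .var (.vs v)

def Tm.inst {Γ : Ctx} {ρ τ : Ty} (r : Tm (ρ :: Γ) τ) (s : Tm Γ ρ) : Tm Γ τ :=
  r.subst (instSubst s)

namespace Fm

def subst : {Γ Δ : Ctx} → (∀ ρ, Var Γ ρ → Tm Δ ρ) → Fm Γ → Fm Δ
  | _, _, σ, .eq s t => .eq (s.subst σ) (t.subst σ)
  | _, _, _, .bot => .bot
  | _, _, σ, .imp A B => .imp (A.subst σ) (B.subst σ)
  | _, _, σ, .all ρ A => .all ρ (A.subst (liftSubst ρ σ))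

def wk {Γ : Ctx} {ρ : Ty} (A : Fm Γ) : Fm (ρ :: Γ) := A.subst fun _ v => .var (.vs v)

def inst {Γ : Ctx} {ρ : Ty} (A : Fm (ρ :: Γ)) (s : Tm Γ ρ) : Fm Γ := A.subst (instSubst s)

def neg {Γ : Ctx} (A : Fm Γ) : Fm Γ := A ⇛ .bot
def and {Γ : Ctx} (A B : Fm Γ) : Fm Γ := neg (A ⇛ neg B)
def iff {Γ : Ctx} (A B : Fm Γ) : Fm Γ := and (A ⇛ B) (B ⇛ A)
def ex {Γ : Ctx} (ρ : Ty) (A : Fm (ρ :: Γ)) : Fm Γ := neg (.all ρ (neg A))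

/-- Quantifier-free formulas. -/
def QF : {Γ : Ctx} → Fm Γ → Prop
  | _, .eq _ _ => True
  | _, .bot => True
  | _, .imp A B => A.QF ∧ B.QF
  | _, .all _ _ => False

end Fm

/-- Combinatory abstraction `λ x₀. t`. -/
def lam {Γ : Ctx} {ρ : Ty} : {τ : Ty} → Tm (ρ :: Γ) τ → Tm Γ (ρ ⇒ τ)
  | _, .var .vz => .con (.S ρ (ρ ⇒ ρ) ρ) ⬝ .con (.K ρ (ρ ⇒ ρ)) ⬝ .con (.K ρ ρ)
  | _, .var (.vs v) => .con (.K _ ρ) ⬝ .var v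
  | _, .con c => .con (.K _ ρ) ⬝ .con c
  | _, .app f a => .con (.S ρ _ _) ⬝ lam f ⬝ lam a

section Variables

variable {Γ : Ctx} {ρ₀ ρ₁ ρ₂ ρ₃ : Ty}

def v0 : Tm (ρ₀ :: Γ) ρ₀ := .var .vz
def v1 : Tm (ρ₀ :: ρ₁ :: Γ) ρ₁ := .var (.vs .vz)
def v2 : Tm (ρ₀ :: ρ₁ :: ρ₂ :: Γ) ρ₂ := .var (.vs (.vs .vz))
def v3 : Tm (ρ₀ :: ρ₁ :: ρ₂ :: ρ₃ :: Γ) ρ₃ := .var (.vs (.vs (.vs .vz)))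

end Variables

/-! ## Primitive recursive arithmetic

Each operation is a closed term (name ending in `C`), followed by its application to arguments. -/

section Arithmetic

variable {Γ : Ctx}

def zero : Tm Γ .nat := .con .zero
def suc (s : Tm Γ .nat) : Tm Γ .nat := .con .succ ⬝ s

def num : ℕ → Tm Γ .nat
  | 0 => zero
  | n + 1 => suc (num n)

/-- Recursion on `n` with initial value `a`; in the step, `v0` is the index and `v1` the previous
value. -/
def prim (n a : Tm Γ .nat) (step : Tm (.nat :: .nat :: Γ) .nat) : Tm Γ .nat :=
  .con .recN ⬝ n ⬝ a ⬝ lam (lam step)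

def addC : Tm [] (.nat ⇒ .nat ⇒ .nat) := lam (lam (prim v0 v1 (suc v1)))
def add (s t : Tm Γ .nat) : Tm Γ .nat := addC.cl ⬝ s ⬝ t

def predC : Tm [] (.nat ⇒ .nat) := lam (prim v0 zero v0)
def pred (s : Tm Γ .nat) : Tm Γ .nat := predC.cl ⬝ s

/-- Truncated subtraction. -/
def monusC : Tm [] (.nat ⇒ .nat ⇒ .nat) := lam (lam (prim v0 v1 (pred v1)))
def monus (s t : Tm Γ .nat) : Tm Γ .nat := monusC.cl ⬝ s ⬝ t

def mulC : Tm [] (.nat ⇒ .nat ⇒ .nat) := lam (lam (prim v0 zero (add v1 v3)))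
def mul (s t : Tm Γ .nat) : Tm Γ .nat := mulC.cl ⬝ s ⬝ t

def pow2C : Tm [] (.nat ⇒ .nat) := lam (prim v0 (num 1) (add v1 v1))
def pow2 (s : Tm Γ .nat) : Tm Γ .nat := pow2C.cl ⬝ s

/-- `cond c a b` is `a` if `c = 0` and `b` otherwise. -/
def condC : Tm [] (.nat ⇒ .nat ⇒ .nat ⇒ .nat) := lam (lam (lam (prim v2 v1 v2)))
def cond (c a b : Tm Γ .nat) : Tm Γ .nat := condC.cl ⬝ c ⬝ a ⬝ b

def le (s t : Tm Γ .nat) : Fm Γ := .eq (monus s t) zero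

/-- Triangular numbers. -/
def triC : Tm [] (.nat ⇒ .nat) := lam (prim v0 zero (add v1 (suc v0)))
def tri (s : Tm Γ .nat) : Tm Γ .nat := triC.cl ⬝ s

/-- Cantor pairing `j(x, y) = ((x + y)² + 3x + y) / 2`. -/
def pairC : Tm [] (.nat ⇒ .nat ⇒ .nat) := lam (lam (add (tri (add v1 v0)) v1))
def pair (s t : Tm Γ .nat) : Tm Γ .nat := pairC.cl ⬝ s ⬝ t

/-- The largest `w` with `tri w ≤ z`. -/
def rootC : Tm [] (.nat ⇒ .nat) :=
  lam (prim v0 zero (cond (monus (tri (suc v1)) (suc v0)) (suc v1) v1))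
def root (s : Tm Γ .nat) : Tm Γ .nat := rootC.cl ⬝ s

def fstC : Tm [] (.nat ⇒ .nat) := lam (monus v0 (tri (root v0)))
def fst (s : Tm Γ .nat) : Tm Γ .nat := fstC.cl ⬝ s

def sndC : Tm [] (.nat ⇒ .nat) := lam (monus (root v0) (fst v0))
def snd (s : Tm Γ .nat) : Tm Γ .nat := sndC.cl ⬝ s

/-- Remainder modulo two. -/
def parC : Tm [] (.nat ⇒ .nat) := lam (prim v0 zero (monus (num 1) v1))
def par (s : Tm Γ .nat) : Tm Γ .nat := parC.cl ⬝ s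

/-- Quotient by two. -/
def halfC : Tm [] (.nat ⇒ .nat) := lam (prim v0 zero (add v1 (par v0)))
def half (s : Tm Γ .nat) : Tm Γ .nat := halfC.cl ⬝ s

end Arithmetic

/-! ## Rational numbers

The number `2k` codes the integer `k`, the number `2k - 1` codes `-k` (`k > 0`), and the number
`j(a, d)` codes the rational with numerator coded by `a` and denominator `d + 1`. -/

section Rationals

variable {Γ : Ctx}

/-- The code of the integer `p - q`. -/
def intC : Tm [] (.nat ⇒ .nat ⇒ .nat) :=
  lam (lam (cond (monus v0 v1) (mul (num 2) (monus v1 v0)) (pred (mul (num 2) (monus v0 v1)))))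
def int (p q : Tm Γ .nat) : Tm Γ .nat := intC.cl ⬝ p ⬝ q

/-- The positive part of the numerator of a coded rational. -/
def posC : Tm [] (.nat ⇒ .nat) := lam (mul (monus (num 1) (par (fst v0))) (half (fst v0)))
def pos (r : Tm Γ .nat) : Tm Γ .nat := posC.cl ⬝ r

/-- The negative part of the numerator of a coded rational. -/
def ngtC : Tm [] (.nat ⇒ .nat) := lam (mul (par (fst v0)) (half (suc (fst v0))))
def ngt (r : Tm Γ .nat) : Tm Γ .nat := ngtC.cl ⬝ r

def den (r : Tm Γ .nat) : Tm Γ .nat := suc (snd r)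

/-- The code of `(p - q) / d` for `d > 0`. -/
def mkQ (p q d : Tm Γ .nat) : Tm Γ .nat := pair (int p q) (pred d)

def addQC : Tm [] (.nat ⇒ .nat ⇒ .nat) :=
  lam (lam (mkQ (add (mul (pos v1) (den v0)) (mul (pos v0) (den v1)))
    (add (mul (ngt v1) (den v0)) (mul (ngt v0) (den v1))) (mul (den v1) (den v0))))
def addQ (r s : Tm Γ .nat) : Tm Γ .nat := addQC.cl ⬝ r ⬝ s

def mulQC : Tm [] (.nat ⇒ .nat ⇒ .nat) :=
  lam (lam (mkQ (add (mul (pos v1) (pos v0)) (mul (ngt v1) (ngt v0)))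
    (add (mul (pos v1) (ngt v0)) (mul (ngt v1) (pos v0))) (mul (den v1) (den v0))))
def mulQ (r s : Tm Γ .nat) : Tm Γ .nat := mulQC.cl ⬝ r ⬝ s

def negQC : Tm [] (.nat ⇒ .nat) := lam (mkQ (ngt v0) (pos v0) (den v0))
def negQ (r : Tm Γ .nat) : Tm Γ .nat := negQC.cl ⬝ r

def subQ (r s : Tm Γ .nat) : Tm Γ .nat := addQ r (negQ s)

def absQC : Tm [] (.nat ⇒ .nat) := lam (mkQ (add (pos v0) (ngt v0)) zero (den v0))
def absQ (r : Tm Γ .nat) : Tm Γ .nat := absQC.cl ⬝ r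

/-- The characteristic function of `<` on coded rationals: `0` if `r < s`, positive otherwise. -/
def ltQC : Tm [] (.nat ⇒ .nat ⇒ .nat) :=
  lam (lam (monus (suc (add (mul (pos v1) (den v0)) (mul (ngt v0) (den v1))))
    (add (mul (pos v0) (den v1)) (mul (ngt v1) (den v0)))))
def ltQ (r s : Tm Γ .nat) : Tm Γ .nat := ltQC.cl ⬝ r ⬝ s

/-- The rational `2⁻ⁿ`. -/
def invPow2C : Tm [] (.nat ⇒ .nat) := lam (mkQ (num 1) zero (pow2 v0))
def invPow2 (n : Tm Γ .nat) : Tm Γ .nat := invPow2C.cl ⬝ n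

end Rationals

/-! ## Real numbers

A function `f` of type `1` names a real: `hat f` agrees with `f` as long as
`|f k - f (k + 1)| < 2⁻⁽ᵏ⁺¹⁾`, and is constant from the first violation on. Hence every `f` of
type `1` names exactly one real. -/

section Reals

variable {Γ : Ctx}

/-- `hat f n = f n` if `|f k - f (k + 1)| < 2⁻⁽ᵏ⁺¹⁾` for all `k < n`, and `hat f n = f k` for the
least `k < n` violating this otherwise. -/
def hatC : Tm [] (.fn ⇒ .fn) :=
  lam (lam (v1 ⬝ prim v0 zero
    (cond (add (monus v0 v1)
        (ltQ (absQ (subQ (v3 ⬝ v0) (v3 ⬝ suc v0))) (invPow2 (suc v0))))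
      (suc v0) v1)))
def hat (f : Tm Γ .fn) (n : Tm Γ .nat) : Tm Γ .nat := hatC.cl ⬝ f ⬝ n

def eqR (f g : Tm Γ .fn) : Fm Γ :=
  .all .nat (.eq (ltQ (absQ (subQ (hat f.wk (suc v0)) (hat g.wk (suc v0)))) (invPow2 v0)) zero)

def leR (f g : Tm Γ .fn) : Fm Γ :=
  .all .nat (.eq (ltQ (subQ (hat f.wk (suc v0)) (hat g.wk (suc v0))) (invPow2 v0)) zero)

/-- The embedding of the rationals into the reals. -/
def constRC : Tm [] (.nat ⇒ .fn) := lam (lam v1)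
def constR (q : Tm Γ .nat) : Tm Γ .fn := constRC.cl ⬝ q

def zeroQ : Tm Γ .nat := mkQ zero zero (num 1)
def oneQ : Tm Γ .nat := mkQ (num 1) zero (num 1)

def zeroR : Tm Γ .fn := constR zeroQ
def oneR : Tm Γ .fn := constR oneQ

def addRC : Tm [] (.fn ⇒ .fn ⇒ .fn) :=
  lam (lam (lam (addQ (hat v2 (suc v0)) (hat v1 (suc v0)))))
def addR (f g : Tm Γ .fn) : Tm Γ .fn := addRC.cl ⬝ f ⬝ g

def negRC : Tm [] (.fn ⇒ .fn) := lam (lam (negQ (hat v1 v0)))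
def negR (f : Tm Γ .fn) : Tm Γ .fn := negRC.cl ⬝ f

def subR (f g : Tm Γ .fn) : Tm Γ .fn := addR f (negR g)

def absRC : Tm [] (.fn ⇒ .fn) := lam (lam (absQ (hat v1 v0)))
def absR (f : Tm Γ .fn) : Tm Γ .fn := absRC.cl ⬝ f

/-- A number `k` with `|f 0| + |g 0| + 2 ≤ k ≤ 2ᵏ`. -/
def mulBound (f g : Tm Γ .fn) : Tm Γ .nat :=
  add (add (add (pos (f ⬝ zero)) (ngt (f ⬝ zero))) (add (pos (g ⬝ zero)) (ngt (g ⬝ zero))))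
    (num 2)

def mulRC : Tm [] (.fn ⇒ .fn ⇒ .fn) :=
  lam (lam (lam (mulQ (hat v2 (add v0 (mulBound v2 v1))) (hat v1 (add v0 (mulBound v2 v1))))))
def mulR (f g : Tm Γ .fn) : Tm Γ .fn := mulRC.cl ⬝ f ⬝ g

end Reals

/-! ## The abstract space and equality of higher types -/

section Space

variable {Γ : Ctx}

def zeroX : Tm Γ .X := .con .zeroX
def addX (x y : Tm Γ .X) : Tm Γ .X := .con .addX ⬝ x ⬝ y
def negX (x : Tm Γ .X) : Tm Γ .X := .con .negX ⬝ x
def subX (x y : Tm Γ .X) : Tm Γ .X := addX x (negX y)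
def smulX (a : Tm Γ .fn) (x : Tm Γ .X) : Tm Γ .X := .con .smulX ⬝ a ⬝ x
def normX (x : Tm Γ .X) : Tm Γ .fn := .con .normX ⬝ x
def innerX (x y : Tm Γ .X) : Tm Γ .fn := .con .innerX ⬝ x ⬝ y

/-- Equality of objects of `X` is defined as `‖x - y‖ = 0`. -/
def eqX (x y : Tm Γ .X) : Fm Γ := eqR (normX (subX x y)) zeroR

end Space

/-- The defined (extensional) equality of arbitrary type. -/
def eqT : {Γ : Ctx} → (ρ : Ty) → Tm Γ ρ → Tm Γ ρ → Fm Γ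
  | _, .nat, s, t => .eq s t
  | _, .X, s, t => eqX s t
  | _, .arr ρ τ, s, t => .all ρ (eqT τ (s.wk ⬝ v0) (t.wk ⬝ v0))

/-! ## The formal systems -/

/-- From `A(x, y)` (with `v0 = y`, `v1 = x`) to `A(x, Y x)` (with `v0 = x`, `v1 = Y`). -/
def choiceSubst {Γ : Ctx} {ρ τ : Ty} :
    ∀ δ, Var (τ :: ρ :: Γ) δ → Tm (ρ :: (ρ ⇒ τ) :: Γ) δ
  | _, .vz => v1 ⬝ v0
  | _, .vs .vz => v0
  | _, .vs (.vs v) => .var (.vs (.vs v))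

/-- The renaming that inserts an unused variable (the bound `M`) below `z, m, n`. -/
def collSubst {Γ : Ctx} :
    ∀ δ, Var (.nat :: .nat :: .nat :: Γ) δ → Tm (.nat :: .nat :: .nat :: .nat :: Γ) δ :=
  liftSubst .nat (liftSubst .nat (liftSubst .nat fun _ v => .var (.vs v)))

/-- The non-logical axioms of the weakly extensional system of classical arithmetic in all finite
types with quantifier-free induction, ground-type recursion and quantifier-free choice, extended by
an abstract real inner product space `X`. (Completeness of `X` is not among the axioms.) -/
inductive PAwX (Γ : Ctx) : Fm Γ → Prop
  -- equality of type `0`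
  | eq_refl (s : Tm Γ .nat) : PAwX Γ (.eq s s)
  | eq_symm (s t : Tm Γ .nat) : PAwX Γ (.eq s t ⇛ .eq t s)
  | eq_trans (r s t : Tm Γ .nat) : PAwX Γ (.eq r s ⇛ .eq s t ⇛ .eq r t)
  -- successor
  | succ_ne_zero (s : Tm Γ .nat) : PAwX Γ (Fm.neg (.eq (suc s) zero))
  | succ_inj (s t : Tm Γ .nat) : PAwX Γ (.eq (suc s) (suc t) ⇛ .eq s t)
  -- combinators
  | K_ax {ρ τ : Ty} (s : Tm Γ ρ) (t : Tm Γ τ) : PAwX Γ (eqT ρ (.con (.K ρ τ) ⬝ s ⬝ t) s)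
  | S_ax {δ ρ τ : Ty} (f : Tm Γ (δ ⇒ ρ ⇒ τ)) (g : Tm Γ (δ ⇒ ρ)) (s : Tm Γ δ) :
      PAwX Γ (eqT τ (.con (.S δ ρ τ) ⬝ f ⬝ g ⬝ s) (f ⬝ s ⬝ (g ⬝ s)))
  -- recursors
  | recN_zero (a : Tm Γ .nat) (f : Tm Γ (.nat ⇒ .nat ⇒ .nat)) :
      PAwX Γ (.eq (.con .recN ⬝ zero ⬝ a ⬝ f) a)
  | recN_succ (n a : Tm Γ .nat) (f : Tm Γ (.nat ⇒ .nat ⇒ .nat)) :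
      PAwX Γ (.eq (.con .recN ⬝ suc n ⬝ a ⬝ f) (f ⬝ (.con .recN ⬝ n ⬝ a ⬝ f) ⬝ n))
  | recX_zero (a : Tm Γ .X) (f : Tm Γ (.X ⇒ .nat ⇒ .X)) :
      PAwX Γ (eqX (.con .recX ⬝ zero ⬝ a ⬝ f) a)
  | recX_succ (n : Tm Γ .nat) (a : Tm Γ .X) (f : Tm Γ (.X ⇒ .nat ⇒ .X)) :
      PAwX Γ (eqX (.con .recX ⬝ suc n ⬝ a ⬝ f) (f ⬝ (.con .recX ⬝ n ⬝ a ⬝ f) ⬝ n))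
  -- quantifier-free induction
  | qf_ind (A : Fm (.nat :: Γ)) (hA : A.QF) :
      PAwX Γ (A.inst zero ⇛ .all .nat (A ⇛ A.subst (replSubst (suc v0))) ⇛ .all .nat A)
  -- quantifier-free choice: `∀ x ∃ y A(x, y) → ∃ Y ∀ x A(x, Y x)`
  | qf_ac {ρ τ : Ty} (A : Fm (τ :: ρ :: Γ)) (hA : A.QF) :
      PAwX Γ (.all ρ (.ex τ A) ⇛
        .ex (ρ ⇒ τ) (.all ρ (A.subst choiceSubst)))
  -- real vector space
  | addX_assoc (x y z : Tm Γ .X) : PAwX Γ (eqX (addX (addX x y) z) (addX x (addX y z)))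
  | addX_comm (x y : Tm Γ .X) : PAwX Γ (eqX (addX x y) (addX y x))
  | addX_zero (x : Tm Γ .X) : PAwX Γ (eqX (addX x zeroX) x)
  | addX_neg (x : Tm Γ .X) : PAwX Γ (eqX (addX x (negX x)) zeroX)
  | one_smul (x : Tm Γ .X) : PAwX Γ (eqX (smulX oneR x) x)
  | mul_smul (a b : Tm Γ .fn) (x : Tm Γ .X) :
      PAwX Γ (eqX (smulX (mulR a b) x) (smulX a (smulX b x)))
  | smul_add (a : Tm Γ .fn) (x y : Tm Γ .X) :
      PAwX Γ (eqX (smulX a (addX x y)) (addX (smulX a x) (smulX a y)))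
  | add_smul (a b : Tm Γ .fn) (x : Tm Γ .X) :
      PAwX Γ (eqX (smulX (addR a b) x) (addX (smulX a x) (smulX b x)))
  -- norm
  | norm_self (x : Tm Γ .X) : PAwX Γ (eqR (normX (subX x x)) zeroR)
  | norm_symm (x y : Tm Γ .X) : PAwX Γ (eqR (normX (subX x y)) (normX (subX y x)))
  | norm_triangle (x y z : Tm Γ .X) :
      PAwX Γ (leR (normX (subX x z)) (addR (normX (subX x y)) (normX (subX y z))))
  | norm_smul (a : Tm Γ .fn) (x y : Tm Γ .X) :
      PAwX Γ (eqR (normX (subX (smulX a x) (smulX a y))) (mulR (absR a) (normX (subX x y))))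
  | norm_smul_sub (a b : Tm Γ .fn) (x : Tm Γ .X) :
      PAwX Γ (eqR (normX (subX (smulX a x) (smulX b x))) (mulR (absR (subR a b)) (normX x)))
  | norm_add_sub (x y u v : Tm Γ .X) :
      PAwX Γ (leR (normX (subX (addX x y) (addX u v)))
        (addR (normX (subX x u)) (normX (subX y v))))
  | norm_neg_sub (x y : Tm Γ .X) :
      PAwX Γ (eqR (normX (subX (negX x) (negX y))) (normX (subX x y)))
  | norm_sub_norm (x y : Tm Γ .X) :
      PAwX Γ (leR (absR (subR (normX x) (normX y))) (normX (subX x y)))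
  -- scalar product
  | norm_nonneg (x : Tm Γ .X) : PAwX Γ (leR zeroR (normX x))
  | inner_self (x : Tm Γ .X) : PAwX Γ (eqR (innerX x x) (mulR (normX x) (normX x)))
  | inner_symm (x y : Tm Γ .X) : PAwX Γ (eqR (innerX x y) (innerX y x))
  | inner_add (x y z : Tm Γ .X) :
      PAwX Γ (eqR (innerX (addX x y) z) (addR (innerX x z) (innerX y z)))
  | inner_smul (a : Tm Γ .fn) (x y : Tm Γ .X) :
      PAwX Γ (eqR (innerX (smulX a x) y) (mulR a (innerX x y)))

/-- The collection schema for `Π⁰₁`-formulas `∀ z A₀(n, m, z)` (`v0 = z`, `v1 = m`, `v2 = n`), with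
parameters of arbitrary types:
`∀ n ≤ k ∃ m ∀ z A₀(n, m, z) → ∃ M ∀ n ≤ k ∃ m ≤ M ∀ z A₀(n, m, z)`. -/
inductive Pi01CP (Γ : Ctx) : Fm Γ → Prop
  | cp (A : Fm (.nat :: .nat :: .nat :: Γ)) (hA : A.QF) (k : Tm Γ .nat) :
      Pi01CP Γ (.all .nat (le v0 k.wk ⇛ .ex .nat (.all .nat A)) ⇛
        .ex .nat (.all .nat (le v0 k.wk.wk ⇛
          .ex .nat (.and (le v0 v2) (.all .nat (A.subst collSubst))))))

/-- Derivability `H ⊢ A` in classical natural deduction from the axioms `T`, together with the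
quantifier-free rule of extensionality. The premise of that rule must be a theorem, that is,
derived without open assumptions. -/
inductive Der (T : ∀ Γ : Ctx, Fm Γ → Prop) : ∀ {Γ : Ctx}, List (Fm Γ) → Fm Γ → Prop
  | ax {Γ : Ctx} {H : List (Fm Γ)} {A : Fm Γ} : T Γ A → Der T H A
  | hyp {Γ : Ctx} {H : List (Fm Γ)} {A : Fm Γ} : A ∈ H → Der T H A
  | impI {Γ : Ctx} {H : List (Fm Γ)} {A B : Fm Γ} : Der T (A :: H) B → Der T H (A ⇛ B)
  | impE {Γ : Ctx} {H : List (Fm Γ)} {A B : Fm Γ} : Der T H (A ⇛ B) → Der T H A → Der T H B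
  | raa {Γ : Ctx} {H : List (Fm Γ)} {A : Fm Γ} : Der T (A.neg :: H) .bot → Der T H A
  | allI {Γ : Ctx} {H : List (Fm Γ)} {ρ : Ty} {A : Fm (ρ :: Γ)} :
      Der T (H.map Fm.wk) A → Der T H (.all ρ A)
  | allE {Γ : Ctx} {H : List (Fm Γ)} {ρ : Ty} {A : Fm (ρ :: Γ)} (s : Tm Γ ρ) :
      Der T H (.all ρ A) → Der T H (A.inst s)
  | qf_er {Γ : Ctx} {H : List (Fm Γ)} {ρ τ : Ty} {A : Fm Γ} (hA : A.QF) {s t : Tm Γ ρ}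
      (r : Tm (ρ :: Γ) τ) :
      Der T [] (A ⇛ eqT ρ s t) → Der T H (A ⇛ eqT τ (r.inst s) (r.inst t))

/-- Provability, without assumptions, in the system with the abstract space `X` plus `Π⁰₁`-CP.
Free variables of `A` are read universally. -/
def Provable {Γ : Ctx} (A : Fm Γ) : Prop :=
  Der (fun Γ A => PAwX Γ A ∨ Pi01CP Γ A) [] A

/-! ## The principles -/

section Principles

variable {Γ : Ctx}

/-- The Kronecker delta as a real. -/
def delta (i j : Tm Γ .nat) : Tm Γ .fn :=
  constR (cond (add (monus i j) (monus j i)) oneQ zeroQ)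

/-- `∀ i, j ⟨eᵢ, eⱼ⟩ = δᵢⱼ`. -/
def OrthonormalSeq (e : Tm Γ (.nat ⇒ .X)) : Fm Γ :=
  .all .nat (.all .nat (eqR (innerX (e.wk.wk ⬝ v1) (e.wk.wk ⬝ v0)) (delta v1 v0)))

/-- `∃ b ∀ i ‖xᵢ‖ ≤ b`, with `b` a real. -/
def BoundedSeq (x : Tm Γ (.nat ⇒ .X)) : Fm Γ :=
  .ex .fn (.all .nat (leR (normX (x.wk.wk ⬝ v0)) v1))

/-- `∀ y lim ⟨y, xᵢ⟩ = ⟨y, z⟩`, that is,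
`∀ y ∀ k ∃ m ∀ i ≥ m |⟨y, xᵢ⟩ - ⟨y, z⟩| ≤ 2⁻ᵏ`. -/
def WeakLim (x : Tm Γ (.nat ⇒ .X)) (z : Tm Γ .X) : Fm Γ :=
  .all .X (.all .nat (.ex .nat (.all .nat (le v1 v0 ⇛
    leR (absR (subR (innerX v3 (x.wk.wk.wk.wk ⬝ v0)) (innerX v3 z.wk.wk.wk.wk)))
      (constR (invPow2 v2))))))

/-- `∀ i h(i) < h(i + 1)`. -/
def StrictIncr (h : Tm Γ .fn) : Fm Γ :=
  .all .nat (le (suc (h.wk ⬝ v0)) (h.wk ⬝ suc v0))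

/-- Composition `i ↦ x (h i)`. -/
def subseqC : Tm [] ((.nat ⇒ .X) ⇒ .fn ⇒ .nat ⇒ .X) := lam (lam (lam (v2 ⬝ (v1 ⬝ v0))))
def subseq (x : Tm Γ (.nat ⇒ .X)) (h : Tm Γ .fn) : Tm Γ (.nat ⇒ .X) := subseqC.cl ⬝ x ⬝ h

/-- The Bolzano-Weierstrass principle for weak convergence for the sequence `x`: if `x` is bounded,
then some subsequence `x ∘ h` converges weakly to some point (`v1` is the point, `v0` is `h`). -/
def BWweak (x : Tm Γ (.nat ⇒ .X)) : Fm Γ :=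
  BoundedSeq x ⇛ .ex .X (.ex .fn (.and (StrictIncr v0) (WeakLim (subseq x.wk.wk v0) v1)))

/-- `∃ g ∀ n (g n = 0 ↔ ∀ x ∃ y t x y n = 0)`. -/
def Pi02CA (t : Tm Γ (.nat ⇒ .nat ⇒ .nat ⇒ .nat)) : Fm Γ :=
  .ex .fn (.all .nat (.iff (.eq (v1 ⬝ v0) zero)
    (.all .nat (.ex .nat (.eq (t.wk.wk.wk.wk ⬝ v1 ⬝ v0 ⬝ v2) zero)))))

end Principles

end FinTypeArith

open FinTypeArith

namespace FinTypeArith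

/-! ## Substitution -/

/-! The mathematical core. For each n a counter runs through x = 0, 1, … and moves on from x once it
has met some y with t x y n = 0. Its steps p propose `snd p` as y, so every y is proposed again
after any given step. The counter is monotone in p, and it becomes constant exactly when ∀ x ∃ y t x
y n = 0 fails (`exists_countLim_iff`). It therefore suffices to decide which counters converge.

The p-th vector x_p is the sum over m ≤ p of 2⁻ᵐ e_{j(m, c)}, where c is the value of the m-th
counter after p steps. By orthonormality its squared norm is a partial sum of ∑ 4⁻ᵐ
(`ip_part_self_le`). If x is a weak limit of a subsequence, then the coefficient of x at e_{j(n, i)}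
is 2⁻ⁿ if the n-th counter settles at i, and 0 otherwise (`coeff_of_countLim`,
`coeff_of_not_countLim`).

The decisive step is to test weak convergence against x itself. The number ⟨x, x_p⟩ collects 4⁻ᵐ for
those m ≤ p whose counter has its final value at p. It grows towards ⟨x, x⟩, and a convergent
counter n that is not yet final at p leaves a gap of at least 4⁻ⁿ (`ip_seq_add_le`). Hence any p
with ⟨x, x⟩ - ⟨x, x_p⟩ < 4⁻ⁿ is a valid waiting time for n. Quantifier-free choice supplies such a p
= Y n from rational approximations. The counter converges iff its value at Y n is final, that is,
iff the corresponding coefficient of x is 2⁻ⁿ and not 0, and one rational approximation tells these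
two apart (`exists_characteristic`). All comparisons of sums are made term by term, so no common
waiting time for several counters is required.

The formal derivation is obtained from completeness (`prv_of_models`): a Henkin construction gives a
term model of any consistent set-up. Extensionality is only a rule, so terms are identified when
they are indiscernible in numerical contexts; this makes prime formulas genuine equations and turns
the rule into the field `ext` of `Model`.

Inside a model the numbers form an ordered semiring, possibly nonstandard. Its fraction field and
the Cauchy functions on it give an ordered ring in which every name of a real has a value (`val`),
and the defined relations become true order and equality (`sat_leR`, `sat_eqR`). Only induction
remains delicate. Quantifier-free induction with choice gives Σ⁰₁-induction (`sigma_induction`),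
counting downwards gives Π⁰₁-induction (`pi_induction`), and this covers inequalities between
internal sequences of reals (`real_induction`), which replace finite sums. -/

abbrev Sub (Γ Δ : Ctx) : Type := ∀ ρ, Var Γ ρ → Tm Δ ρ

@[simp] theorem Tm.subst_var {Γ Δ : Ctx} (σ : Sub Γ Δ) {ρ : Ty} (v : Var Γ ρ) :
    (Tm.var v).subst σ = σ _ v := rfl
@[simp] theorem Tm.subst_con {Γ Δ : Ctx} (σ : Sub Γ Δ) {ρ : Ty} (c : Cst ρ) :
    (Tm.con c).subst σ = .con c := rfl
@[simp] theorem Tm.subst_app {Γ Δ : Ctx} (σ : Sub Γ Δ) {ρ τ : Ty} (f : Tm Γ (ρ ⇒ τ))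
    (a : Tm Γ ρ) : (f ⬝ a).subst σ = f.subst σ ⬝ a.subst σ := rfl

theorem Tm.subst_subst {Γ Δ Θ : Ctx} (σ : Sub Γ Δ) (θ : Sub Δ Θ) {τ : Ty} (t : Tm Γ τ) :
    (t.subst σ).subst θ = t.subst fun _ v => (σ _ v).subst θ := by
  induction t with
  | var v => rfl
  | con c => rfl
  | app f a ihf iha => simp [ihf, iha]

theorem Tm.subst_id {Γ : Ctx} {τ : Ty} (t : Tm Γ τ) : t.subst (fun _ v => .var v) = t := by
  induction t with
  | var v => rfl
  | con c => rfl
  | app f a ihf iha => simp [ihf, iha]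

theorem Tm.wk_subst_lift {Γ Δ : Ctx} (σ : Sub Γ Δ) (ρ : Ty) {τ : Ty} (t : Tm Γ τ) :
    t.wk.subst (liftSubst ρ σ) = (t.subst σ).wk := by
  simp only [Tm.wk, Tm.subst_subst]; rfl

theorem liftSubst_comp {Γ Δ Θ : Ctx} (σ : Sub Γ Δ) (θ : Sub Δ Θ) (ρ : Ty) :
    (fun τ v => (liftSubst ρ σ τ v).subst (liftSubst ρ θ)) =
      liftSubst ρ (fun τ v => (σ τ v).subst θ) := by
  funext τ v
  cases v with
  | vz => rfl
  | vs v => exact Tm.wk_subst_lift θ ρ _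

theorem Fm.subst_subst {Γ Δ Θ : Ctx} (σ : Sub Γ Δ) (θ : Sub Δ Θ) (A : Fm Γ) :
    (A.subst σ).subst θ = A.subst fun _ v => (σ _ v).subst θ := by
  induction A generalizing Δ Θ with
  | eq s t => simp [Fm.subst, Tm.subst_subst]
  | bot => rfl
  | imp A B ihA ihB => simp [Fm.subst, ihA, ihB]
  | all ρ A ih => simp only [Fm.subst, ih, liftSubst_comp]

theorem liftSubst_id {Γ : Ctx} (ρ : Ty) :
    liftSubst ρ (fun τ (v : Var Γ τ) => Tm.var v) = fun _ v => .var v := by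
  funext τ v
  cases v <;> rfl

theorem Fm.subst_id {Γ : Ctx} (A : Fm Γ) : A.subst (fun _ v => .var v) = A := by
  induction A with
  | eq s t => simp [Fm.subst, Tm.subst_id]
  | bot => rfl
  | imp A B ihA ihB => simp [Fm.subst, ihA, ihB]
  | all ρ A ih => simp [Fm.subst, liftSubst_id, ih]

theorem Fm.wk_subst_lift {Γ Δ : Ctx} (σ : Sub Γ Δ) (ρ : Ty) (A : Fm Γ) :
    A.wk.subst (liftSubst ρ σ) = (A.subst σ).wk := by
  simp only [Fm.wk, Fm.subst_subst]; rfl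

theorem Tm.wk_inst {Γ : Ctx} {ρ τ : Ty} (t : Tm Γ τ) (s : Tm Γ ρ) : t.wk.inst s = t := by
  simp only [Tm.wk, Tm.inst, Tm.subst_subst]
  exact t.subst_id

theorem Fm.wk_inst {Γ : Ctx} {ρ : Ty} (A : Fm Γ) (s : Tm Γ ρ) : A.wk.inst s = A := by
  simp only [Fm.wk, Fm.inst, Fm.subst_subst]
  exact A.subst_id

/-- The substitution `x₀ := s`, followed by `σ` on the other variables. -/
def consSubst {Γ Δ : Ctx} {ρ : Ty} (s : Tm Δ ρ) (σ : Sub Γ Δ) : Sub (ρ :: Γ) Δ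
  | _, .vz => s
  | _, .vs v => σ _ v

theorem liftSubst_inst {Γ Δ : Ctx} {ρ : Ty} (σ : Sub Γ Δ) (s : Tm Δ ρ) :
    (fun τ v => (liftSubst ρ σ τ v).subst (instSubst s)) = consSubst s σ := by
  funext τ v
  cases v with
  | vz => rfl
  | vs v => exact Tm.wk_inst _ _

theorem Fm.subst_lift_inst {Γ Δ : Ctx} {ρ : Ty} (σ : Sub Γ Δ) (s : Tm Δ ρ) (A : Fm (ρ :: Γ)) :
    (A.subst (liftSubst ρ σ)).inst s = A.subst (consSubst s σ) := by
  rw [Fm.inst, Fm.subst_subst, liftSubst_inst]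

theorem Tm.subst_lift_inst {Γ Δ : Ctx} {ρ τ : Ty} (σ : Sub Γ Δ) (s : Tm Δ ρ) (t : Tm (ρ :: Γ) τ) :
    (t.subst (liftSubst ρ σ)).inst s = t.subst (consSubst s σ) := by
  rw [Tm.inst, Tm.subst_subst, liftSubst_inst]

theorem instSubst_comp {Γ Δ : Ctx} {ρ : Ty} (σ : Sub Γ Δ) (s : Tm Γ ρ) :
    (fun τ v => (instSubst s τ v).subst σ) = consSubst (s.subst σ) σ := by
  funext τ v
  cases v <;> rfl

theorem Fm.inst_subst {Γ Δ : Ctx} {ρ : Ty} (σ : Sub Γ Δ) (s : Tm Γ ρ) (A : Fm (ρ :: Γ)) :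
    (A.inst s).subst σ = (A.subst (liftSubst ρ σ)).inst (s.subst σ) := by
  rw [Fm.subst_lift_inst, Fm.inst, Fm.subst_subst, instSubst_comp]

theorem Tm.inst_subst {Γ Δ : Ctx} {ρ τ : Ty} (σ : Sub Γ Δ) (s : Tm Γ ρ) (t : Tm (ρ :: Γ) τ) :
    (t.inst s).subst σ = (t.subst (liftSubst ρ σ)).inst (s.subst σ) := by
  rw [Tm.subst_lift_inst, Tm.inst, Tm.subst_subst, instSubst_comp]

theorem Fm.QF.subst {Γ Δ : Ctx} (σ : Sub Γ Δ) {A : Fm Γ} (hA : A.QF) : (A.subst σ).QF := by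
  induction A generalizing Δ with
  | eq s t => trivial
  | bot => trivial
  | imp A B ihA ihB => exact ⟨ihA σ hA.1, ihB σ hA.2⟩
  | all ρ A ih => exact hA.elim

theorem Tm.cl_subst {Γ Δ : Ctx} (σ : Sub Γ Δ) {τ : Ty} (t : Tm [] τ) :
    t.cl.subst σ = (t.cl : Tm Δ τ) := by
  simp only [Tm.cl, Tm.subst_subst]
  congr 1
  funext τ v
  cases v

/-! ### Defined notions and axioms under substitution. -/

section
variable {Γ Δ : Ctx} (σ : Sub Γ Δ)

theorem eqR_subst (f g : Tm Γ .fn) :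
    (eqR f g).subst σ = eqR (f.subst σ) (g.subst σ) := by
  simp [eqR, Fm.subst, ltQ, absQ, subQ, hat, addQ, negQ, invPow2, Tm.cl_subst, Tm.wk_subst_lift,
    v0, suc, zero, liftSubst]

theorem leR_subst (f g : Tm Γ .fn) :
    (leR f g).subst σ = leR (f.subst σ) (g.subst σ) := by
  simp [leR, Fm.subst, ltQ, subQ, hat, addQ, negQ, invPow2, Tm.cl_subst, Tm.wk_subst_lift,
    v0, suc, zero, liftSubst]

theorem eqX_subst (x y : Tm Γ .X) :
    (eqX x y).subst σ = eqX (x.subst σ) (y.subst σ) := by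
  simp [eqX, eqR_subst, normX, subX, addX, negX, zeroR, constR, zeroQ, mkQ, pair, int, pred, num,
    suc, zero, Tm.cl_subst]

theorem eqT_subst (ρ : Ty) (s t : Tm Γ ρ) :
    (eqT ρ s t).subst σ = eqT ρ (s.subst σ) (t.subst σ) := by
  induction ρ generalizing Γ Δ with
  | nat => rfl
  | X => exact eqX_subst σ s t
  | arr ρ τ _ ih =>
    simp only [eqT, Fm.subst, ih, Tm.subst_app, Tm.wk_subst_lift]
    rfl

end

theorem choiceSubst_comp {Γ Δ : Ctx} {ρ τ : Ty} (σ : Sub Γ Δ) (A : Fm (τ :: ρ :: Γ)) :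
    (A.subst choiceSubst).subst (liftSubst ρ (liftSubst (ρ ⇒ τ) σ)) =
      (A.subst (liftSubst τ (liftSubst ρ σ))).subst choiceSubst := by
  simp only [Fm.subst_subst]
  congr 1
  funext δ v
  rcases v with _ | v
  · rfl
  rcases v with _ | v
  · rfl
  · simp only [choiceSubst, liftSubst, Tm.subst_var, Tm.wk, Tm.subst_subst]

theorem replSubst_comp {Γ Δ : Ctx} (σ : Sub Γ Δ) (A : Fm (.nat :: Γ)) :
    (A.subst (replSubst (suc v0))).subst (liftSubst .nat σ) =
      (A.subst (liftSubst .nat σ)).subst (replSubst (suc v0)) := by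
  simp only [Fm.subst_subst]
  congr 1
  funext δ v
  rcases v with _ | v
  · rfl
  · simp only [replSubst, liftSubst, Tm.subst_var, Tm.wk, Tm.subst_subst]

section
variable {Γ Δ : Ctx} (σ : Sub Γ Δ)

theorem suc_subst (s : Tm Γ .nat) : (suc s).subst σ = suc (s.subst σ) := rfl
theorem zero_subst : (zero : Tm Γ .nat).subst σ = zero := rfl
theorem zeroX_subst : (zeroX : Tm Γ .X).subst σ = zeroX := rfl
theorem addX_subst (x y : Tm Γ .X) : (addX x y).subst σ = addX (x.subst σ) (y.subst σ) := rfl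
theorem negX_subst (x : Tm Γ .X) : (negX x).subst σ = negX (x.subst σ) := rfl
theorem subX_subst (x y : Tm Γ .X) : (subX x y).subst σ = subX (x.subst σ) (y.subst σ) := rfl
theorem smulX_subst (a : Tm Γ .fn) (x : Tm Γ .X) :
    (smulX a x).subst σ = smulX (a.subst σ) (x.subst σ) := rfl
theorem normX_subst (x : Tm Γ .X) : (normX x).subst σ = normX (x.subst σ) := rfl
theorem innerX_subst (x y : Tm Γ .X) :
    (innerX x y).subst σ = innerX (x.subst σ) (y.subst σ) := rfl
theorem addR_subst (f g : Tm Γ .fn) : (addR f g).subst σ = addR (f.subst σ) (g.subst σ) := by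
  simp [addR, Tm.cl_subst]
theorem mulR_subst (f g : Tm Γ .fn) : (mulR f g).subst σ = mulR (f.subst σ) (g.subst σ) := by
  simp [mulR, Tm.cl_subst]
theorem negR_subst (f : Tm Γ .fn) : (negR f).subst σ = negR (f.subst σ) := by
  simp [negR, Tm.cl_subst]
theorem absR_subst (f : Tm Γ .fn) : (absR f).subst σ = absR (f.subst σ) := by
  simp [absR, Tm.cl_subst]
theorem subR_subst (f g : Tm Γ .fn) : (subR f g).subst σ = subR (f.subst σ) (g.subst σ) := by
  simp [subR, addR_subst, negR_subst]
theorem zeroR_subst : (zeroR : Tm Γ .fn).subst σ = zeroR := by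
  simp [zeroR, constR, zeroQ, mkQ, pair, int, pred, num, suc, zero, Tm.cl_subst]
theorem oneR_subst : (oneR : Tm Γ .fn).subst σ = oneR := by
  simp [oneR, constR, oneQ, mkQ, pair, int, pred, num, suc, zero, Tm.cl_subst]

end

/-- Each axiom is a schema over arbitrary terms in an arbitrary context, so a substituted instance
is again an instance. Only induction and choice contain substitutions of their own, which have to be
commuted with the given one. -/
theorem PAwX.subst {Γ Δ : Ctx} (σ : Sub Γ Δ) {A : Fm Γ} (h : PAwX Γ A) : PAwX Δ (A.subst σ) := by
  cases h with
  | qf_ind A hA =>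
    have := PAwX.qf_ind (A.subst (liftSubst .nat σ)) (hA.subst _)
    simpa only [Fm.subst, Fm.inst_subst, replSubst_comp, zero_subst] using this
  | qf_ac A hA =>
    have := PAwX.qf_ac (A.subst (liftSubst _ (liftSubst _ σ))) (hA.subst _)
    simpa only [Fm.subst, Fm.ex, Fm.neg, choiceSubst_comp] using this
  | eq_refl a => exact .eq_refl (a.subst σ)
  | eq_symm a b => exact .eq_symm (a.subst σ) (b.subst σ)
  | eq_trans a b c => exact .eq_trans (a.subst σ) (b.subst σ) (c.subst σ)
  | succ_ne_zero a => exact .succ_ne_zero (a.subst σ)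
  | succ_inj a b => exact .succ_inj (a.subst σ) (b.subst σ)
  | K_ax a b => rw [eqT_subst]; exact .K_ax (a.subst σ) (b.subst σ)
  | S_ax a b c => rw [eqT_subst]; exact .S_ax (a.subst σ) (b.subst σ) (c.subst σ)
  | recN_zero a b => exact .recN_zero (a.subst σ) (b.subst σ)
  | recN_succ a b c => exact .recN_succ (a.subst σ) (b.subst σ) (c.subst σ)
  | recX_zero a b => rw [eqX_subst]; exact .recX_zero (a.subst σ) (b.subst σ)
  | recX_succ a b c => rw [eqX_subst]; exact .recX_succ (a.subst σ) (b.subst σ) (c.subst σ)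
  | addX_assoc a b c => rw [eqX_subst]; exact .addX_assoc (a.subst σ) (b.subst σ) (c.subst σ)
  | addX_comm a b => rw [eqX_subst]; exact .addX_comm (a.subst σ) (b.subst σ)
  | addX_zero a => rw [eqX_subst]; exact .addX_zero (a.subst σ)
  | addX_neg a => rw [eqX_subst]; exact .addX_neg (a.subst σ)
  | one_smul a =>
    simp only [eqX_subst, smulX_subst, oneR_subst]
    exact .one_smul (a.subst σ)
  | mul_smul a b c =>
    simp only [eqX_subst, smulX_subst, mulR_subst]
    exact .mul_smul (a.subst σ) (b.subst σ) (c.subst σ)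
  | smul_add a b c =>
    simp only [eqX_subst, smulX_subst, addX_subst]
    exact .smul_add (a.subst σ) (b.subst σ) (c.subst σ)
  | add_smul a b c =>
    simp only [eqX_subst, smulX_subst, addX_subst, addR_subst]
    exact .add_smul (a.subst σ) (b.subst σ) (c.subst σ)
  | norm_self a =>
    simp only [eqR_subst, normX_subst, subX_subst, zeroR_subst]
    exact .norm_self (a.subst σ)
  | norm_symm a b =>
    simp only [eqR_subst, normX_subst, subX_subst]
    exact .norm_symm (a.subst σ) (b.subst σ)
  | norm_triangle a b c =>
    simp only [leR_subst, normX_subst, subX_subst, addR_subst]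
    exact .norm_triangle (a.subst σ) (b.subst σ) (c.subst σ)
  | norm_smul a b c =>
    simp only [eqR_subst, normX_subst, subX_subst, smulX_subst, mulR_subst, absR_subst]
    exact .norm_smul (a.subst σ) (b.subst σ) (c.subst σ)
  | norm_smul_sub a b c =>
    simp only [eqR_subst, normX_subst, subX_subst, smulX_subst, mulR_subst, absR_subst, subR_subst]
    exact .norm_smul_sub (a.subst σ) (b.subst σ) (c.subst σ)
  | norm_add_sub a b c d =>
    simp only [leR_subst, normX_subst, subX_subst, addX_subst, addR_subst]
    exact .norm_add_sub (a.subst σ) (b.subst σ) (c.subst σ) (d.subst σ)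
  | norm_neg_sub a b =>
    simp only [eqR_subst, normX_subst, subX_subst, negX_subst]
    exact .norm_neg_sub (a.subst σ) (b.subst σ)
  | norm_sub_norm a b =>
    simp only [leR_subst, absR_subst, subR_subst, normX_subst, subX_subst]
    exact .norm_sub_norm (a.subst σ) (b.subst σ)
  | norm_nonneg a =>
    simp only [leR_subst, zeroR_subst, normX_subst]
    exact .norm_nonneg (a.subst σ)
  | inner_self a =>
    simp only [eqR_subst, innerX_subst, mulR_subst, normX_subst]
    exact .inner_self (a.subst σ)
  | inner_symm a b =>
    simp only [eqR_subst, innerX_subst]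
    exact .inner_symm (a.subst σ) (b.subst σ)
  | inner_add a b c =>
    simp only [eqR_subst, innerX_subst, addX_subst, addR_subst]
    exact .inner_add (a.subst σ) (b.subst σ) (c.subst σ)
  | inner_smul a b c =>
    simp only [eqR_subst, innerX_subst, smulX_subst, mulR_subst]
    exact .inner_smul (a.subst σ) (b.subst σ) (c.subst σ)

/-- Derivability from the axioms of the theory, without collection. -/
abbrev Prv {Γ : Ctx} (H : List (Fm Γ)) (A : Fm Γ) : Prop := Der PAwX H A

/-! ### Structural properties of derivability. -/

theorem Der.mono {T T' : ∀ Γ : Ctx, Fm Γ → Prop} (hT : ∀ Γ A, T Γ A → T' Γ A) {Γ : Ctx}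
    {H : List (Fm Γ)} {A : Fm Γ} (h : Der T H A) : Der T' H A := by
  induction h with
  | ax h => exact .ax (hT _ _ h)
  | hyp h => exact .hyp h
  | impI _ ih => exact .impI ih
  | impE _ _ ih₁ ih₂ => exact .impE ih₁ ih₂
  | raa _ ih => exact .raa ih
  | allI _ ih => exact .allI ih
  | allE s _ ih => exact .allE s ih
  | qf_er hA r _ ih => exact .qf_er hA r ih

theorem Der.weaken {T : ∀ Γ : Ctx, Fm Γ → Prop} {Γ : Ctx} {H H' : List (Fm Γ)} {A : Fm Γ}
    (h : Der T H A) (hH : H ⊆ H') : Der T H' A := by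
  induction h with
  | ax h => exact .ax h
  | hyp h => exact .hyp (hH h)
  | impI _ ih => exact .impI (ih (List.cons_subset_cons _ hH))
  | impE _ _ ih₁ ih₂ => exact .impE (ih₁ hH) (ih₂ hH)
  | raa _ ih => exact .raa (ih (List.cons_subset_cons _ hH))
  | allI _ ih => exact .allI (ih (List.map_subset _ hH))
  | allE s _ ih => exact .allE s (ih hH)
  | qf_er hA r h _ => exact .qf_er hA r h

/-- Free variables act universally. The extensionality rule survives substitution because its
premise has no assumptions before and none after. This lemma moves derivations from one Henkin stage
to the next and into arbitrary environments. -/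
theorem Prv.subst {Γ Δ : Ctx} {H : List (Fm Γ)} {A : Fm Γ} (h : Prv H A) (σ : Sub Γ Δ) :
    Prv (H.map (Fm.subst σ)) (A.subst σ) := by
  induction h generalizing Δ with
  | ax h => exact .ax (h.subst σ)
  | hyp h => exact .hyp (List.mem_map_of_mem h)
  | impI _ ih => exact .impI (ih σ)
  | impE _ _ ih₁ ih₂ => exact .impE (ih₁ σ) (ih₂ σ)
  | raa _ ih => exact .raa (ih σ)
  | @allI Γ H ρ A _ ih =>
    refine .allI ?_
    have := ih (liftSubst ρ σ)
    rw [List.map_map] at this ⊢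
    convert this using 2
    funext B
    exact (Fm.wk_subst_lift σ ρ B).symm
  | allE s _ ih =>
    rw [Fm.inst_subst]
    exact .allE _ (ih σ)
  | qf_er hA r _ ih =>
    have h := ih σ
    simp only [Fm.subst, eqT_subst, Tm.inst_subst] at h ⊢
    exact .qf_er (hA.subst σ) _ h

theorem Prv.wk {Γ : Ctx} {H : List (Fm Γ)} {A : Fm Γ} (h : Prv H A) (ρ : Ty) :
    Prv (H.map (Fm.wk (ρ := ρ))) A.wk := h.subst _

end FinTypeArith

namespace FinTypeArith

/-! ## Countability of the syntax -/

def Ty.code : Ty → ℕ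
  | .nat => 0
  | .X => 1
  | .arr ρ τ => Nat.pair ρ.code τ.code + 2

theorem Ty.code_injective : Function.Injective Ty.code := by
  intro ρ
  induction ρ with
  | nat => rintro (_ | _ | _) h <;> simp_all [Ty.code]
  | X => rintro (_ | _ | _) h <;> simp_all [Ty.code]
  | arr ρ τ ihρ ihτ =>
    rintro (_ | _ | ⟨ρ', τ'⟩) h
    · simp [Ty.code] at h
    · simp [Ty.code] at h
    · simp only [Ty.code, Nat.add_right_cancel_iff, Nat.pair_eq_pair] at h
      rw [ihρ h.1, ihτ h.2]

instance : Nonempty Ty := ⟨.nat⟩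

instance : Countable Ty := Ty.code_injective.countable

def Var.idx : {Γ : Ctx} → {ρ : Ty} → Var Γ ρ → ℕ
  | _, _, .vz => 0
  | _, _, .vs v => v.idx + 1

theorem Var.eq_of_idx {Γ : Ctx} {ρ τ : Ty} (v : Var Γ ρ) (w : Var Γ τ) (h : v.idx = w.idx) :
    (⟨ρ, v⟩ : Σ ρ, Var Γ ρ) = ⟨τ, w⟩ := by
  induction v with
  | vz => cases w with
    | vz => rfl
    | vs w => simp [Var.idx] at h
  | vs v ih => cases w with
    | vz => simp [Var.idx] at h
    | vs w =>
      have := ih w (by simpa [Var.idx] using h)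
      cases this
      rfl

instance : Countable (Σ ρ, Cst ρ) := by
  let f : Fin 10 ⊕ (Ty × Ty) ⊕ (Ty × Ty × Ty) → Σ ρ, Cst ρ
    | .inl i => ![⟨_, .zero⟩, ⟨_, .succ⟩, ⟨_, .recN⟩, ⟨_, .recX⟩, ⟨_, .zeroX⟩, ⟨_, .addX⟩,
        ⟨_, .negX⟩, ⟨_, .smulX⟩, ⟨_, .normX⟩, ⟨_, .innerX⟩] i
    | .inr (.inl p) => ⟨_, .K p.1 p.2⟩
    | .inr (.inr p) => ⟨_, .S p.1 p.2.1 p.2.2⟩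
  refine Function.Surjective.countable (f := f) ?_
  rintro ⟨_, c⟩
  cases c with
  | zero => exact ⟨.inl 0, rfl⟩
  | succ => exact ⟨.inl 1, rfl⟩
  | K ρ τ => exact ⟨.inr (.inl (ρ, τ)), rfl⟩
  | S δ ρ τ => exact ⟨.inr (.inr (δ, ρ, τ)), rfl⟩
  | recN => exact ⟨.inl 2, rfl⟩
  | recX => exact ⟨.inl 3, rfl⟩
  | zeroX => exact ⟨.inl 4, rfl⟩
  | addX => exact ⟨.inl 5, rfl⟩
  | negX => exact ⟨.inl 6, rfl⟩
  | smulX => exact ⟨.inl 7, rfl⟩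
  | normX => exact ⟨.inl 8, rfl⟩
  | innerX => exact ⟨.inl 9, rfl⟩

theorem exists_cst_code : ∃ f : (Σ ρ, Cst ρ) → ℕ, Function.Injective f :=
  Countable.exists_injective_nat _

noncomputable def Cst.code {ρ : Ty} (c : Cst ρ) : ℕ := exists_cst_code.choose ⟨ρ, c⟩

noncomputable def Tm.code {Γ : Ctx} : {ρ : Ty} → Tm Γ ρ → ℕ
  | _, .var v => 3 * v.idx
  | _, .con c => 3 * c.code + 1
  | _, .app f a => 3 * Nat.pair f.code a.code + 2

/-- The types are allowed to differ because an application hides its argument type: for two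
applications with equal codes, the agreement of these types is part of what has to be proved. -/
theorem Tm.eq_of_code {Γ : Ctx} {ρ τ : Ty} (s : Tm Γ ρ) (t : Tm Γ τ) (h : s.code = t.code) :
    (⟨ρ, s⟩ : Σ ρ, Tm Γ ρ) = ⟨τ, t⟩ := by
  induction s generalizing τ with
  | var v =>
    cases t with
    | var w =>
      simp only [Tm.code] at h
      have := Var.eq_of_idx v w (by omega)
      cases this
      rfl
    | con c => simp only [Tm.code] at h; omega
    | app f a => simp only [Tm.code] at h; omega
  | con c =>
    cases t with
    | var w => simp only [Tm.code] at h; omega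
    | con d =>
      simp only [Tm.code] at h
      have := exists_cst_code.choose_spec (a₁ := ⟨_, c⟩) (a₂ := ⟨_, d⟩)
        (show c.code = d.code by omega)
      cases this
      rfl
    | app f a => simp only [Tm.code] at h; omega
  | app f a ihf iha =>
    cases t with
    | var w => simp only [Tm.code] at h; omega
    | con d => simp only [Tm.code] at h; omega
    | app g b =>
      simp only [Tm.code] at h
      have h' : Nat.pair f.code a.code = Nat.pair g.code b.code := by omega
      rw [Nat.pair_eq_pair] at h'
      have h₁ := ihf g h'.1
      have h₂ := iha b h'.2
      cases h₁
      cases h₂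
      rfl

theorem Tm.code_injective {Γ : Ctx} {ρ : Ty} {s t : Tm Γ ρ} (h : s.code = t.code) : s = t := by
  simpa using Tm.eq_of_code s t h

noncomputable def Fm.code : {Γ : Ctx} → Fm Γ → ℕ
  | _, .eq s t => 4 * Nat.pair s.code t.code
  | _, .bot => 1
  | _, .imp A B => 4 * Nat.pair A.code B.code + 2
  | _, .all ρ A => 4 * Nat.pair ρ.code A.code + 3

theorem Fm.code_injective {Γ : Ctx} {A B : Fm Γ} (h : A.code = B.code) : A = B := by
  induction A with
  | eq s t =>
    cases B with
    | eq s' t' =>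
      simp only [Fm.code] at h
      have h' : Nat.pair s.code t.code = Nat.pair s'.code t'.code := by omega
      rw [Nat.pair_eq_pair] at h'
      rw [Tm.code_injective h'.1, Tm.code_injective h'.2]
    | _ => simp only [Fm.code] at h; omega
  | bot =>
    cases B with
    | bot => rfl
    | _ => simp only [Fm.code] at h; omega
  | imp A A' ih ih' =>
    cases B with
    | imp B B' =>
      simp only [Fm.code] at h
      have h' : Nat.pair A.code A'.code = Nat.pair B.code B'.code := by omega
      rw [Nat.pair_eq_pair] at h'
      rw [ih h'.1, ih' h'.2]
    | _ => simp only [Fm.code] at h; omega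
  | all ρ A ih =>
    cases B with
    | all τ B =>
      simp only [Fm.code] at h
      have h' : Nat.pair ρ.code A.code = Nat.pair τ.code B.code := by omega
      rw [Nat.pair_eq_pair] at h'
      obtain rfl := Ty.code_injective h'.1
      rw [ih h'.2]
    | _ => simp only [Fm.code] at h; omega

instance (Γ : Ctx) : Countable (Fm Γ) :=
  Function.Injective.countable (f := Fm.code) fun _ _ => Fm.code_injective

/-! ## The supply of variables -/

/-- The type of the `n`-th Henkin variable; every type occurs infinitely often. -/
noncomputable def henkinTy (n : ℕ) : Ty :=
  (exists_surjective_nat Ty).choose n.unpair.1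

/-- The first `n` Henkin variables. -/
@[reducible] noncomputable def henkinCtx : ℕ → Ctx
  | 0 => []
  | n + 1 => henkinTy n :: henkinCtx n

/-- Terms over all Henkin variables. -/
inductive HTm : Ty → Type
  | var (i : ℕ) : HTm (henkinTy i)
  | con {ρ : Ty} : Cst ρ → HTm ρ
  | app {ρ τ : Ty} : HTm (ρ ⇒ τ) → HTm ρ → HTm τ

/-- A closed term of each type. -/
def dfltTm {Γ : Ctx} : (ρ : Ty) → Tm Γ ρ
  | .nat => zero
  | .X => zeroX
  | .arr ρ τ => .con (.K τ ρ) ⬝ dfltTm τ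

/-- The `i`-th Henkin variable as a term over the first `n` ones. -/
noncomputable def henkinVar : (n i : ℕ) → Tm (henkinCtx n) (henkinTy i)
  -- A variable that does not exist yet is replaced by a closed default term; this is harmless, as
  -- only stages beyond `HTm.bound` are evaluated in earnest.
  | 0, _ => dfltTm _
  | n + 1, i => if h : i = n then h ▸ v0 else (henkinVar n i).wk

theorem henkinVar_self (n : ℕ) : henkinVar (n + 1) n = v0 := by simp [henkinVar]

theorem henkinVar_succ {n i : ℕ} (h : i < n) : henkinVar (n + 1) i = (henkinVar n i).wk := by
  simp [henkinVar, h.ne]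

namespace HTm

/-- The truncation to the first `n` variables. -/
noncomputable def trunc (n : ℕ) : {ρ : Ty} → HTm ρ → Tm (henkinCtx n) ρ
  | _, .var i => henkinVar n i
  | _, .con c => .con c
  | _, .app f a => .app (f.trunc n) (a.trunc n)

/-- From this stage on all variables of the term exist. The summand 1 appears because variable `i`
is created in passing from stage `i` to stage `i + 1`. -/
def bound : {ρ : Ty} → HTm ρ → ℕ
  | _, .var i => i + 1
  | _, .con _ => 0
  | _, .app f a => max f.bound a.bound

theorem trunc_succ {n : ℕ} {ρ : Ty} (s : HTm ρ) (h : s.bound ≤ n) :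
    s.trunc (n + 1) = (s.trunc n).wk := by
  induction s with
  | var i => exact henkinVar_succ h
  | con c => rfl
  | app f a ihf iha =>
    simp only [bound, max_le_iff] at h
    simp only [trunc, ihf h.1, iha h.2]
    rfl

end HTm

/-- Variables over the first `n` Henkin variables as terms over all of them. -/
noncomputable def henkinEmb : (n : ℕ) → ∀ τ, Var (henkinCtx n) τ → HTm τ
  | 0, _, v => nomatch v
  | n + 1, _, .vz => .var n
  | n + 1, _, .vs v => henkinEmb n _ v

/-- Past its bound a truncation loses nothing, so reading it back over all variables and truncating
anew has the same effect as truncating once. Hence the formula treated at stage `n` is the intended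
one, although it was listed over an earlier context. -/
theorem HTm.trunc_subst {k : ℕ} (n : ℕ) {ρ : Ty} (s : HTm ρ) (h : s.bound ≤ k) :
    (s.trunc k).subst (fun τ v => (henkinEmb k τ v).trunc n) = s.trunc n := by
  induction s with
  | var i =>
    simp only [bound] at h
    simp only [trunc]
    induction k with
    | zero => omega
    | succ k ih =>
      rcases Nat.lt_or_ge i k with hi | hi
      · rw [henkinVar_succ hi, Tm.wk, Tm.subst_subst]
        exact ih hi
      · obtain rfl : i = k := by omega
        rw [henkinVar_self]
        rfl
  | con c => rfl
  | app f a ihf iha =>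
    simp only [bound, max_le_iff] at h
    simp only [trunc, Tm.subst_app, ihf h.1, iha h.2]

abbrev HEnv (Γ : Ctx) : Type := ∀ τ, Var Γ τ → HTm τ

theorem HEnv.exists_bound {Γ : Ctx} (e : HEnv Γ) : ∃ n, ∀ τ v, (e τ v).bound ≤ n := by
  induction Γ with
  | nil => exact ⟨0, fun τ v => nomatch v⟩
  | cons ρ Γ ih =>
    obtain ⟨n, hn⟩ := ih fun τ v => e τ (.vs v)
    refine ⟨max n (e ρ .vz).bound, fun τ v => ?_⟩
    cases v with
    | vz => exact le_max_right _ _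
    | vs v => exact (hn τ v).trans (le_max_left _ _)

/-- The environment as a substitution into the first `n` variables. -/
noncomputable def HEnv.trunc {Γ : Ctx} (e : HEnv Γ) (n : ℕ) : Sub Γ (henkinCtx n) :=
  fun τ v => (e τ v).trunc n

def HEnv.cons {Γ : Ctx} {ρ : Ty} (d : HTm ρ) (e : HEnv Γ) : HEnv (ρ :: Γ)
  | _, .vz => d
  | _, .vs v => e _ v

theorem HEnv.trunc_cons {Γ : Ctx} {ρ : Ty} (d : HTm ρ) (e : HEnv Γ) (n : ℕ) :
    (e.cons d).trunc n = consSubst (d.trunc n) (e.trunc n) := by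
  funext τ v
  cases v <;> rfl

/-! ## The Henkin sequence -/

instance (ρ : Ty) : Nonempty (Σ k, Fm (ρ :: henkinCtx k)) := ⟨⟨0, .bot⟩⟩

/-- The formula treated at stage `n`. -/
noncomputable def henkinItem (n : ℕ) : Fm (henkinTy n :: henkinCtx n) :=
  let p := (exists_surjective_nat (Σ k, Fm (henkinTy n :: henkinCtx k))).choose n.unpair.2.unpair.1
  p.2.subst (liftSubst _ fun τ v => (henkinEmb p.1 τ v).trunc n)

/-- Every formula over every context is eventually treated, at a stage late enough for its
parameters to exist and with a fresh variable of the right type. -/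
theorem exists_henkinItem {ρ : Ty} (k : ℕ) (B : Fm (ρ :: henkinCtx k)) :
    ∃ n, k ≤ n ∧ ∃ h : henkinTy n = ρ, ∀ C : Fm (henkinTy n :: henkinCtx k), h ▸ C = B →
      henkinItem n = C.subst (liftSubst _ fun τ v => (henkinEmb k τ v).trunc n) := by
  obtain ⟨a, ha⟩ := (exists_surjective_nat Ty).choose_spec ρ
  obtain ⟨b, hb⟩ := (exists_surjective_nat (Σ k, Fm (ρ :: henkinCtx k))).choose_spec ⟨k, B⟩
  have hn : henkinTy (Nat.pair a (Nat.pair b k)) = ρ := by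
    simp [henkinTy, ha]
  -- The components select the type and the formula; the last one, `k`, is padding that only forces
  -- the stage to be at least `k`.
  refine ⟨Nat.pair a (Nat.pair b k),
    (Nat.right_le_pair b k).trans (Nat.right_le_pair a _), hn, fun C hC => ?_⟩
  -- The type is generalized so that the equality of types can be eliminated together with the cast.
  have key : ∀ ρ' (h : ρ' = ρ) (C : Fm (ρ' :: henkinCtx k)), h ▸ C = B → ∀ m, m = b →
      (exists_surjective_nat (Σ k, Fm (ρ' :: henkinCtx k))).choose m = ⟨k, C⟩ := by
    rintro _ rfl C rfl _ rfl
    exact hb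
  simp only [henkinItem]
  rw [key _ hn C hC _ (by simp)]

open Classical in
/-- At stage `n`, either the generalization of the treated formula is added, or the new variable
becomes a counterexample. -/
noncomputable def henkinHyp (A : Fm []) : (n : ℕ) → List (Fm (henkinCtx n))
  | 0 => [A.neg]
  | n + 1 =>
    (if Prv (.all _ (henkinItem n) :: henkinHyp A n) .bot then (henkinItem n).neg
      else (Fm.all _ (henkinItem n)).wk) :: (henkinHyp A n).map Fm.wk

theorem Prv.of_neg_bot {Γ : Ctx} {H : List (Fm Γ)} {A : Fm Γ} (h : Prv (A :: H) .bot) :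
    Prv H A.neg := .impI h

/-- Every type contains a closed term, so a fresh variable can be instantiated away and adding one
never creates an inconsistency. -/
theorem Prv.of_wk_bot {Γ : Ctx} {ρ : Ty} {H : List (Fm Γ)}
    (h : Prv (H.map (Fm.wk (ρ := ρ))) .bot) : Prv H .bot := by
  have := h.subst (instSubst (dfltTm ρ))
  rw [List.map_map] at this
  convert this using 1
  swap
  · rfl
  conv_lhs => rw [← List.map_id H]
  congr 1
  funext B
  exact (Fm.wk_inst B _).symm

variable {A : Fm []}

/-- If the counterexample added for the new variable led to a contradiction, generalizing over that
variable would derive the universal formula, which was rejected as inconsistent with the stage. -/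
theorem henkinHyp_consistent (hA : ¬ Prv [] A) (n : ℕ) : ¬ Prv (henkinHyp A n) .bot := by
  induction n with
  | zero => exact fun h => hA (.raa h)
  | succ n ih =>
    intro h
    rw [henkinHyp] at h
    split_ifs at h with hc
    · have h₁ : Prv (henkinHyp A n) (.all _ (henkinItem n)) := .allI (.raa h)
      exact ih (.impE (Prv.of_neg_bot hc) h₁)
    · exact hc (Prv.of_wk_bot (ρ := henkinTy n) h)

theorem henkinHyp_step {n : ℕ} {B : Fm (henkinCtx n)} (h : Prv (henkinHyp A n) B) :
    Prv (henkinHyp A (n + 1)) B.wk :=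
  (h.wk _).weaken (List.subset_cons_self _ _)

/-- Truth in the limit of the Henkin sequence. -/
def Forces (A : Fm []) {Γ : Ctx} (e : HEnv Γ) (B : Fm Γ) : Prop :=
  ∀ᶠ n in Filter.atTop, Prv (henkinHyp A n) (B.subst (e.trunc n))

/-- Once all variables of the environment exist, passing to a later stage merely weakens the
formula, so one successful stage decides all later ones. -/
theorem Forces.of_stage {Γ : Ctx} {e : HEnv Γ} {B : Fm Γ} {n : ℕ}
    (hn : ∀ τ v, (e τ v).bound ≤ n) (h : Prv (henkinHyp A n) (B.subst (e.trunc n))) :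
    Forces A e B := by
  refine Filter.eventually_atTop.2 ⟨n, fun m hm => ?_⟩
  induction m, hm using Nat.le_induction with
  | base => exact h
  | succ m hm ih =>
    have := henkinHyp_step ih
    rw [Fm.wk, Fm.subst_subst] at this
    convert this using 2
    funext τ v
    exact (e τ v).trunc_succ ((hn τ v).trans hm)

theorem Forces.of_prv {Γ : Ctx} {e : HEnv Γ} {B : Fm Γ} (h : Prv [] B) : Forces A e B :=
  Filter.Eventually.of_forall fun n => (h.subst (e.trunc n)).weaken (List.nil_subset _)

theorem Forces.mp {Γ : Ctx} {e : HEnv Γ} {B C : Fm Γ} (h : Forces A e (B ⇛ C))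
    (h' : Forces A e B) : Forces A e C := by
  filter_upwards [h, h'] with n h h'
  exact .impE h h'

theorem not_forces_bot (hA : ¬ Prv [] A) {Γ : Ctx} (e : HEnv Γ) : ¬ Forces A e .bot := fun h =>
  let ⟨n, hn⟩ := h.exists
  henkinHyp_consistent hA n hn

/-- This is both halves of the Henkin property at once: at the stage that treats the formula, either
its generalization becomes an assumption or the fresh variable refutes it. Completeness of the limit
theory follows by a vacuous quantifier. -/
theorem forces_all_or {Γ : Ctx} {ρ : Ty} (e : HEnv Γ) (B : Fm (ρ :: Γ)) :
    Forces A e (.all ρ B) ∨ ∃ d : HTm ρ, Forces A (e.cons d) B.neg := by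
  obtain ⟨k, hk⟩ := e.exists_bound
  obtain ⟨n, hkn, h, hn⟩ := exists_henkinItem k (B.subst (liftSubst ρ (e.trunc k)))
  subst h
  have hi := hn _ rfl
  rw [Fm.subst_subst, liftSubst_comp] at hi
  have he : (fun τ v => (e.trunc k τ v).subst fun τ v => (henkinEmb k τ v).trunc n) =
      e.trunc n := by
    funext τ v
    exact (e τ v).trunc_subst n (hk τ v)
  rw [he] at hi
  by_cases hc : Prv (.all _ (henkinItem n) :: henkinHyp A n) .bot
  · refine .inr ⟨.var n, Forces.of_stage (n := n + 1) ?_ ?_⟩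
    · rintro τ (_ | v)
      · exact le_rfl
      · exact (hk _ v).trans (hkn.trans n.le_succ)
    · refine .hyp ?_
      rw [henkinHyp, if_pos hc, hi]
      refine List.mem_cons.2 (.inl ?_)
      simp only [Fm.neg, Fm.subst]
      congr 2
      funext τ v
      cases v with
      | vz => exact henkinVar_self n
      | vs v => exact (e τ v).trunc_succ ((hk τ v).trans hkn)
  · refine .inl (Forces.of_stage (n := n + 1) (fun τ v => (hk τ v).trans (hkn.trans n.le_succ)) ?_)
    refine .hyp ?_
    rw [henkinHyp, if_neg hc, hi]
    refine List.mem_cons.2 (.inl ?_)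
    change _ = ((Fm.all (henkinTy n) B).subst (e.trunc n)).wk
    rw [Fm.wk, Fm.subst_subst]
    congr 1
    funext τ v
    exact (e τ v).trunc_succ ((hk τ v).trans hkn)

/-- The alternative of `forces_all_or` for a quantifier over a variable that does not occur. -/
theorem forces_or_neg {Γ : Ctx} (e : HEnv Γ) (B : Fm Γ) : Forces A e B ∨ Forces A e B.neg := by
  rcases forces_all_or (A := A) (ρ := .nat) e B.wk with h | ⟨d, h⟩
  · left
    filter_upwards [h] with n hn
    have := Der.allE zero hn
    rw [Fm.wk_subst_lift, Fm.wk_inst] at this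
    exact this
  · right
    filter_upwards [h] with n hn
    rw [HEnv.trunc_cons] at hn
    simp only [Fm.neg, Fm.subst, Fm.wk, Fm.subst_subst] at hn ⊢
    exact hn

theorem forces_imp_iff {Γ : Ctx} (e : HEnv Γ) (B C : Fm Γ) :
    Forces A e (B ⇛ C) ↔ (Forces A e B → Forces A e C) := by
  refine ⟨fun h h' => h.mp h', fun h => ?_⟩
  rcases forces_or_neg (A := A) e B with hB | hB
  · filter_upwards [h hB] with n hn
    exact .impI (hn.weaken (List.subset_cons_self _ _))
  · filter_upwards [hB] with n hn
    refine .impI (.raa ?_)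
    exact .impE (hn.weaken (by simp)) (.hyp (by simp))

theorem forces_all_iff (hA : ¬ Prv [] A) {Γ : Ctx} {ρ : Ty} (e : HEnv Γ) (B : Fm (ρ :: Γ)) :
    Forces A e (.all ρ B) ↔ ∀ d : HTm ρ, Forces A (e.cons d) B := by
  refine ⟨fun h d => ?_, fun h => ?_⟩
  · filter_upwards [h] with n hn
    have := Der.allE (d.trunc n) hn
    rwa [Fm.subst_lift_inst, ← HEnv.trunc_cons] at this
  · refine (forces_all_or e B).resolve_right ?_
    rintro ⟨d, hd⟩
    exact not_forces_bot hA (e.cons d) (hd.mp (h d))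

end FinTypeArith

namespace FinTypeArith

/-! ## Interpretations and completeness -/

/-- An applicative structure interpreting the constants. -/
structure Interp where
  D : Ty → Type
  app : ∀ {ρ τ : Ty}, D (ρ ⇒ τ) → D ρ → D τ
  con : ∀ {ρ : Ty}, Cst ρ → D ρ

namespace Interp

variable (M : Interp)

abbrev Env (Γ : Ctx) : Type := ∀ τ, Var Γ τ → M.D τ

variable {M}

def nil : M.Env [] := nofun

def cons {Γ : Ctx} {ρ : Ty} (d : M.D ρ) (e : M.Env Γ) : M.Env (ρ :: Γ)
  | _, .vz => d
  | _, .vs v => e _ v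

def eval {Γ : Ctx} (e : M.Env Γ) : {ρ : Ty} → Tm Γ ρ → M.D ρ
  | _, .var v => e _ v
  | _, .con c => M.con c
  | _, .app f a => M.app (eval e f) (eval e a)

/-- Satisfaction; prime formulas are interpreted by genuine equality. -/
def Sat : {Γ : Ctx} → M.Env Γ → Fm Γ → Prop
  | _, e, .eq s t => eval e s = eval e t
  | _, _, .bot => False
  | _, e, .imp A B => Sat e A → Sat e B
  | _, e, .all ρ A => ∀ d : M.D ρ, Sat (cons d e) A

theorem eval_subst {Γ Δ : Ctx} (e : M.Env Δ) (σ : Sub Γ Δ) {ρ : Ty} (t : Tm Γ ρ) :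
    eval e (t.subst σ) = eval (fun _ v => eval e (σ _ v)) t := by
  induction t with
  | var v => rfl
  | con c => rfl
  | app f a ihf iha => simp only [Tm.subst, eval, ihf, iha]

@[simp] theorem eval_wk {Γ : Ctx} {ρ τ : Ty} (d : M.D ρ) (e : M.Env Γ) (t : Tm Γ τ) :
    eval (cons d e) t.wk = eval e t := eval_subst _ _ _

theorem eval_cl {Γ : Ctx} {τ : Ty} (e : M.Env Γ) (t : Tm [] τ) :
    eval e t.cl = eval nil t := by
  rw [Tm.cl, eval_subst]
  congr 1
  funext τ v
  cases v

theorem cons_eval_lift {Γ Δ : Ctx} {ρ : Ty} (d : M.D ρ) (e : M.Env Δ) (σ : Sub Γ Δ) :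
    (fun τ v => eval (cons d e) (liftSubst ρ σ τ v)) = cons d fun τ v => eval e (σ τ v) := by
  funext τ v
  cases v with
  | vz => rfl
  | vs v => exact eval_wk d e _

theorem sat_subst {Γ Δ : Ctx} (e : M.Env Δ) (σ : Sub Γ Δ) (A : Fm Γ) :
    Sat e (A.subst σ) ↔ Sat (fun _ v => eval e (σ _ v)) A := by
  induction A generalizing Δ with
  | eq s t => simp only [Fm.subst, Sat, eval_subst]
  | bot => rfl
  | imp A B ihA ihB => simp only [Fm.subst, Sat, ihA, ihB]
  | all ρ A ih => simp only [Fm.subst, Sat, ih, cons_eval_lift]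

@[simp] theorem sat_neg {Γ : Ctx} (e : M.Env Γ) (A : Fm Γ) : Sat e A.neg ↔ ¬ Sat e A := Iff.rfl

@[simp] theorem sat_and {Γ : Ctx} (e : M.Env Γ) (A B : Fm Γ) :
    Sat e (A.and B) ↔ Sat e A ∧ Sat e B := by
  simp only [Fm.and, Fm.neg, Sat]; tauto

@[simp] theorem sat_iff {Γ : Ctx} (e : M.Env Γ) (A B : Fm Γ) :
    Sat e (A.iff B) ↔ (Sat e A ↔ Sat e B) := by
  simp only [Fm.iff, sat_and, Sat]; tauto

@[simp] theorem sat_ex {Γ : Ctx} {ρ : Ty} (e : M.Env Γ) (A : Fm (ρ :: Γ)) :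
    Sat e (.ex ρ A) ↔ ∃ d, Sat (cons d e) A := by
  simp only [Fm.ex, Fm.neg, Sat]
  exact not_forall_not

end Interp

/-- A model of all theorems in which terms are equal as soon as their extensional equality follows
provably from a true quantifier-free formula. -/
structure Model extends Interp where
  sound : ∀ {Γ : Ctx} {A : Fm Γ}, Prv [] A → ∀ e, Interp.Sat (M := toInterp) e A
  ext : ∀ {Γ : Ctx} {ρ : Ty} {A : Fm Γ} {s t : Tm Γ ρ}, A.QF → Prv [] (A ⇛ eqT ρ s t) →
    ∀ e, Interp.Sat (M := toInterp) e A → Interp.eval e s = Interp.eval e t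

/-! ### The term model -/

def HEnv.nil : HEnv [] := nofun

def HTm.eval {Γ : Ctx} (e : HEnv Γ) : {ρ : Ty} → Tm Γ ρ → HTm ρ
  | _, .var v => e _ v
  | _, .con c => .con c
  | _, .app f a => .app (eval e f) (eval e a)

theorem HTm.trunc_eval {Γ : Ctx} (e : HEnv Γ) (n : ℕ) {ρ : Ty} (t : Tm Γ ρ) :
    (HTm.eval e t).trunc n = t.subst (e.trunc n) := by
  induction t with
  | var v => rfl
  | con c => rfl
  | app f a ihf iha => simp only [HTm.eval, HTm.trunc, Tm.subst, ihf, iha]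

theorem HTm.eval_subst {Γ Δ : Ctx} (e : HEnv Δ) (σ : Sub Γ Δ) {ρ : Ty} (t : Tm Γ ρ) :
    HTm.eval e (t.subst σ) = HTm.eval (fun _ v => HTm.eval e (σ _ v)) t := by
  induction t with
  | var v => rfl
  | con c => rfl
  | app f a ihf iha => simp only [Tm.subst, HTm.eval, ihf, iha]

/-- Indiscernibility in numerical contexts. -/
def Indisc (A : Fm []) {ρ : Ty} (s t : HTm ρ) : Prop :=
  ∀ (Δ : Ctx) (r : Tm (ρ :: Δ) .nat) (e : HEnv Δ),
    ∀ᶠ n in Filter.atTop, Prv (henkinHyp A n)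
      (.eq ((HTm.eval (e.cons s) r).trunc n) ((HTm.eval (e.cons t) r).trunc n))

theorem Prv.eq_symm {Γ : Ctx} {H : List (Fm Γ)} {s t : Tm Γ .nat} (h : Prv H (.eq s t)) :
    Prv H (.eq t s) := .impE (.ax (.eq_symm _ _)) h

theorem Prv.eq_trans {Γ : Ctx} {H : List (Fm Γ)} {r s t : Tm Γ .nat} (h : Prv H (.eq r s))
    (h' : Prv H (.eq s t)) : Prv H (.eq r t) := .impE (.impE (.ax (.eq_trans _ _ _)) h) h'

variable {A : Fm []}

def indiscSetoid (A : Fm []) (ρ : Ty) : Setoid (HTm ρ) where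
  r := Indisc A
  iseqv :=
    { refl := fun _ _ _ _ => Filter.Eventually.of_forall fun _ => .ax (.eq_refl _)
      symm := fun h Δ r e => (h Δ r e).mono fun _ h => h.eq_symm
      trans := fun h h' Δ r e => by
        filter_upwards [h Δ r e, h' Δ r e] with n h h'
        exact h.eq_trans h' }

/-- Function and argument are exchanged one after the other, with the unchanged partner moved into
the environment of the numerical context. This is why contexts with further parameters are part of
the definition of `Indisc`. -/
theorem Indisc.app {ρ τ : Ty} {f f' : HTm (ρ ⇒ τ)} {a a' : HTm ρ} (hf : Indisc A f f')
    (ha : Indisc A a a') : Indisc A (f.app a) (f'.app a') := by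
  intro Δ r e
  have h₁ := hf (ρ :: Δ) (r.subst (consSubst (v0 ⬝ v1) fun _ v => .var (.vs (.vs v)))) (e.cons a)
  have h₂ := ha ((ρ ⇒ τ) :: Δ) (r.subst (consSubst (v1 ⬝ v0) fun _ v => .var (.vs (.vs v))))
    (e.cons f')
  simp only [HTm.eval_subst] at h₁ h₂
  have key₁ : ∀ (g : HTm (ρ ⇒ τ)) (b : HTm ρ),
      (fun δ v => HTm.eval ((e.cons b).cons g)
        (consSubst (v0 ⬝ v1) (fun _ v => .var (.vs (.vs v))) δ v)) = e.cons (g.app b) := by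
    intro g b
    funext δ v
    cases v <;> rfl
  have key₂ : ∀ (g : HTm (ρ ⇒ τ)) (b : HTm ρ),
      (fun δ v => HTm.eval ((e.cons g).cons b)
        (consSubst (v1 ⬝ v0) (fun _ v => .var (.vs (.vs v))) δ v)) = e.cons (g.app b) := by
    intro g b
    funext δ v
    cases v <;> rfl
  simp only [key₁] at h₁
  simp only [key₂] at h₂
  filter_upwards [h₁, h₂] with n h₁ h₂
  exact h₁.eq_trans h₂

def termInterp (A : Fm []) : Interp where
  D ρ := Quotient (indiscSetoid A ρ)
  app f a := Quotient.map₂ HTm.app (fun _ _ hf _ _ ha => Indisc.app hf ha) f a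
  con c := Quotient.mk _ (.con c)

/-- The class of a term. -/
def HTm.cls (A : Fm []) {ρ : Ty} (s : HTm ρ) : (termInterp A).D ρ := Quotient.mk _ s

theorem HTm.cls_surjective {ρ : Ty} (d : (termInterp A).D ρ) : ∃ s : HTm ρ, s.cls A = d :=
  Quotient.exists_rep d

def HEnv.cls (A : Fm []) {Γ : Ctx} (e : HEnv Γ) : (termInterp A).Env Γ := fun τ v => (e τ v).cls A

theorem HEnv.cls_surjective {Γ : Ctx} (e : (termInterp A).Env Γ) : ∃ e' : HEnv Γ, e'.cls A = e := by
  choose f hf using fun τ v => HTm.cls_surjective (e τ v)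
  exact ⟨f, funext fun τ => funext fun v => hf τ v⟩

theorem HEnv.cls_cons {Γ : Ctx} {ρ : Ty} (d : HTm ρ) (e : HEnv Γ) :
    (e.cons d).cls A = Interp.cons (d.cls A) (e.cls A) := by
  funext τ v
  cases v <;> rfl

theorem eval_cls {Γ : Ctx} (e : HEnv Γ) {ρ : Ty} (t : Tm Γ ρ) :
    Interp.eval (e.cls A) t = (HTm.eval e t).cls A := by
  induction t with
  | var v => rfl
  | con c => rfl
  | app f a ihf iha => simp only [Interp.eval, ihf, iha]; rfl

/-- The quantifier-free rule of extensionality is applied at a stage where the premise is derivable;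
the implication itself is a theorem, as the rule demands. The conclusion at type `0` is an equation
in an arbitrary numerical context, which is indiscernibility. -/
theorem indisc_of_forces {Γ : Ctx} {ρ : Ty} {B : Fm Γ} {s t : Tm Γ ρ} (hB : B.QF)
    (h : Prv [] (B ⇛ eqT ρ s t)) (e : HEnv Γ) (he : Forces A e B) :
    Indisc A (HTm.eval e s) (HTm.eval e t) := by
  intro Δ r e'
  filter_upwards [he] with n hn
  have h₁ := h.subst (e.trunc n)
  simp only [Fm.subst, eqT_subst] at h₁
  have h₂ := Der.qf_er (H := henkinHyp A n) (hB.subst _) (r.subst (liftSubst ρ (e'.trunc n))) h₁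
  have h₃ := Der.impE h₂ hn
  rw [Tm.subst_lift_inst, Tm.subst_lift_inst] at h₃
  simp only [HTm.trunc_eval, HEnv.trunc_cons]
  exact h₃

/-- At type `0` indiscernibility is no more than derivable equality, by the rule of extensionality
applied to x = y → x = y. This makes genuine equality the right reading of prime formulas. -/
theorem cls_eq_iff (s t : HTm .nat) :
    s.cls A = t.cls A ↔ ∀ᶠ n in Filter.atTop, Prv (henkinHyp A n) (.eq (s.trunc n) (t.trunc n)) := by
  refine ⟨fun h => (Quotient.exact h : Indisc A s t) [] v0 HEnv.nil, fun h => Quotient.sound ?_⟩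
  let e : HEnv [.nat, .nat] := HEnv.cons s (HEnv.cons t HEnv.nil)
  exact indisc_of_forces (B := .eq v0 v1) (s := v0) (t := v1) (by simp [Fm.QF])
    (.impI (.hyp (by simp [eqT]))) e h

/-- The truth lemma. The quantifier case uses that every element of the term model is the class of a
term over the Henkin variables. -/
theorem sat_cls (hA : ¬ Prv [] A) {Γ : Ctx} (e : HEnv Γ) (B : Fm Γ) :
    Interp.Sat (e.cls A) B ↔ Forces A e B := by
  induction B with
  | eq s t =>
    simp only [Interp.Sat, eval_cls, cls_eq_iff, HTm.trunc_eval]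
    rfl
  | bot => exact ⟨False.elim, not_forces_bot hA e⟩
  | imp B C ihB ihC => rw [Interp.Sat, ihB, ihC, forces_imp_iff]
  | all ρ B ih =>
    rw [Interp.Sat, forces_all_iff hA]
    refine ⟨fun h d => (ih _).1 ?_, fun h d => ?_⟩
    · rw [HEnv.cls_cons]
      exact h _
    · obtain ⟨d, rfl⟩ := HTm.cls_surjective d
      rw [← HEnv.cls_cons]
      exact (ih _).2 (h d)

def termModel (hA : ¬ Prv [] A) : Model where
  toInterp := termInterp A
  sound h e := by
    obtain ⟨e, rfl⟩ := HEnv.cls_surjective e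
    exact (sat_cls hA e _).2 (Forces.of_prv h)
  ext hB h e he := by
    obtain ⟨e, rfl⟩ := HEnv.cls_surjective e
    rw [eval_cls, eval_cls]
    exact Quotient.sound (indisc_of_forces hB h e ((sat_cls hA e _).1 he))

/-- If the sentence were underivable, the Henkin sequence would start from its negation, and the
term model would refute the sentence. -/
theorem prv_of_closed (h : ∀ (M : Model) (e : M.Env []), Interp.Sat e A) : Prv [] A := by
  by_contra hA
  have h₁ := (sat_cls hA HEnv.nil A).1 (h (termModel hA) (HEnv.cls A HEnv.nil))
  have h₂ : Forces A HEnv.nil A.neg := by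
    refine Forces.of_stage (n := 0) (fun _ v => nomatch v) (.hyp ?_)
    rw [henkinHyp]
    refine List.mem_singleton.2 ?_
    conv_rhs => rw [← Fm.subst_id A.neg]
    congr 1
    funext τ v
    cases v
  exact not_forces_bot hA _ (h₂.mp h₁)

/-- Completeness: what holds in all models is provable. -/
theorem prv_of_models {Γ : Ctx} {B : Fm Γ} (h : ∀ (M : Model) (e : M.Env Γ), Interp.Sat e B) :
    Prv [] B := by
  induction Γ with
  | nil => exact prv_of_closed h
  | cons ρ Γ ih =>
    have h₁ : Prv [] (Fm.all ρ B) := ih fun M e d => h M (Interp.cons d e)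
    have h₂ := Der.allE (H := []) v0 (h₁.wk ρ)
    rw [Fm.subst_lift_inst] at h₂
    convert h₂ using 1
    conv_lhs => rw [← Fm.subst_id B]
    congr 1
    funext τ v
    cases v <;> rfl

theorem provable_of_models {Γ : Ctx} {B : Fm Γ}
    (h : ∀ (M : Model) (e : M.Env Γ), Interp.Sat e B) : Provable B :=
  (prv_of_models h).mono fun _ _ => .inl

end FinTypeArith

namespace FinTypeArith

notation:80 f:80 " ⋆ " a:81 => Interp.app _ f a

namespace Model

open Interp

variable {M : Model}

/-! ## Arithmetic in a model -/

/-- With a trivially true premise, `ext` turns the pointwise equations of the axioms into identities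
of the model, so combinators and recursors can be rewritten at every type. -/
theorem eq_of_ax {Γ : Ctx} {ρ : Ty} {s t : Tm Γ ρ} (h : PAwX Γ (eqT ρ s t)) (e : M.Env Γ) :
    eval e s = eval e t :=
  M.ext (A := .bot ⇛ .bot) (by simp [Fm.QF]) (.impI (.ax h)) e id

@[simp] theorem K_app {ρ τ : Ty} (a : M.D ρ) (b : M.D τ) : M.con (.K ρ τ) ⋆ a ⋆ b = a :=
  eq_of_ax (PAwX.K_ax v0 v1) (cons a (cons b nil))

@[simp] theorem S_app {δ ρ τ : Ty} (f : M.D (δ ⇒ ρ ⇒ τ)) (g : M.D (δ ⇒ ρ)) (a : M.D δ) :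
    M.con (.S δ ρ τ) ⋆ f ⋆ g ⋆ a = f ⋆ a ⋆ (g ⋆ a) :=
  eq_of_ax (PAwX.S_ax v0 v1 v2) (cons f (cons g (cons a nil)))

@[simp] theorem eval_app {Γ : Ctx} {ρ τ : Ty} (e : M.Env Γ) (f : Tm Γ (ρ ⇒ τ)) (a : Tm Γ ρ) :
    eval e (f ⬝ a) = eval e f ⋆ eval e a := rfl

@[simp] theorem eval_con {Γ : Ctx} {ρ : Ty} (e : M.Env Γ) (c : Cst ρ) :
    eval e (.con c) = M.con c := rfl

@[simp] theorem eval_lam {Γ : Ctx} {ρ τ : Ty} (e : M.Env Γ) (t : Tm (ρ :: Γ) τ) (d : M.D ρ) :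
    eval e (lam t) ⋆ d = eval (cons d e) t := by
  induction t with
  | var v => cases v <;> simp [lam, Interp.eval, cons]
  | con c => simp [lam]
  | app f a ihf iha => simp only [lam, eval_app, eval_con, S_app, ihf, iha]

section
variable {Γ : Ctx} {ρ₀ ρ₁ ρ₂ ρ₃ : Ty} (e : M.Env Γ) (a : M.D ρ₀) (b : M.D ρ₁) (c : M.D ρ₂)
  (d : M.D ρ₃)
@[simp] theorem eval_v0 : eval (cons a e) v0 = a := rfl
@[simp] theorem eval_v1 : eval (cons a (cons b e)) v1 = b := rfl
@[simp] theorem eval_v2 : eval (cons a (cons b (cons c e))) v2 = c := rfl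
@[simp] theorem eval_v3 : eval (cons a (cons b (cons c (cons d e)))) v3 = d := rfl
end

variable (M) in
/-- The numbers of the model. -/
abbrev N : Type := M.D .nat

instance : Zero M.N := ⟨M.con .zero⟩

def S (n : M.N) : M.N := M.con .succ ⋆ n

@[simp] theorem eval_zero {Γ : Ctx} (e : M.Env Γ) : eval e zero = 0 := rfl
@[simp] theorem eval_suc {Γ : Ctx} (e : M.Env Γ) (s : Tm Γ .nat) :
    eval e (suc s) = S (eval e s) := rfl

theorem S_ne_zero (n : M.N) : S n ≠ 0 :=
  M.sound (.ax (PAwX.succ_ne_zero v0)) (cons n nil)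

theorem S_inj {m n : M.N} (h : S m = S n) : m = n :=
  M.sound (.ax (PAwX.succ_inj v0 v1)) (cons m (cons n nil)) h

/-- Quantifier-free induction. -/
theorem induction {Γ : Ctx} (e : M.Env Γ) (A : Fm (.nat :: Γ)) (hA : A.QF) {P : M.N → Prop}
    (hP : ∀ n, Sat (cons n e) A ↔ P n) (h0 : P 0) (hs : ∀ n, P n → P (S n)) (n : M.N) : P n := by
  have h := M.sound (.ax (PAwX.qf_ind A hA)) e
  have e0 : (fun τ v => eval e (instSubst zero τ v)) = cons (0 : M.N) e := by
    funext τ v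
    cases v <;> rfl
  have es : ∀ n : M.N, (fun τ v => eval (cons n e) (replSubst (suc v0) τ v)) = cons (S n) e := by
    intro n
    funext τ v
    cases v <;> rfl
  simp only [Sat, Fm.inst, sat_subst, e0, es, hP] at h
  exact h h0 hs n

/-- The recursor with numerical values. -/
def recNat (n a : M.N) (f : M.D (.nat ⇒ .nat ⇒ .nat)) : M.N := M.con .recN ⋆ n ⋆ a ⋆ f

@[simp] theorem recNat_zero (a : M.N) (f : M.D (.nat ⇒ .nat ⇒ .nat)) : recNat 0 a f = a :=
  M.sound (.ax (PAwX.recN_zero v0 v1)) (cons a (cons f nil))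

@[simp] theorem recNat_S (n a : M.N) (f : M.D (.nat ⇒ .nat ⇒ .nat)) :
    recNat (S n) a f = f ⋆ recNat n a f ⋆ n :=
  M.sound (.ax (PAwX.recN_succ v0 v1 v2)) (cons n (cons a (cons f nil)))

/-- Functions of the model need not be equal when they agree pointwise, so replacing the step
function of a recursion requires an induction. -/
theorem recNat_congr {f g : M.D (.nat ⇒ .nat ⇒ .nat)} (h : ∀ x y, f ⋆ x ⋆ y = g ⋆ x ⋆ y)
    (n a : M.N) : recNat n a f = recNat n a g := by
  refine M.induction (P := fun n => recNat n a f = recNat n a g) (cons a (cons f (cons g nil)))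
    (.eq (.con .recN ⬝ v0 ⬝ v1 ⬝ v2) (.con .recN ⬝ v0 ⬝ v1 ⬝ v3)) trivial (fun n => Iff.rfl)
    (by simp) (fun n ih => ?_) n
  rw [recNat_S, recNat_S, ih, h]

@[simp] theorem eval_prim {Γ : Ctx} (e : M.Env Γ) (n a : Tm Γ .nat)
    (s : Tm (.nat :: .nat :: Γ) .nat) :
    eval e (prim n a s) = recNat (eval e n) (eval e a) (eval e (lam (lam s))) := rfl

instance : Add M.N := ⟨fun a b => eval nil addC ⋆ a ⋆ b⟩
instance : Mul M.N := ⟨fun a b => eval nil mulC ⋆ a ⋆ b⟩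
instance : One M.N := ⟨S 0⟩

def pred (a : M.N) : M.N := eval nil predC ⋆ a
def monus (a b : M.N) : M.N := eval nil monusC ⋆ a ⋆ b

section
variable {Γ : Ctx} (e : M.Env Γ) (s t : Tm Γ .nat)
@[simp] theorem eval_add : eval e (add s t) = eval e s + eval e t := by
  simp only [add, eval_app, eval_cl]; rfl
@[simp] theorem eval_mul : eval e (mul s t) = eval e s * eval e t := by
  simp only [mul, eval_app, eval_cl]; rfl
@[simp] theorem eval_pred : eval e (FinTypeArith.pred s) = pred (eval e s) := by
  simp only [FinTypeArith.pred, eval_app, eval_cl]; rfl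
@[simp] theorem eval_monus : eval e (FinTypeArith.monus s t) = monus (eval e s) (eval e t) := by
  simp only [FinTypeArith.monus, eval_app, eval_cl]; rfl
@[simp] theorem eval_one : eval e (num 1) = 1 := rfl
end

theorem add_def (a b : M.N) :
    a + b = recNat b a (eval (cons b (cons a nil)) (lam (lam (suc v1)))) := by
  change eval nil addC ⋆ a ⋆ b = _
  simp [addC]

theorem add_zero' (a : M.N) : a + 0 = a := by simp [add_def]

theorem add_S (a b : M.N) : a + S b = S (a + b) := by
  simp only [add_def, recNat_S, eval_lam, eval_suc, eval_v1]
  exact congrArg S (recNat_congr (by simp) _ _)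

theorem mul_def (a b : M.N) :
    a * b = recNat b 0 (eval (cons b (cons a nil)) (lam (lam (add v1 v3)))) := by
  change eval nil mulC ⋆ a ⋆ b = _
  simp [mulC]

theorem mul_zero' (a : M.N) : a * 0 = 0 := by simp [mul_def]

theorem mul_S (a b : M.N) : a * S b = a * b + a := by
  simp only [mul_def, recNat_S, eval_lam, eval_add, eval_v1, eval_v3]
  exact congrArg (· + a) (recNat_congr (by simp) _ _)

@[simp] theorem pred_zero : pred (0 : M.N) = 0 := by simp [pred, predC]
@[simp] theorem pred_S (a : M.N) : pred (S a) = a := by simp [pred, predC]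

theorem monus_def (a b : M.N) :
    monus a b = recNat b a (eval (cons b (cons a nil)) (lam (lam (FinTypeArith.pred v1)))) := by
  simp [monus, monusC]

@[simp] theorem monus_zero (a : M.N) : monus a 0 = a := by simp [monus_def]

theorem monus_S (a b : M.N) : monus a (S b) = pred (monus a b) := by
  simp only [monus_def, recNat_S, eval_lam, eval_pred, eval_v1]
  exact congrArg pred (recNat_congr (by simp) _ _)

/-- The predecessor is named by `pred` instead of being quantified, which keeps the induction
formula quantifier-free. -/
theorem eq_zero_or_S (n : M.N) : n = 0 ∨ n = S (pred n) := by
  by_cases h : n = 0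
  · exact .inl h
  · refine .inr (M.induction (P := fun n => n ≠ 0 → n = S (pred n)) nil
      (Fm.neg (.eq v0 zero) ⇛ .eq v0 (suc (FinTypeArith.pred v0))) (by simp [Fm.QF, Fm.neg])
      (fun n => by simp [Sat]) (fun h => (h rfl).elim) (fun n _ _ => by simp) n h)

theorem zero_add' (n : M.N) : 0 + n = n :=
  M.induction (P := fun n => 0 + n = n) nil (.eq (add zero v0) v0) trivial
    (fun n => by simp [Sat]) (add_zero' 0) (fun n ih => by rw [add_S, ih]) n

theorem S_add (a b : M.N) : S a + b = S (a + b) :=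
  M.induction (P := fun b => S a + b = S (a + b)) (cons a nil)
    (.eq (add (suc v1) v0) (suc (add v1 v0))) trivial
    (fun n => by simp [Sat]) (by simp [add_zero']) (fun n ih => by rw [add_S, add_S, ih]) b

theorem add_comm' (a b : M.N) : a + b = b + a :=
  M.induction (P := fun b => a + b = b + a) (cons a nil) (.eq (add v1 v0) (add v0 v1)) trivial
    (fun n => by simp [Sat]) (by rw [add_zero', zero_add'])
    (fun n ih => by rw [add_S, S_add, ih]) b

theorem add_assoc' (a b c : M.N) : a + b + c = a + (b + c) :=
  M.induction (P := fun c => a + b + c = a + (b + c)) (cons a (cons b nil))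
    (.eq (add (add v1 v2) v0) (add v1 (add v2 v0))) trivial
    (fun n => by simp [Sat]) (by simp only [add_zero'])
    (fun n ih => by rw [add_S, add_S, add_S, ih]) c

instance : AddCommMonoid M.N where
  add_assoc := add_assoc'
  zero_add := zero_add'
  add_zero := add_zero'
  add_comm := add_comm'
  nsmul := nsmulRec

theorem S_eq (a : M.N) : S a = a + 1 := by
  change S a = a + S 0
  rw [add_S, add_zero]

theorem zero_mul' (n : M.N) : 0 * n = 0 :=
  M.induction (P := fun n => 0 * n = 0) nil (.eq (mul zero v0) zero) trivial
    (fun n => by simp [Sat]) (mul_zero' 0) (fun n ih => by rw [mul_S, ih, add_zero]) n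

theorem S_mul (a b : M.N) : S a * b = a * b + b :=
  M.induction (P := fun b => S a * b = a * b + b) (cons a nil)
    (.eq (mul (suc v1) v0) (add (mul v1 v0) v0)) trivial
    (fun n => by simp [Sat]) (by simp only [mul_zero', add_zero])
    (fun n ih => by simp only [mul_S, add_S, ih]; rw [add_right_comm]) b

theorem mul_comm' (a b : M.N) : a * b = b * a :=
  M.induction (P := fun b => a * b = b * a) (cons a nil) (.eq (mul v1 v0) (mul v0 v1)) trivial
    (fun n => by simp [Sat]) (by rw [mul_zero', zero_mul'])
    (fun n ih => by rw [mul_S, S_mul, ih]) b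

theorem mul_add' (a b c : M.N) : a * (b + c) = a * b + a * c :=
  M.induction (P := fun c => a * (b + c) = a * b + a * c) (cons a (cons b nil))
    (.eq (mul v1 (add v2 v0)) (add (mul v1 v2) (mul v1 v0))) trivial
    (fun n => by simp [Sat]) (by simp only [mul_zero', add_zero])
    (fun n ih => by rw [add_S, mul_S, mul_S, ih, add_assoc]) c

theorem mul_assoc' (a b c : M.N) : a * b * c = a * (b * c) :=
  M.induction (P := fun c => a * b * c = a * (b * c)) (cons a (cons b nil))
    (.eq (mul (mul v1 v2) v0) (mul v1 (mul v2 v0))) trivial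
    (fun n => by simp [Sat]) (by simp only [mul_zero'])
    (fun n ih => by rw [mul_S, mul_S, ih, mul_add']) c

theorem mul_one' (a : M.N) : a * 1 = a := by
  change a * S 0 = a
  rw [mul_S, mul_zero', zero_add]

instance : CommSemiring M.N where
  left_distrib := mul_add'
  right_distrib a b c := by rw [mul_comm', mul_add', mul_comm' c, mul_comm' c]
  zero_mul := zero_mul'
  mul_zero := mul_zero'
  mul_assoc := mul_assoc'
  one_mul a := by rw [mul_comm', mul_one']
  mul_one := mul_one'
  mul_comm := mul_comm'

instance : IsCancelAdd M.N :=
  have h : ∀ a b c : M.N, a + c = b + c → a = b := fun a b c =>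
    M.induction (P := fun c => a + c = b + c → a = b) (cons a (cons b nil))
      (.eq (add v1 v0) (add v2 v0) ⇛ .eq v1 v2) ⟨trivial, trivial⟩
      (fun n => by simp [Sat]) (by simp)
      (fun n ih h => ih (S_inj (by simpa only [add_S] using h))) c
  have : IsRightCancelAdd M.N := ⟨fun c a b => h a b c⟩
  { AddCommMagma.IsRightCancelAdd.toIsLeftCancelAdd M.N with }

/-! ### Truncated subtraction and the ordered semiring of numbers. -/

theorem S_monus_S (a b : M.N) : monus (S a) (S b) = monus a b :=
  M.induction (P := fun b => monus (S a) (S b) = monus a b) (cons a nil)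
    (.eq (FinTypeArith.monus (suc v1) (suc v0)) (FinTypeArith.monus v1 v0)) trivial
    (fun n => by simp [Sat]) (by simp [monus_S])
    (fun n ih => by rw [monus_S, ih, ← monus_S]) b

theorem add_monus (a b : M.N) : monus (a + b) b = a :=
  M.induction (P := fun b => monus (a + b) b = a) (cons a nil)
    (.eq (FinTypeArith.monus (add v1 v0) v0) v1) trivial
    (fun n => by simp [Sat]) (by simp) (fun n ih => by rw [add_S, S_monus_S, ih]) b

theorem monus_add (a b : M.N) : monus a (a + b) = 0 :=
  M.induction (P := fun b => monus a (a + b) = 0) (cons a nil)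
    (.eq (FinTypeArith.monus v1 (add v1 v0)) zero) trivial
    (fun n => by simp [Sat]) (by simpa using add_monus 0 a)
    (fun n ih => by rw [add_S, monus_S, ih, pred_zero]) b

theorem eq_add_monus_of_ne_zero {a b : M.N} (h : monus a b ≠ 0) : a = b + monus a b :=
  M.induction (P := fun b => monus a b ≠ 0 → a = b + monus a b) (cons a nil)
    (Fm.neg (.eq (FinTypeArith.monus v1 v0) zero) ⇛ .eq v1 (add v0 (FinTypeArith.monus v1 v0)))
    (by simp [Fm.QF, Fm.neg]) (fun n => by simp [Sat]) (by simp)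
    (fun n ih h => by
      rw [monus_S] at h ⊢
      have h' : monus a n ≠ 0 := fun h' => h (by rw [h', pred_zero])
      rw [S_add, ← add_S, ← (eq_zero_or_S (monus a n)).resolve_left h']
      exact ih h') b h

/-- The companion of `eq_add_monus_of_ne_zero`. In both cases the difference is given by a term, so
the claim is open to quantifier-free induction; together they make the order total. -/
theorem eq_add_of_monus_eq_zero {a b : M.N} (h : monus a b = 0) : b = a + monus b a :=
  M.induction (P := fun b => monus a b = 0 → b = a + monus b a) (cons a nil)
    (.eq (FinTypeArith.monus v1 v0) zero ⇛ .eq v0 (add v1 (FinTypeArith.monus v0 v1)))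
    (by simp [Fm.QF]) (fun n => by simp [Sat]) (fun h => by simp_all)
    (fun n ih h => by
      by_cases h' : monus a n = 0
      · have := ih h'
        have h₂ : S n = S (monus n a) + a := by rw [S_add, add_comm, ← this]
        rw [h₂, add_monus, add_comm]
      · have h₁ := eq_add_monus_of_ne_zero h'
        rw [monus_S] at h
        rw [(eq_zero_or_S (monus a n)).resolve_left h', h, add_S, add_zero] at h₁
        have h₂ := monus_add a 0
        rw [add_zero] at h₂
        rw [← h₁, h₂, add_zero]) b h

instance : LE M.N := ⟨fun a b => ∃ c, b = a + c⟩

/-- This trades the existential order for an equation, the form in which inequalities may enter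
quantifier-free induction. -/
theorem le_iff_monus {a b : M.N} : a ≤ b ↔ monus a b = 0 :=
  ⟨fun ⟨c, h⟩ => by rw [h, monus_add], fun h => ⟨_, eq_add_of_monus_eq_zero h⟩⟩

theorem eq_zero_of_add_eq_zero {a b : M.N} (h : a + b = 0) : a = 0 := by
  rcases eq_zero_or_S a with h' | h'
  · exact h'
  · rw [h', S_add] at h
    exact (S_ne_zero _ h).elim

noncomputable instance : LinearOrder M.N where
  le_refl a := ⟨0, (add_zero a).symm⟩
  le_trans := by
    rintro a _ _ ⟨c, rfl⟩ ⟨d, rfl⟩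
    exact ⟨c + d, add_assoc _ _ _⟩
  le_antisymm := by
    rintro a _ ⟨c, rfl⟩ ⟨d, h⟩
    rw [add_assoc, left_eq_add] at h
    rw [eq_zero_of_add_eq_zero h, add_zero]
  le_total a b := by
    by_cases h : monus a b = 0
    · exact .inl (le_iff_monus.2 h)
    · exact .inr ⟨_, eq_add_monus_of_ne_zero h⟩
  toDecidableLE := Classical.decRel _

instance : CanonicallyOrderedAdd M.N where
  exists_add_of_le h := h
  le_self_add _ b := ⟨b, rfl⟩
  le_add_self _ b := ⟨b, add_comm _ _⟩

instance : Nontrivial M.N := ⟨⟨1, 0, S_ne_zero 0⟩⟩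

theorem S_ne_self_add (a b : M.N) : a ≠ a + S b := fun h =>
  S_ne_zero b (left_eq_add.1 h)

theorem lt_iff_exists_add_S {a b : M.N} : a < b ↔ ∃ c, b = a + S c := by
  constructor
  · intro h
    obtain ⟨c, rfl⟩ := h.le
    rcases eq_zero_or_S c with rfl | hc
    · simp at h
    · exact ⟨pred c, by rw [← hc]⟩
  · rintro ⟨c, rfl⟩
    exact lt_of_le_of_ne ⟨_, rfl⟩ (S_ne_self_add a c)

instance : IsStrictOrderedRing M.N where
  add_le_add_left := by
    rintro a _ ⟨c, rfl⟩ d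
    exact ⟨c, add_right_comm _ _ _⟩
  le_of_add_le_add_left := by
    rintro a b c ⟨d, h⟩
    exact ⟨d, add_left_cancel (a := a) (by rw [h, add_assoc])⟩
  zero_le_one := ⟨1, (zero_add 1).symm⟩
  mul_lt_mul_of_pos_left := by
    intro a ha b c h
    rw [lt_iff_exists_add_S] at ha h ⊢
    obtain ⟨x, rfl⟩ := ha
    obtain ⟨y, rfl⟩ := h
    exact ⟨x * S y + y, by simp only [S_eq]; ring⟩
  mul_lt_mul_of_pos_right := by
    intro a ha b c h
    rw [lt_iff_exists_add_S] at ha h ⊢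
    obtain ⟨x, rfl⟩ := ha
    obtain ⟨y, rfl⟩ := h
    exact ⟨S y * x + y, by simp only [S_eq]; ring⟩

theorem S_le_iff {a b : M.N} : a + 1 ≤ b ↔ a < b := by
  rw [lt_iff_exists_add_S]
  constructor
  · rintro ⟨c, rfl⟩
    exact ⟨c, by rw [S_eq]; ring⟩
  · rintro ⟨c, rfl⟩
    exact ⟨c, by rw [S_eq]; ring⟩

theorem lt_S_iff {a b : M.N} : a < b + 1 ↔ a ≤ b := by
  rw [← S_le_iff]
  simp

end Model

end FinTypeArith

namespace FinTypeArith

namespace Model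

open Interp

variable {M : Model}

/-! ## Pairing and integers in a model -/

/-- Quantifier-free induction, with the successor written as a sum. -/
theorem induction_add_one {Γ : Ctx} (e : M.Env Γ) (A : Fm (.nat :: Γ)) (hA : A.QF)
    {P : M.N → Prop} (hP : ∀ n, Sat (cons n e) A ↔ P n) (h0 : P 0) (hs : ∀ n, P n → P (n + 1))
    (n : M.N) : P n :=
  M.induction e A hA hP h0 (fun n h => by rw [S_eq]; exact hs n h) n

@[simp] theorem recNat_add_one (n a : M.N) (f : M.D (.nat ⇒ .nat ⇒ .nat)) :
    recNat (n + 1) a f = f ⋆ recNat n a f ⋆ n := by rw [← S_eq, recNat_S]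

@[simp] theorem pred_add_one (a : M.N) : pred (a + 1) = a := by rw [← S_eq, pred_S]

theorem pred_add_cancel {a : M.N} (h : 0 < a) : pred a + 1 = a := by
  rw [← S_eq]
  exact ((eq_zero_or_S a).resolve_left h.ne').symm

theorem monus_eq_iff {a b c : M.N} (h : b ≤ a) : monus a b = c ↔ a = b + c := by
  obtain ⟨d, rfl⟩ := h
  rw [add_comm b d, add_monus, add_comm b c, add_left_inj]

def pow2 (a : M.N) : M.N := eval nil pow2C ⋆ a
def cond (a b c : M.N) : M.N := eval nil condC ⋆ a ⋆ b ⋆ c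
def tri (a : M.N) : M.N := eval nil triC ⋆ a
def pair (a b : M.N) : M.N := eval nil pairC ⋆ a ⋆ b
def root (a : M.N) : M.N := eval nil rootC ⋆ a
def fst (a : M.N) : M.N := eval nil fstC ⋆ a
def snd (a : M.N) : M.N := eval nil sndC ⋆ a
def par (a : M.N) : M.N := eval nil parC ⋆ a
def half (a : M.N) : M.N := eval nil halfC ⋆ a
def int (a b : M.N) : M.N := eval nil intC ⋆ a ⋆ b
def pos (a : M.N) : M.N := eval nil posC ⋆ a
def ngt (a : M.N) : M.N := eval nil ngtC ⋆ a

section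
variable {Γ : Ctx} (e : M.Env Γ) (r s t : Tm Γ .nat)
@[simp] theorem eval_pow2 : eval e (FinTypeArith.pow2 r) =
    pow2 (eval e r) := by
  simp only [FinTypeArith.pow2, eval_app, eval_cl]; rfl
@[simp] theorem eval_cond : eval e (FinTypeArith.cond r s t) =
    cond (eval e r) (eval e s) (eval e t) := by
  simp only [FinTypeArith.cond, eval_app, eval_cl]; rfl
@[simp] theorem eval_tri : eval e (FinTypeArith.tri r) =
    tri (eval e r) := by
  simp only [FinTypeArith.tri, eval_app, eval_cl]; rfl
@[simp] theorem eval_pair : eval e (FinTypeArith.pair r s) =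
    pair (eval e r) (eval e s) := by
  simp only [FinTypeArith.pair, eval_app, eval_cl]; rfl
@[simp] theorem eval_root : eval e (FinTypeArith.root r) =
    root (eval e r) := by
  simp only [FinTypeArith.root, eval_app, eval_cl]; rfl
@[simp] theorem eval_fst : eval e (FinTypeArith.fst r) =
    fst (eval e r) := by
  simp only [FinTypeArith.fst, eval_app, eval_cl]; rfl
@[simp] theorem eval_snd : eval e (FinTypeArith.snd r) =
    snd (eval e r) := by
  simp only [FinTypeArith.snd, eval_app, eval_cl]; rfl
@[simp] theorem eval_par : eval e (FinTypeArith.par r) =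
    par (eval e r) := by
  simp only [FinTypeArith.par, eval_app, eval_cl]; rfl
@[simp] theorem eval_half : eval e (FinTypeArith.half r) =
    half (eval e r) := by
  simp only [FinTypeArith.half, eval_app, eval_cl]; rfl
@[simp] theorem eval_int : eval e (FinTypeArith.int r s) =
    int (eval e r) (eval e s) := by
  simp only [FinTypeArith.int, eval_app, eval_cl]; rfl
@[simp] theorem eval_pos : eval e (FinTypeArith.pos r) =
    pos (eval e r) := by
  simp only [FinTypeArith.pos, eval_app, eval_cl]; rfl
@[simp] theorem eval_ngt : eval e (FinTypeArith.ngt r) =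
    ngt (eval e r) := by
  simp only [FinTypeArith.ngt, eval_app, eval_cl]; rfl
end

/-- The abstracted variable is the length of the recursion and also lies in the scope of the step.
The values at `n` and `n + 1` thus come from different step functions that agree pointwise, and
`recNat_congr` closes the gap. -/
theorem rec_lam {Γ : Ctx} (e : M.Env Γ) {z : Tm (.nat :: Γ) .nat}
    {s : Tm (.nat :: .nat :: .nat :: Γ) .nat} (a : M.N) (F : M.N → M.N → M.N)
    (hz : ∀ n, eval (cons n e) z = a)
    (hs : ∀ n x y, eval (cons y (cons x (cons n e))) s = F x y) :
    eval e (lam (prim v0 z s)) ⋆ 0 = a ∧ ∀ n,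
      eval e (lam (prim v0 z s)) ⋆ (n + 1) = F (eval e (lam (prim v0 z s)) ⋆ n) n := by
  simp only [eval_lam, eval_prim, eval_v0, hz, recNat_zero, recNat_add_one, hs, true_and]
  intro n
  rw [recNat_congr fun x y => ?_]
  simp [hs]

@[simp] theorem pow2_zero : pow2 (0 : M.N) = 1 := by simp [pow2, pow2C]

theorem pow2_add_one (a : M.N) : pow2 (a + 1) = pow2 a + pow2 a :=
  (rec_lam nil 1 (fun x _ => x + x) (by simp) (by simp)).2 a

@[simp] theorem cond_zero (a b : M.N) : cond 0 a b = a := by simp [cond, condC]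

theorem cond_of_ne_zero {c : M.N} (hc : c ≠ 0) (a b : M.N) : cond c a b = b := by
  rw [(eq_zero_or_S c).resolve_left hc, S_eq]
  simp [cond, condC]

@[simp] theorem tri_zero : tri (0 : M.N) = 0 := by simp [tri, triC]

theorem tri_add_one (a : M.N) : tri (a + 1) = tri a + (a + 1) :=
  (rec_lam nil 0 (fun x y => x + (y + 1)) (by simp) (by simp [S_eq])).2 a

theorem pair_eq (a b : M.N) : pair a b = tri (a + b) + a := by simp [pair, pairC]

@[simp] theorem root_zero : root (0 : M.N) = 0 := by simp [root, rootC]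

theorem root_add_one (a : M.N) :
    root (a + 1) = cond (monus (tri (root a + 1)) (a + 1)) (root a + 1) (root a) :=
  (rec_lam nil 0 (fun x y => cond (monus (tri (x + 1)) (y + 1)) (x + 1) x) (by simp)
    (by simp [S_eq])).2 a

theorem fst_eq (a : M.N) : fst a = monus a (tri (root a)) := by simp [fst, fstC]
theorem snd_eq (a : M.N) : snd a = monus (root a) (fst a) := by simp [snd, sndC]

@[simp] theorem par_zero : par (0 : M.N) = 0 := by simp [par, parC]

theorem par_add_one (a : M.N) : par (a + 1) = monus 1 (par a) :=
  (rec_lam nil 0 (fun x _ => monus 1 x) (by simp) (by simp)).2 a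

@[simp] theorem half_zero : half (0 : M.N) = 0 := by simp [half, halfC]

theorem half_add_one (a : M.N) : half (a + 1) = half a + par a :=
  (rec_lam nil 0 (fun x y => x + par y) (by simp) (by simp)).2 a

/-- Doubling avoids a division: twice the triangular number is n(n + 1), which is visibly monotone.
-/
theorem tri_mono {a b : M.N} (h : a ≤ b) : tri a ≤ tri b := by
  have h₂ : ∀ n : M.N, tri n + tri n = n * (n + 1) := fun n =>
    M.induction_add_one (P := fun n => tri n + tri n = n * (n + 1)) nil
      (.eq (add (FinTypeArith.tri v0) (FinTypeArith.tri v0)) (mul v0 (suc v0))) trivial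
      (fun n => by simp [Sat, S_eq]) (by simp)
      (fun n ih => by
        calc tri (n + 1) + tri (n + 1) = (tri n + tri n) + (n + 1) + (n + 1) := by
              rw [tri_add_one]; ring
          _ = (n + 1) * (n + 1 + 1) := by rw [ih]; ring) n
  by_contra! hlt
  have h₃ := add_lt_add hlt hlt
  rw [h₂, h₂] at h₃
  exact absurd (mul_le_mul' h (add_le_add_left h 1)) h₃.not_ge

/-- The root moves up by one exactly when the next triangular number is reached, so both bounds
persist through the induction. -/
theorem root_spec (a : M.N) : tri (root a) ≤ a ∧ a < tri (root a + 1) := by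
  rw [← S_le_iff, le_iff_monus, le_iff_monus]
  refine M.induction_add_one
    (P := fun a => monus (tri (root a)) a = 0 ∧ monus (a + 1) (tri (root a + 1)) = 0) nil
    (Fm.and (.eq (FinTypeArith.monus (FinTypeArith.tri (FinTypeArith.root v0)) v0) zero)
      (.eq (FinTypeArith.monus (suc v0) (FinTypeArith.tri (suc (FinTypeArith.root v0)))) zero))
    (by simp [Fm.QF, Fm.and, Fm.neg]) (fun n => by simp [Sat, S_eq]) ?_ ?_ a
  · simp only [root_zero, tri_add_one, ← le_iff_monus]
    simp
  · intro n
    simp only [← le_iff_monus, root_add_one]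
    rintro ⟨h₁, h₂⟩
    by_cases h : tri (root n + 1) ≤ n + 1
    · rw [le_iff_monus.1 h, cond_zero]
      refine ⟨h, ?_⟩
      rw [tri_add_one (root n + 1)]
      have := add_le_add h₂ (show (1 : M.N) ≤ root n + 1 + 1 from le_add_self)
      exact this
    · rw [cond_of_ne_zero (fun h' => h (le_iff_monus.2 h'))]
      rw [not_le] at h
      exact ⟨h₁.trans le_self_add, S_le_iff.2 h⟩

theorem root_eq {a w : M.N} (h₁ : tri w ≤ a) (h₂ : a < tri (w + 1)) : root a = w := by
  obtain ⟨h₃, h₄⟩ := root_spec a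
  refine le_antisymm ?_ ?_
  · by_contra! h
    exact absurd ((tri_mono (S_le_iff.2 h)).trans h₃) h₂.not_ge
  · by_contra! h
    exact absurd ((tri_mono (S_le_iff.2 h)).trans h₁) h₄.not_ge

theorem root_pair (a b : M.N) : root (pair a b) = a + b := by
  refine root_eq ?_ ?_
  · rw [pair_eq]; exact le_self_add
  · rw [pair_eq, tri_add_one, add_lt_add_iff_left, lt_S_iff]; exact le_self_add

@[simp] theorem fst_pair (a b : M.N) : fst (pair a b) = a := by
  rw [fst_eq, root_pair, pair_eq, add_comm, add_monus]

@[simp] theorem snd_pair (a b : M.N) : snd (pair a b) = b := by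
  rw [snd_eq, fst_pair, root_pair, add_comm, add_monus]

theorem le_pair (a b : M.N) : a ≤ pair a b := by
  rw [pair_eq]; exact le_add_self

theorem par_half_double (a : M.N) : par (a + a) = 0 ∧ half (a + a) = a := by
  refine M.induction_add_one (P := fun a => par (a + a) = 0 ∧ half (a + a) = a) nil
    (Fm.and (.eq (FinTypeArith.par (add v0 v0)) zero) (.eq (FinTypeArith.half (add v0 v0)) v0))
    (by simp [Fm.QF, Fm.and, Fm.neg]) (fun n => by simp [Sat]) (by simp) (fun n ih => ?_) a
  have h₁ : monus (1 : M.N) 1 = 0 := by simpa using monus_add (1 : M.N) 0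
  rw [show n + 1 + (n + 1) = n + n + 1 + 1 by ring, par_add_one, half_add_one, par_add_one,
    half_add_one, ih.1, ih.2]
  simp [h₁]

/-- The code of an integer. -/
theorem int_eq (a b : M.N) :
    (b ≤ a ∧ int a b = monus a b + monus a b) ∨
      (a < b ∧ int a b = pred (monus b a + monus b a)) := by
  have h : int a b = cond (monus b a) (monus a b + monus a b) (pred (monus b a + monus b a)) := by
    have h2 : ∀ {Γ : Ctx} (e : M.Env Γ) , eval e (num 2) = 2 := fun e => by
      change S (S 0) = 2
      rw [S_eq, S_eq, zero_add, one_add_one_eq_two]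
    simp [int, intC, h2, two_mul]
  rcases le_or_gt b a with hab | hab
  · exact .inl ⟨hab, by rw [h, le_iff_monus.1 hab, cond_zero]⟩
  · refine .inr ⟨hab, ?_⟩
    rw [h, cond_of_ne_zero fun h' => hab.not_ge (le_iff_monus.2 h')]

theorem pos_eq (r : M.N) : pos r = monus 1 (par (fst r)) * half (fst r) := by simp [pos, posC]
theorem ngt_eq (r : M.N) : ngt r = par (fst r) * half (fst r + 1) := by simp [ngt, ngtC, S_eq]

/-- A nonnegative difference k has the even code 2k, whose half is k; a negative one has an odd
code, and the parity factor then kills the positive part. -/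
theorem pos_pair_int (a b d : M.N) : pos (pair (int a b) d) = monus a b := by
  rw [pos_eq, fst_pair]
  rcases int_eq a b with ⟨h, h'⟩ | ⟨h, h'⟩
  · rw [h', (par_half_double _).1, (par_half_double _).2]
    simp
  · have h₀ : monus b a ≠ 0 := fun h' => h.not_ge (le_iff_monus.2 h')
    obtain ⟨k, hk⟩ : ∃ k, monus b a = k + 1 := ⟨_, (pred_add_cancel (pos_iff_ne_zero.2 h₀)).symm⟩
    have h₁ : monus (1 : M.N) 1 = 0 := by simpa using monus_add (1 : M.N) 0
    rw [h', hk, show k + 1 + (k + 1) = k + k + 1 + 1 by ring, pred_add_one, par_add_one,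
      (par_half_double _).1, le_iff_monus.1 h.le, monus_zero, h₁, zero_mul]

theorem ngt_pair_int (a b d : M.N) : ngt (pair (int a b) d) = monus b a := by
  rw [ngt_eq, fst_pair]
  rcases int_eq a b with ⟨h, h'⟩ | ⟨h, h'⟩
  · rw [h', (par_half_double _).1, le_iff_monus.1 h, zero_mul]
  · have h₀ : monus b a ≠ 0 := fun h' => h.not_ge (le_iff_monus.2 h')
    obtain ⟨k, hk⟩ : ∃ k, monus b a = k + 1 := ⟨_, (pred_add_cancel (pos_iff_ne_zero.2 h₀)).symm⟩
    rw [h', hk, show k + 1 + (k + 1) = k + k + 1 + 1 by ring, pred_add_one, par_add_one,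
      (par_half_double _).1, monus_zero, one_mul, show k + k + 1 + 1 = k + 1 + (k + 1) by ring,
      (par_half_double _).2]

end Model

end FinTypeArith

namespace FinTypeArith

/-! ## Ordered rings from numbers -/

section Cone

variable {R : Type*} [CommRing R]

/-- The linear order with a given set of nonnegative elements. -/
@[reducible] noncomputable def linearOrderOfNonneg (P : R → Prop) (h0 : P 0)
    (hadd : ∀ a b, P a → P b → P (a + b)) (hanti : ∀ a, P a → P (-a) → a = 0)
    (htot : ∀ a, P a ∨ P (-a)) : LinearOrder R where
  le a b := P (b - a)
  le_refl a := by simpa using h0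
  le_trans a b c h₁ h₂ := by simpa using hadd _ _ h₂ h₁
  le_antisymm a b h₁ h₂ := (sub_eq_zero.1 (hanti (b - a) h₁ (by simpa using h₂))).symm
  le_total a b := by simpa using htot (b - a)
  toDecidableLE := Classical.decRel _

theorem isStrictOrderedRing_of_nonneg [LinearOrder R] [Nontrivial R] [NoZeroDivisors R]
    {P : R → Prop} (hP : ∀ a b : R, a ≤ b ↔ P (b - a))
    (hmul : ∀ a b, P a → P b → P (a * b)) : IsStrictOrderedRing R := by
  have hadd : ∀ a b : R, a ≤ b → ∀ c, a + c ≤ b + c := fun a b h c => by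
    rw [hP] at h ⊢
    simpa using h
  have : IsOrderedAddMonoid R := { add_le_add_left := hadd }
  have h1 : (0 : R) ≤ 1 := by
    rcases le_total (0 : R) 1 with h | h
    · exact h
    · rw [hP] at h ⊢
      simpa using hmul _ _ h h
  have : ZeroLEOneClass R := ⟨h1⟩
  refine IsStrictOrderedRing.of_mul_pos fun a b ha hb => ?_
  refine lt_of_le_of_ne ?_ (mul_ne_zero ha.ne' hb.ne').symm
  have h₁ := ha.le
  have h₂ := hb.le
  rw [hP] at h₁ h₂ ⊢
  simpa using hmul _ _ h₁ h₂

end Cone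

section Differences

variable (N : Type*) [CommSemiring N] [IsCancelAdd N]

def diffSetoid : Setoid (N × N) where
  r a b := a.1 + b.2 = b.1 + a.2
  iseqv :=
    { refl := fun _ => rfl
      symm := fun h => h.symm
      trans := fun {a b c} h₁ h₂ => by
        have : a.1 + c.2 + b.2 = c.1 + a.2 + b.2 := by
          calc a.1 + c.2 + b.2 = (a.1 + b.2) + c.2 := by ring
            _ = (b.1 + c.2) + a.2 := by rw [h₁]; ring
            _ = c.1 + a.2 + b.2 := by rw [h₂]; ring
        exact add_right_cancel this }

/-- The ring of differences of a cancellative semiring. -/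
def Diff : Type _ := Quotient (diffSetoid N)

variable {N}

namespace Diff

def mk (a b : N) : Diff N := Quotient.mk (diffSetoid N) (a, b)

theorem mk_eq_mk {a b c d : N} : mk a b = mk c d ↔ a + d = c + b := Quotient.eq (r := diffSetoid N)

theorem exists_mk (z : Diff N) : ∃ a b, mk a b = z := by
  obtain ⟨⟨a, b⟩, rfl⟩ := Quotient.exists_rep z
  exact ⟨a, b, rfl⟩

instance : Zero (Diff N) := ⟨mk 0 0⟩
instance : One (Diff N) := ⟨mk 1 0⟩
instance : Neg (Diff N) := ⟨Quotient.map (fun a => (a.2, a.1)) fun a b h => by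
  change a.1 + b.2 = b.1 + a.2 at h
  change a.2 + b.1 = b.2 + a.1
  rw [add_comm, ← h, add_comm]⟩
instance : Add (Diff N) := ⟨Quotient.map₂ (fun a b => (a.1 + b.1, a.2 + b.2)) fun a b h c d h' => by
  change a.1 + b.2 = b.1 + a.2 at h
  change c.1 + d.2 = d.1 + c.2 at h'
  change a.1 + c.1 + (b.2 + d.2) = b.1 + d.1 + (a.2 + c.2)
  calc a.1 + c.1 + (b.2 + d.2) = (a.1 + b.2) + (c.1 + d.2) := by ring
    _ = b.1 + d.1 + (a.2 + c.2) := by rw [h, h']; ring⟩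
instance : Mul (Diff N) :=
  ⟨Quotient.map₂ (fun a b => (a.1 * b.1 + a.2 * b.2, a.1 * b.2 + a.2 * b.1)) fun a b h c d h' => by
    change a.1 + b.2 = b.1 + a.2 at h
    change c.1 + d.2 = d.1 + c.2 at h'
    change a.1 * c.1 + a.2 * c.2 + (b.1 * d.2 + b.2 * d.1) =
      b.1 * d.1 + b.2 * d.2 + (a.1 * c.2 + a.2 * c.1)
    -- Adding the mixed products allows the two changes of representatives to be made one after the
    -- other.
    refine add_right_cancel (b := b.2 * c.1 + b.1 * c.2) ?_
    calc a.1 * c.1 + a.2 * c.2 + (b.1 * d.2 + b.2 * d.1) + (b.2 * c.1 + b.1 * c.2)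
        = (a.1 + b.2) * c.1 + (b.1 + a.2) * c.2 + (b.1 * d.2 + b.2 * d.1) := by ring
      _ = (b.1 + a.2) * c.1 + (a.1 + b.2) * c.2 + (b.1 * d.2 + b.2 * d.1) := by rw [h]
      _ = b.1 * (c.1 + d.2) + b.2 * (d.1 + c.2) + (a.1 * c.2 + a.2 * c.1) := by ring
      _ = b.1 * (d.1 + c.2) + b.2 * (c.1 + d.2) + (a.1 * c.2 + a.2 * c.1) := by rw [h']
      _ = _ := by ring⟩

theorem mk_add (a b c d : N) : mk a b + mk c d = mk (a + c) (b + d) := rfl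
theorem mk_mul (a b c d : N) : mk a b * mk c d = mk (a * c + b * d) (a * d + b * c) := rfl
theorem neg_mk (a b : N) : -mk a b = mk b a := rfl
theorem zero_def : (0 : Diff N) = mk 0 0 := rfl
theorem one_def : (1 : Diff N) = mk 1 0 := rfl

instance : CommRing (Diff N) where
  add_assoc x y z := by
    obtain ⟨a, b, rfl⟩ := exists_mk x
    obtain ⟨c, d, rfl⟩ := exists_mk y
    obtain ⟨e, f, rfl⟩ := exists_mk z
    simp only [mk_add, add_assoc]
  zero_add x := by
    obtain ⟨a, b, rfl⟩ := exists_mk x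
    simp only [zero_def, mk_add, zero_add]
  add_zero x := by
    obtain ⟨a, b, rfl⟩ := exists_mk x
    simp only [zero_def, mk_add, add_zero]
  add_comm x y := by
    obtain ⟨a, b, rfl⟩ := exists_mk x
    obtain ⟨c, d, rfl⟩ := exists_mk y
    simp only [mk_add, add_comm]
  neg_add_cancel x := by
    obtain ⟨a, b, rfl⟩ := exists_mk x
    simp only [neg_mk, mk_add, zero_def, mk_eq_mk]
    ring
  left_distrib x y z := by
    obtain ⟨a, b, rfl⟩ := exists_mk x
    obtain ⟨c, d, rfl⟩ := exists_mk y
    obtain ⟨e, f, rfl⟩ := exists_mk z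
    simp only [mk_add, mk_mul, mk_eq_mk]
    ring
  right_distrib x y z := by
    obtain ⟨a, b, rfl⟩ := exists_mk x
    obtain ⟨c, d, rfl⟩ := exists_mk y
    obtain ⟨e, f, rfl⟩ := exists_mk z
    simp only [mk_add, mk_mul, mk_eq_mk]
    ring
  zero_mul x := by
    obtain ⟨a, b, rfl⟩ := exists_mk x
    simp only [zero_def, mk_mul, mk_eq_mk]
    ring
  mul_zero x := by
    obtain ⟨a, b, rfl⟩ := exists_mk x
    simp only [zero_def, mk_mul, mk_eq_mk]
    ring
  mul_assoc x y z := by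
    obtain ⟨a, b, rfl⟩ := exists_mk x
    obtain ⟨c, d, rfl⟩ := exists_mk y
    obtain ⟨e, f, rfl⟩ := exists_mk z
    simp only [mk_mul, mk_eq_mk]
    ring
  one_mul x := by
    obtain ⟨a, b, rfl⟩ := exists_mk x
    simp only [one_def, mk_mul, mk_eq_mk]
    ring
  mul_one x := by
    obtain ⟨a, b, rfl⟩ := exists_mk x
    simp only [one_def, mk_mul, mk_eq_mk]
    ring
  mul_comm x y := by
    obtain ⟨a, b, rfl⟩ := exists_mk x
    obtain ⟨c, d, rfl⟩ := exists_mk y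
    simp only [mk_mul, mk_eq_mk]
    ring
  nsmul := nsmulRec
  zsmul := zsmulRec

variable (N) in
/-- The embedding of the semiring. -/
def of : N →+* Diff N where
  toFun a := mk a 0
  map_zero' := rfl
  map_one' := rfl
  map_add' a b := by rw [mk_add, add_zero]
  map_mul' a b := by rw [mk_mul]; simp

theorem mk_eq (a b : N) : mk a b = of N a - of N b := by
  rw [sub_eq_add_neg]
  change _ = mk a 0 + - mk b 0
  rw [neg_mk, mk_add, add_zero, zero_add]

theorem of_injective : Function.Injective (of N) := fun a b h => by
  simpa using mk_eq_mk.1 (show mk a 0 = mk b 0 from h)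

variable [LinearOrder N] [CanonicallyOrderedAdd N]

theorem exists_of (z : Diff N) : (∃ a, z = of N a) ∨ ∃ a, -z = of N a := by
  obtain ⟨a, b, rfl⟩ := exists_mk z
  rw [mk_eq]
  rcases le_total a b with h | h
  · obtain ⟨c, rfl⟩ := exists_add_of_le h
    exact .inr ⟨c, by rw [map_add]; ring⟩
  · obtain ⟨c, rfl⟩ := exists_add_of_le h
    exact .inl ⟨c, by rw [map_add]; ring⟩

noncomputable instance : LinearOrder (Diff N) :=
  linearOrderOfNonneg (fun z => ∃ a, z = of N a) ⟨0, (map_zero _).symm⟩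
    (by rintro _ _ ⟨a, rfl⟩ ⟨b, rfl⟩; exact ⟨a + b, (map_add _ _ _).symm⟩)
    (by
      rintro _ ⟨a, rfl⟩ ⟨b, h⟩
      have h' : of N (a + b) = of N 0 := by rw [map_add, ← h, map_zero]; ring
      have h'' := of_injective h'
      rw [add_eq_zero] at h''
      rw [h''.1, map_zero])
    exists_of

theorem le_iff_exists (x y : Diff N) : x ≤ y ↔ ∃ a, y - x = of N a := Iff.rfl

theorem of_le_of {a b : N} : of N a ≤ of N b ↔ a ≤ b := by
  rw [le_iff_exists]
  constructor
  · rintro ⟨c, hc⟩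
    have : of N b = of N (a + c) := by rw [map_add, ← hc]; ring
    rw [of_injective this]
    exact le_self_add
  · intro h
    obtain ⟨c, rfl⟩ := exists_add_of_le h
    exact ⟨c, by rw [map_add]; ring⟩

variable [IsStrictOrderedRing N]

instance : Nontrivial (Diff N) := of_injective.nontrivial

instance : NoZeroDivisors (Diff N) where
  eq_zero_or_eq_zero_of_mul_eq_zero {x y} h := by
    have key : ∀ a b : N, of N a * of N b = 0 → of N a = 0 ∨ of N b = 0 := fun a b h => by
      rw [← map_mul, ← map_zero (of N)] at h
      rcases mul_eq_zero.1 (of_injective h) with h | h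
      · exact .inl (by rw [h, map_zero])
      · exact .inr (by rw [h, map_zero])
    rcases exists_of x with ⟨a, ha⟩ | ⟨a, ha⟩ <;> rcases exists_of y with ⟨b, hb⟩ | ⟨b, hb⟩ <;>
      simpa [← ha, ← hb, h] using key a b

instance : IsStrictOrderedRing (Diff N) :=
  isStrictOrderedRing_of_nonneg (P := fun z => ∃ a, z = of N a) le_iff_exists
    (by rintro _ _ ⟨a, rfl⟩ ⟨b, rfl⟩; exact ⟨a * b, (map_mul _ _ _).symm⟩)

end Diff

end Differences

section Fractions

variable (Z : Type*) [CommRing Z] [LinearOrder Z] [IsStrictOrderedRing Z]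

/-- The field of fractions, to be ordered. -/
def Frac : Type _ := FractionRing Z

noncomputable instance : Field (Frac Z) := inferInstanceAs (Field (FractionRing Z))
noncomputable instance : Algebra Z (Frac Z) := inferInstanceAs (Algebra Z (FractionRing Z))
instance : IsFractionRing Z (Frac Z) := inferInstanceAs (IsFractionRing Z (FractionRing Z))

variable {Z}

namespace Frac

theorem algebraMap_ne_zero {b : Z} (hb : 0 < b) : algebraMap Z (Frac Z) b ≠ 0 := by
  simpa using hb.ne'

def Nonneg (x : Frac Z) : Prop :=
  ∃ a b : Z, 0 ≤ a ∧ 0 < b ∧ x = algebraMap Z _ a / algebraMap Z _ b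

theorem Nonneg.add {x y : Frac Z} (hx : Nonneg x) (hy : Nonneg y) : Nonneg (x + y) := by
  obtain ⟨a, b, ha, hb, rfl⟩ := hx
  obtain ⟨c, d, hc, hd, rfl⟩ := hy
  refine ⟨a * d + b * c, b * d, by positivity, by positivity, ?_⟩
  rw [div_add_div _ _ (algebraMap_ne_zero hb) (algebraMap_ne_zero hd)]
  simp

theorem Nonneg.mul {x y : Frac Z} (hx : Nonneg x) (hy : Nonneg y) : Nonneg (x * y) := by
  obtain ⟨a, b, ha, hb, rfl⟩ := hx
  obtain ⟨c, d, hc, hd, rfl⟩ := hy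
  exact ⟨a * c, b * d, by positivity, by positivity, by rw [div_mul_div_comm]; simp⟩

theorem Nonneg.antisymm {x : Frac Z} (hx : Nonneg x) (hx' : Nonneg (-x)) : x = 0 := by
  obtain ⟨a, b, ha, hb, rfl⟩ := hx
  obtain ⟨c, d, hc, hd, h⟩ := hx'
  have h₁ := algebraMap_ne_zero hb
  have h₂ := algebraMap_ne_zero hd
  rw [← neg_div, div_eq_div_iff h₁ h₂, ← map_neg, ← map_mul, ← map_mul] at h
  have h₃ := IsFractionRing.injective Z (Frac Z) h
  have h₄ : 0 ≤ c * b := by positivity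
  have h₅ : a = 0 := by
    by_contra hne
    have : 0 < a * d := mul_pos (lt_of_le_of_ne ha (Ne.symm hne)) hd
    linarith
  simp [h₅]

theorem Nonneg.total (x : Frac Z) : Nonneg x ∨ Nonneg (-x) := by
  obtain ⟨a, b, hb, rfl⟩ := IsFractionRing.div_surjective (A := Z) x
  have hb' : b ≠ 0 := nonZeroDivisors.ne_zero hb
  rcases le_total 0 a with ha | ha <;> rcases lt_or_gt_of_ne hb' with hb | hb
  · exact .inr ⟨a, -b, ha, by linarith, by rw [map_neg, div_neg]⟩
  · exact .inl ⟨a, b, ha, hb, rfl⟩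
  · exact .inl ⟨-a, -b, by linarith, by linarith, by rw [map_neg, map_neg, neg_div_neg_eq]⟩
  · exact .inr ⟨-a, b, by linarith, hb, by rw [map_neg, neg_div]⟩

noncomputable instance : LinearOrder (Frac Z) :=
  linearOrderOfNonneg Nonneg ⟨0, 1, le_rfl, one_pos, by simp⟩ (fun _ _ => Nonneg.add)
    (fun _ => Nonneg.antisymm) Nonneg.total

instance : IsStrictOrderedRing (Frac Z) :=
  isStrictOrderedRing_of_nonneg (P := Nonneg) (fun _ _ => Iff.rfl) fun _ _ => Nonneg.mul

theorem algebraMap_nonneg {a : Z} (h : 0 ≤ a) : 0 ≤ algebraMap Z (Frac Z) a := by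
  change Nonneg _
  exact ⟨a, 1, h, one_pos, by simp⟩

end Frac

end Fractions

section Values

variable (N : Type*) [CommSemiring N] [LinearOrder N] [IsStrictOrderedRing N]
  [CanonicallyOrderedAdd N] [IsCancelAdd N]

/-- The fraction field of the differences of `N`. -/
abbrev QOf : Type _ := Frac (Diff N)

/-- The embedding of `N` into the field. -/
noncomputable def toQ : N →+* QOf N := (algebraMap (Diff N) (QOf N)).comp (Diff.of N)

variable {N}

theorem toQ_le {a b : N} : toQ N a ≤ toQ N b ↔ a ≤ b := by
  have h : ∀ {a b : N}, a ≤ b → toQ N a ≤ toQ N b := fun {a b} h => by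
    obtain ⟨c, rfl⟩ := exists_add_of_le h
    have h0 : 0 ≤ toQ N c := Frac.algebraMap_nonneg (by
      rw [← map_zero (Diff.of N)]
      exact Diff.of_le_of.2 zero_le)
    rw [map_add]
    linarith
  refine ⟨fun hab => ?_, h⟩
  by_contra! hlt
  have := le_antisymm hab (h hlt.le)
  exact hlt.ne' (Diff.of_injective (IsFractionRing.injective (Diff N) (QOf N) this))

theorem toQ_lt {a b : N} : toQ N a < toQ N b ↔ a < b := by
  rw [← not_le, toQ_le, not_le]

theorem toQ_nonneg (a : N) : 0 ≤ toQ N a := by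
  rw [← map_zero (toQ N)]
  exact toQ_le.2 zero_le

/-- Positive numbers are at least 1, so a nonnegative fraction a / b is at most its numerator a. The
field is thus Archimedean relative to the semiring, though perhaps not relative to ℕ. -/
theorem exists_toQ_gt (hN : ∀ a : N, 0 < a → 1 ≤ a) (q : QOf N) : ∃ a : N, q < toQ N a := by
  rcases lt_or_ge q 0 with h | h
  · exact ⟨0, by rwa [map_zero]⟩
  · have h' : Frac.Nonneg (q - 0) := h
    rw [sub_zero] at h'
    obtain ⟨a, b, ha, hb, rfl⟩ := h'
    obtain ⟨a, ha'⟩ := (Diff.le_iff_exists 0 a).1 ha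
    obtain ⟨b, hb'⟩ := (Diff.le_iff_exists 0 b).1 hb.le
    rw [sub_zero] at ha' hb'
    subst ha' hb'
    refine ⟨a + 1, ?_⟩
    change toQ N a / toQ N b < _
    have hb₁ : 1 ≤ toQ N b := by
      rw [← map_one (toQ N), toQ_le]
      refine hN b (pos_iff_ne_zero.2 ?_)
      rintro rfl
      simp at hb
    calc toQ N a / toQ N b ≤ toQ N a := div_le_self (toQ_nonneg a) hb₁
      _ < toQ N (a + 1) := by rw [map_add, map_one]; linarith

end Values

end FinTypeArith

namespace FinTypeArith

/-! ## Completion by Cauchy functions on a linear order -/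

open Filter

section Cauchy

variable (ι : Type*) [LinearOrder ι] [Nonempty ι] (Q : Type*) [Field Q] [LinearOrder Q]
  [IsStrictOrderedRing Q]

variable {ι Q}

/-- The index set is an arbitrary linear order because it will be the set of numbers of a model,
which may be nonstandard; ordinary sequences would not exhaust it. -/
def IsCauchy (s : ι → Q) : Prop := ∀ ε > 0, ∃ n, ∀ m ≥ n, |s m - s n| ≤ ε

def IsNull (s : ι → Q) : Prop := ∀ ε > 0, ∀ᶠ n in atTop, |s n| ≤ ε

theorem IsCauchy.bounded {s : ι → Q} (hs : IsCauchy s) : ∃ B > 0, ∀ᶠ n in atTop, |s n| ≤ B := by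
  obtain ⟨n, hn⟩ := hs 1 one_pos
  refine ⟨|s n| + 1, by positivity, eventually_atTop.2 ⟨n, fun m hm => ?_⟩⟩
  calc |s m| = |(s m - s n) + s n| := by ring_nf
    _ ≤ |s m - s n| + |s n| := abs_add_le _ _
    _ ≤ |s n| + 1 := by linarith [hn m hm]

theorem IsCauchy.eventually {s : ι → Q} (hs : IsCauchy s) {ε : Q} (hε : 0 < ε) :
    ∀ᶠ n in atTop, ∀ m ≥ n, |s m - s n| ≤ ε := by
  obtain ⟨n, hn⟩ := hs (ε / 2) (by positivity)
  refine eventually_atTop.2 ⟨n, fun k hk m hm => ?_⟩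
  calc |s m - s k| = |(s m - s n) - (s k - s n)| := by ring_nf
    _ ≤ |s m - s n| + |s k - s n| := abs_sub _ _
    _ ≤ ε := by linarith [hn m (hk.trans hm), hn k hk]

theorem isCauchy_of_eventually {s : ι → Q}
    (h : ∀ ε > 0, ∀ᶠ n in atTop, ∀ m ≥ n, |s m - s n| ≤ ε) : IsCauchy s :=
  fun ε hε => (h ε hε).exists

theorem isCauchy_const (q : Q) : IsCauchy fun _ : ι => q := fun ε hε =>
  ⟨Classical.arbitrary ι, fun m _ => by simpa using hε.le⟩

theorem IsCauchy.add {s t : ι → Q} (hs : IsCauchy s) (ht : IsCauchy t) : IsCauchy (s + t) := by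
  refine isCauchy_of_eventually fun ε hε => ?_
  filter_upwards [hs.eventually (half_pos hε), ht.eventually (half_pos hε)] with n h₁ h₂ m hm
  calc |(s + t) m - (s + t) n| = |(s m - s n) + (t m - t n)| := by simp only [Pi.add_apply]; ring_nf
    _ ≤ |s m - s n| + |t m - t n| := abs_add_le _ _
    _ ≤ ε := by linarith [h₁ m hm, h₂ m hm]

theorem IsCauchy.neg {s : ι → Q} (hs : IsCauchy s) : IsCauchy (-s) := by
  intro ε hε
  obtain ⟨n, hn⟩ := hs ε hε
  refine ⟨n, fun m hm => ?_⟩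
  have := hn m hm
  rwa [Pi.neg_apply, Pi.neg_apply, neg_sub_neg, abs_sub_comm]

theorem IsCauchy.mul {s t : ι → Q} (hs : IsCauchy s) (ht : IsCauchy t) : IsCauchy (s * t) := by
  obtain ⟨A, hA, hsA⟩ := hs.bounded
  obtain ⟨B, hB, htB⟩ := ht.bounded
  refine isCauchy_of_eventually fun ε hε => ?_
  have h₁ := hs.eventually (ε := ε / (2 * B)) (by positivity)
  have h₂ := ht.eventually (ε := ε / (2 * A)) (by positivity)
  filter_upwards [h₁, h₂, eventually_forall_ge_atTop.2 hsA, htB] with n h₁ h₂ h₃ h₄ m hm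
  calc |(s * t) m - (s * t) n| = |s m * (t m - t n) + (s m - s n) * t n| := by
        simp only [Pi.mul_apply]; ring_nf
    _ ≤ |s m| * |t m - t n| + |s m - s n| * |t n| := by
        rw [← abs_mul, ← abs_mul]; exact abs_add_le _ _
    _ ≤ A * (ε / (2 * A)) + ε / (2 * B) * B := by
        gcongr
        · exact h₃ m hm
        · exact h₂ m hm
        · exact h₁ m hm
    _ = ε := by field_simp; ring

theorem IsCauchy.congr {s t : ι → Q} (hs : IsCauchy s) (h : ∀ᶠ n in atTop, s n = t n) :
    IsCauchy t := by
  obtain ⟨k, hk⟩ := eventually_atTop.1 h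
  refine isCauchy_of_eventually fun ε hε => ?_
  filter_upwards [hs.eventually hε, eventually_ge_atTop k] with n h₁ h₂ m hm
  rw [← hk m (h₂.trans hm), ← hk n h₂]
  exact h₁ m hm

/-- Some late value exceeds ε in absolute value, while all later values differ from it by at most ε
/ 2; so the function keeps its sign and stays away from 0. -/
theorem exists_pos_of_not_isNull {s : ι → Q} (hs : IsCauchy s) (h : ¬ IsNull s) :
    ∃ δ > 0, (∀ᶠ n in atTop, δ ≤ s n) ∨ ∀ᶠ n in atTop, s n ≤ -δ := by
  simp only [IsNull, not_forall] at h
  obtain ⟨ε, hε, h⟩ := h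
  obtain ⟨n, hn, hs⟩ := ((not_eventually.1 h).and_eventually (hs.eventually (half_pos hε))).exists
  rw [not_le] at hn
  refine ⟨ε / 2, half_pos hε, ?_⟩
  rcases lt_abs.1 hn with hn | hn
  · refine .inl (eventually_atTop.2 ⟨n, fun m hm => ?_⟩)
    linarith [(abs_le.1 (hs m hm)).1]
  · refine .inr (eventually_atTop.2 ⟨n, fun m hm => ?_⟩)
    linarith [(abs_le.1 (hs m hm)).2]

variable (ι Q)

/-- The ring of Cauchy functions. -/
def cauchySubring : Subring (ι → Q) where
  carrier := {s | IsCauchy s}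
  mul_mem' := IsCauchy.mul
  one_mem' := isCauchy_const 1
  add_mem' := IsCauchy.add
  zero_mem' := isCauchy_const 0
  neg_mem' := IsCauchy.neg

/-- The ideal of null functions. -/
def nullIdeal : Ideal (cauchySubring ι Q) where
  carrier := {s | IsNull s.1}
  add_mem' {s t} hs ht ε hε := by
    filter_upwards [hs (ε / 2) (half_pos hε), ht (ε / 2) (half_pos hε)] with n h₁ h₂
    calc |s.1 n + t.1 n| ≤ |s.1 n| + |t.1 n| := abs_add_le _ _
      _ ≤ ε := by linarith
  zero_mem' ε hε := Eventually.of_forall fun n => by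
    change |(0 : Q)| ≤ ε
    simpa using hε.le
  smul_mem' c {s} hs ε hε := by
    obtain ⟨B, hB, h⟩ := IsCauchy.bounded c.2
    filter_upwards [h, hs (ε / B) (by positivity)] with n h₁ h₂
    change |c.1 n * s.1 n| ≤ ε
    rw [abs_mul]
    calc |c.1 n| * |s.1 n| ≤ B * (ε / B) := by gcongr
      _ = ε := by field_simp

/-- Cauchy functions modulo null functions. -/
def RealOf : Type _ := cauchySubring ι Q ⧸ nullIdeal ι Q

noncomputable instance : CommRing (RealOf ι Q) :=
  inferInstanceAs (CommRing (cauchySubring ι Q ⧸ nullIdeal ι Q))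

namespace RealOf

variable {ι Q}

def mk (s : ι → Q) (hs : IsCauchy s) : RealOf ι Q := Ideal.Quotient.mk (nullIdeal ι Q) ⟨s, hs⟩

theorem exists_mk (x : RealOf ι Q) : ∃ s hs, mk s hs = x := by
  obtain ⟨⟨s, hs⟩, rfl⟩ := Ideal.Quotient.mk_surjective x
  exact ⟨s, hs, rfl⟩

variable {s t : ι → Q} (hs : IsCauchy s) (ht : IsCauchy t)

theorem mk_add : mk s hs + mk t ht = mk (s + t) (hs.add ht) := rfl
theorem mk_mul : mk s hs * mk t ht = mk (s * t) (hs.mul ht) := rfl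
theorem neg_mk : -mk s hs = mk (-s) hs.neg := rfl

theorem mk_eq_zero : mk s hs = 0 ↔ IsNull s := by
  change Ideal.Quotient.mk (nullIdeal ι Q) _ = 0 ↔ _
  rw [Ideal.Quotient.eq_zero_iff_mem]
  rfl

theorem mk_eq_mk : mk s hs = mk t ht ↔ IsNull (s - t) := by
  rw [← sub_eq_zero, sub_eq_add_neg, neg_mk, mk_add, mk_eq_zero, sub_eq_add_neg]

theorem mk_congr (h : ∀ᶠ n in atTop, s n = t n) : mk s hs = mk t ht := by
  rw [mk_eq_mk]
  intro ε hε
  filter_upwards [h] with n hn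
  simpa [hn] using hε.le

/-- The elements with a nonnegative representative. -/
def Nonneg (x : RealOf ι Q) : Prop := ∃ s hs, (∀ n, 0 ≤ s n) ∧ mk s hs = x

theorem nonneg_of_eventually (h : ∀ᶠ n in atTop, 0 ≤ s n) : Nonneg (mk s hs) := by
  have h' : ∀ᶠ n in atTop, s n = max (s n) 0 := by
    filter_upwards [h] with n hn
    rw [max_eq_left hn]
  exact ⟨fun n => max (s n) 0, hs.congr h', fun n => le_max_right _ _, (mk_congr _ _ h').symm⟩

theorem Nonneg.add {x y : RealOf ι Q} (hx : Nonneg x) (hy : Nonneg y) : Nonneg (x + y) := by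
  obtain ⟨s, hs, h, rfl⟩ := hx
  obtain ⟨t, ht, h', rfl⟩ := hy
  exact ⟨s + t, hs.add ht, fun n => add_nonneg (h n) (h' n), rfl⟩

theorem Nonneg.mul {x y : RealOf ι Q} (hx : Nonneg x) (hy : Nonneg y) : Nonneg (x * y) := by
  obtain ⟨s, hs, h, rfl⟩ := hx
  obtain ⟨t, ht, h', rfl⟩ := hy
  exact ⟨s * t, hs.mul ht, fun n => mul_nonneg (h n) (h' n), rfl⟩

theorem Nonneg.antisymm {x : RealOf ι Q} (hx : Nonneg x) (hx' : Nonneg (-x)) : x = 0 := by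
  obtain ⟨s, hs, h, rfl⟩ := hx
  obtain ⟨t, ht, h', e⟩ := hx'
  rw [neg_mk, mk_eq_mk] at e
  rw [mk_eq_zero]
  intro ε hε
  filter_upwards [e ε hε] with n hn
  simp only [Pi.sub_apply, Pi.neg_apply, sub_neg_eq_add] at hn
  rw [abs_of_nonneg (h n)]
  rw [abs_of_nonneg (add_nonneg (h' n) (h n))] at hn
  linarith [h' n]

theorem Nonneg.total (x : RealOf ι Q) : Nonneg x ∨ Nonneg (-x) := by
  obtain ⟨s, hs, rfl⟩ := exists_mk x
  by_cases h : IsNull s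
  · rw [(mk_eq_zero hs).2 h]
    exact .inl ⟨0, isCauchy_const 0, fun _ => le_rfl, rfl⟩
  · obtain ⟨δ, hδ, h | h⟩ := exists_pos_of_not_isNull hs h
    · refine .inl (nonneg_of_eventually hs (h.mono fun n hn => hδ.le.trans hn))
    · refine .inr (nonneg_of_eventually hs.neg (h.mono fun n hn => ?_))
      rw [Pi.neg_apply]
      linarith

noncomputable instance : LinearOrder (RealOf ι Q) :=
  linearOrderOfNonneg Nonneg ⟨0, isCauchy_const 0, fun _ => le_rfl, rfl⟩ (fun _ _ => Nonneg.add)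
    (fun _ => Nonneg.antisymm) Nonneg.total

theorem le_iff {x y : RealOf ι Q} : x ≤ y ↔ Nonneg (y - x) := Iff.rfl

instance : Nontrivial (RealOf ι Q) where
  exists_pair_ne := by
    refine ⟨mk _ (isCauchy_const 1), 0, fun h => ?_⟩
    rw [mk_eq_zero] at h
    obtain ⟨n, hn⟩ := (h (1 / 2) (by norm_num)).exists
    norm_num at hn

instance : NoZeroDivisors (RealOf ι Q) where
  eq_zero_or_eq_zero_of_mul_eq_zero {x y} h := by
    obtain ⟨s, hs, rfl⟩ := exists_mk x
    obtain ⟨t, ht, rfl⟩ := exists_mk y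
    rw [mk_mul, mk_eq_zero] at h
    rw [mk_eq_zero, mk_eq_zero]
    by_contra! hne
    have key : ∀ {u : ι → Q}, IsCauchy u → ¬ IsNull u → ∃ δ > 0, ∀ᶠ n in atTop, δ ≤ |u n| := by
      intro u hu hn
      obtain ⟨δ, hδ, h | h⟩ := exists_pos_of_not_isNull hu hn
      · exact ⟨δ, hδ, h.mono fun n hn => hn.trans (le_abs_self _)⟩
      · exact ⟨δ, hδ, h.mono fun n hn => (by linarith : δ ≤ -u n).trans (neg_le_abs _)⟩
    obtain ⟨δ, hδ, h₁⟩ := key hs hne.1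
    obtain ⟨η, hη, h₂⟩ := key ht hne.2
    obtain ⟨n, h₁, h₂, h₃⟩ := (h₁.and (h₂.and (h (δ * η / 2) (by positivity)))).exists
    rw [Pi.mul_apply, abs_mul] at h₃
    have h₄ : δ * η ≤ |s n| * |t n| := by gcongr
    have h₅ : 0 < δ * η := by positivity
    linarith

instance : IsStrictOrderedRing (RealOf ι Q) :=
  isStrictOrderedRing_of_nonneg (P := Nonneg) (fun _ _ => Iff.rfl) fun _ _ => Nonneg.mul

theorem mk_le_mk : mk s hs ≤ mk t ht ↔ ∀ ε > 0, ∀ᶠ n in atTop, s n ≤ t n + ε := by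
  rw [le_iff, sub_eq_add_neg, neg_mk, mk_add]
  constructor
  · rintro ⟨u, hu, h, e⟩ ε hε
    rw [mk_eq_mk] at e
    filter_upwards [e ε hε] with n hn
    simp only [Pi.sub_apply, Pi.add_apply, Pi.neg_apply] at hn
    linarith [h n, (abs_le.1 hn).2]
  · intro h
    by_cases hn : IsNull (t + -s)
    · rw [(mk_eq_zero _).2 hn]
      exact ⟨0, isCauchy_const 0, fun _ => le_rfl, rfl⟩
    · obtain ⟨δ, hδ, h' | h'⟩ := exists_pos_of_not_isNull (ht.add hs.neg) hn
      · exact nonneg_of_eventually _ (h'.mono fun n hn => hδ.le.trans hn)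
      · obtain ⟨n, h₁, h₂⟩ := (h'.and (h (δ / 2) (half_pos hδ))).exists
        simp only [Pi.add_apply, Pi.neg_apply] at h₁
        linarith

variable (ι Q) in
/-- The constants. -/
noncomputable def ofQ : Q →+* RealOf ι Q where
  toFun q := mk _ (isCauchy_const q)
  map_zero' := rfl
  map_one' := rfl
  map_add' _ _ := rfl
  map_mul' _ _ := rfl

theorem ofQ_le {p q : Q} : ofQ ι Q p ≤ ofQ ι Q q ↔ p ≤ q := by
  refine (mk_le_mk _ _).trans ⟨fun h => ?_, fun h ε hε => Eventually.of_forall fun _ => by linarith⟩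
  refine le_of_forall_pos_le_add fun ε hε => ?_
  obtain ⟨n, hn⟩ := (h ε hε).exists
  exact hn

theorem ofQ_lt {p q : Q} : ofQ ι Q p < ofQ ι Q q ↔ p < q := by
  rw [← not_le, ofQ_le, not_le]

theorem le_of_forall_ofQ {x y : RealOf ι Q} (h : ∀ ε > 0, x ≤ y + ofQ ι Q ε) : x ≤ y := by
  obtain ⟨s, hs, rfl⟩ := exists_mk x
  obtain ⟨t, ht, rfl⟩ := exists_mk y
  rw [mk_le_mk]
  intro ε hε
  have h₁ := (mk_le_mk hs (ht.add (isCauchy_const (ε / 2)))).1 (h (ε / 2) (half_pos hε))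
  filter_upwards [h₁ (ε / 2) (half_pos hε)] with n hn
  simp only [Pi.add_apply] at hn
  linarith

theorem abs_mk_sub_ofQ_le {n : ι} {δ : Q} (h : ∀ m ≥ n, |s m - s n| ≤ δ) :
    |mk s hs - ofQ ι Q (s n)| ≤ ofQ ι Q δ := by
  rw [abs_sub_le_iff]
  constructor
  · rw [sub_le_iff_le_add, ← map_add]
    refine (mk_le_mk _ _).2 fun ε hε => ?_
    filter_upwards [eventually_ge_atTop n] with m hm
    linarith [(abs_le.1 (h m hm)).2]
  · rw [sub_le_iff_le_add]
    refine (mk_le_mk (isCauchy_const (s n)) ((isCauchy_const δ).add hs)).2 fun ε hε => ?_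
    filter_upwards [eventually_ge_atTop n] with m hm
    simp only [Pi.add_apply]
    linarith [(abs_le.1 (h m hm)).1]

end RealOf

end Cauchy

end FinTypeArith

namespace FinTypeArith

namespace Model

open Interp

variable {M : Model}

/-! ## Rational numbers in a model -/

def addQ (a b : M.N) : M.N := eval nil addQC ⋆ a ⋆ b
def mulQ (a b : M.N) : M.N := eval nil mulQC ⋆ a ⋆ b
def negQ (a : M.N) : M.N := eval nil negQC ⋆ a
def absQ (a : M.N) : M.N := eval nil absQC ⋆ a
def ltQ (a b : M.N) : M.N := eval nil ltQC ⋆ a ⋆ b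
def invPow2 (a : M.N) : M.N := eval nil invPow2C ⋆ a

section
variable {Γ : Ctx} (e : M.Env Γ) (r s t : Tm Γ .nat)
@[simp] theorem eval_addQ : eval e (FinTypeArith.addQ r s) =
    addQ (eval e r) (eval e s) := by
  simp only [FinTypeArith.addQ, eval_app, eval_cl]; rfl
@[simp] theorem eval_mulQ : eval e (FinTypeArith.mulQ r s) =
    mulQ (eval e r) (eval e s) := by
  simp only [FinTypeArith.mulQ, eval_app, eval_cl]; rfl
@[simp] theorem eval_negQ : eval e (FinTypeArith.negQ r) =
    negQ (eval e r) := by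
  simp only [FinTypeArith.negQ, eval_app, eval_cl]; rfl
@[simp] theorem eval_absQ : eval e (FinTypeArith.absQ r) =
    absQ (eval e r) := by
  simp only [FinTypeArith.absQ, eval_app, eval_cl]; rfl
@[simp] theorem eval_ltQ : eval e (FinTypeArith.ltQ r s) =
    ltQ (eval e r) (eval e s) := by
  simp only [FinTypeArith.ltQ, eval_app, eval_cl]; rfl
@[simp] theorem eval_invPow2 : eval e (FinTypeArith.invPow2 r) =
    invPow2 (eval e r) := by
  simp only [FinTypeArith.invPow2, eval_app, eval_cl]; rfl
@[simp] theorem eval_subQ : eval e (subQ r s) = addQ (eval e r) (negQ (eval e s)) := by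
  simp only [subQ, eval_addQ, eval_negQ]
@[simp] theorem eval_den : eval e (den s) = snd (eval e s) + 1 := by
  simp only [den, eval_suc, eval_snd, S_eq]
@[simp] theorem eval_mkQ : eval e (mkQ r s t) =
    pair (int (eval e r) (eval e s)) (pred (eval e t)) := by
  simp only [mkQ, eval_pair, eval_int, eval_pred]
end

variable (M) in
/-- The rationals of the model. -/
abbrev Q : Type := QOf M.N

/-- The rational with a given code. -/
noncomputable def qv (r : M.N) : M.Q := (toQ _ (pos r) - toQ _ (ngt r)) / toQ _ (snd r + 1)

theorem toQ_pos {a : M.N} (h : 0 < a) : 0 < toQ M.N a := by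
  rw [← map_zero (toQ M.N)]
  exact toQ_lt.2 h

theorem den_pos (r : M.N) : 0 < toQ M.N (snd r + 1) := toQ_pos (lt_S_iff.2 zero_le)

theorem toQ_monus_sub (a b : M.N) :
    toQ M.N (monus a b) - toQ _ (monus b a) = toQ _ a - toQ _ b := by
  rcases le_total a b with h | h
  · have e := congrArg (toQ M.N) ((monus_eq_iff h).1 rfl)
    rw [map_add] at e
    rw [le_iff_monus.1 h, e, map_zero]
    ring
  · have e := congrArg (toQ M.N) ((monus_eq_iff h).1 rfl)
    rw [map_add] at e
    rw [le_iff_monus.1 h, e, map_zero]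
    ring

/-- The common last step of all rational operations: coding an integer difference cancels the
smaller part, which the value does not notice. -/
theorem qv_mkQ (a b d : M.N) (hd : 0 < d) :
    qv (pair (int a b) (pred d)) = (toQ _ a - toQ _ b) / toQ M.N d := by
  rw [qv, pos_pair_int, ngt_pair_int, snd_pair, pred_add_cancel hd, toQ_monus_sub]

theorem mul_den_pos (r s : M.N) : 0 < (snd r + 1) * (snd s + 1) :=
  mul_pos (lt_S_iff.2 zero_le) (lt_S_iff.2 zero_le)

@[simp] theorem qv_addQ (r s : M.N) : qv (addQ r s) = qv r + qv s := by
  have hr := (den_pos r).ne'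
  have hs := (den_pos s).ne'
  simp only [addQ, addQC, eval_lam, eval_mkQ, eval_add, eval_mul, eval_pos, eval_ngt, eval_den,
    eval_v0, eval_v1]
  rw [qv_mkQ _ _ _ (mul_den_pos r s), qv, qv, div_add_div _ _ hr hs]
  simp only [map_add, map_mul, map_one]
  congr 1
  ring

@[simp] theorem qv_mulQ (r s : M.N) : qv (mulQ r s) = qv r * qv s := by
  simp only [mulQ, mulQC, eval_lam, eval_mkQ, eval_add, eval_mul, eval_pos, eval_ngt, eval_den,
    eval_v0, eval_v1]
  rw [qv_mkQ _ _ _ (mul_den_pos r s), qv, qv, div_mul_div_comm]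
  simp only [map_add, map_mul, map_one]
  congr 1
  ring

@[simp] theorem qv_negQ (r : M.N) : qv (negQ r) = -qv r := by
  simp only [negQ, negQC, eval_lam, eval_mkQ, eval_pos, eval_ngt, eval_den, eval_v0]
  rw [qv_mkQ _ _ _ (lt_S_iff.2 zero_le), qv, ← neg_div, neg_sub]

/-- One of the two parts of the numerator vanishes. -/
theorem pos_eq_zero_or_ngt_eq_zero (r : M.N) : pos r = 0 ∨ ngt r = 0 := by
  rw [pos_eq, ngt_eq]
  have h : monus 1 (par (fst r)) * par (fst r) = 0 := by
    refine M.induction_add_one (P := fun a => monus 1 (par a) * par a = 0) nil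
      (.eq (mul (FinTypeArith.monus (num 1) (FinTypeArith.par v0)) (FinTypeArith.par v0)) zero)
      trivial (fun n => by simp [Sat]) (by simp) (fun n ih => ?_) _
    rw [par_add_one]
    rcases mul_eq_zero.1 ih with h | h
    · rw [h, mul_zero]
    · rw [h, monus_zero, show monus (1 : M.N) 1 = 0 by simpa using monus_add (1 : M.N) 0, zero_mul]
  rcases mul_eq_zero.1 h with h | h
  · exact .inl (by rw [h, zero_mul])
  · exact .inr (by rw [h, zero_mul])

theorem abs_num (r : M.N) :
    |toQ M.N (pos r) - toQ _ (ngt r)| = toQ M.N (pos r) + toQ _ (ngt r) := by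
  rcases pos_eq_zero_or_ngt_eq_zero r with h | h
  · rw [h, map_zero, zero_sub, zero_add, abs_neg, abs_of_nonneg (toQ_nonneg _)]
  · rw [h, map_zero, sub_zero, add_zero, abs_of_nonneg (toQ_nonneg _)]

@[simp] theorem qv_absQ (r : M.N) : qv (absQ r) = |qv r| := by
  simp only [absQ, absQC, eval_lam, eval_mkQ, eval_pos, eval_ngt, eval_den, eval_v0, eval_add,
    eval_zero]
  rw [qv_mkQ _ _ _ (lt_S_iff.2 zero_le), qv, abs_div, abs_num, abs_of_pos (den_pos r)]
  simp

theorem abs_qv_le (r : M.N) : |qv r| ≤ toQ M.N (pos r + ngt r) := by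
  rw [qv, abs_div, abs_num, abs_of_pos (den_pos r), map_add (toQ M.N) (pos r)]
  have h : 0 ≤ toQ M.N (pos r) + toQ _ (ngt r) := add_nonneg (toQ_nonneg _) (toQ_nonneg _)
  refine div_le_self h ?_
  rw [map_add, map_one]
  linarith [toQ_nonneg (snd r)]

@[simp] theorem ltQ_eq_zero {r s : M.N} : ltQ r s = 0 ↔ qv r < qv s := by
  simp only [ltQ, ltQC, eval_lam, eval_monus, eval_suc, eval_add, eval_mul, eval_pos, eval_ngt,
    eval_den, eval_v0, eval_v1, S_eq]
  rw [← le_iff_monus, S_le_iff, ← toQ_lt, qv, qv, div_lt_div_iff₀ (den_pos r) (den_pos s)]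
  rw [map_add, map_add, map_mul, map_mul, map_mul, map_mul]
  constructor <;> intro h <;> linarith

/-! ### Powers of two -/

theorem pow2_pos (n : M.N) : 0 < pow2 n := by
  rw [pos_iff_ne_zero]
  refine M.induction_add_one (P := fun n => pow2 n ≠ 0) nil
    (Fm.neg (.eq (FinTypeArith.pow2 v0) zero)) (by simp [Fm.QF, Fm.neg]) (fun n => by simp [Sat])
    (by simp) (fun n ih h => ?_) n
  rw [pow2_add_one] at h
  exact ih (eq_zero_of_add_eq_zero h)

theorem pow2_add (m n : M.N) : pow2 (m + n) = pow2 m * pow2 n :=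
  M.induction_add_one (P := fun n => pow2 (m + n) = pow2 m * pow2 n) (cons m nil)
    (.eq (FinTypeArith.pow2 (add v1 v0)) (mul (FinTypeArith.pow2 v1) (FinTypeArith.pow2 v0)))
    trivial (fun n => by simp [Sat]) (by simp)
    (fun n ih => by rw [← add_assoc, pow2_add_one, pow2_add_one, ih]; ring) n

theorem le_pow2 (n : M.N) : n ≤ pow2 n := by
  rw [le_iff_monus]
  refine M.induction_add_one (P := fun n => monus n (pow2 n) = 0) nil
    (.eq (FinTypeArith.monus v0 (FinTypeArith.pow2 v0)) zero) trivial (fun n => by simp [Sat])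
    (le_iff_monus.1 zero_le) (fun n ih => ?_) n
  rw [← le_iff_monus] at ih ⊢
  rw [pow2_add_one]
  refine add_le_add ih ?_
  simpa using S_le_iff.2 (pow2_pos n)

/-- The rational `2⁻ⁿ`. -/
noncomputable def ε (n : M.N) : M.Q := (toQ _ (pow2 n))⁻¹

theorem ε_pos (n : M.N) : 0 < ε n := inv_pos.2 (toQ_pos (pow2_pos n))

@[simp] theorem ε_zero : ε (0 : M.N) = 1 := by simp [ε]

theorem ε_add (m n : M.N) : ε (m + n) = ε m * ε n := by
  rw [ε, pow2_add, map_mul, mul_inv, ε, ε]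

theorem ε_add_one (n : M.N) : ε (n + 1) = ε n / 2 := by
  rw [ε, pow2_add_one, map_add, ← mul_two, mul_inv, ε, div_eq_mul_inv]

theorem toQ_mul_ε_le (n : M.N) : toQ _ n * ε n ≤ 1 := by
  rw [ε, ← div_eq_mul_inv, div_le_one (toQ_pos (pow2_pos n)), toQ_le]
  exact le_pow2 n

theorem exists_ε_lt {q : M.Q} (hq : 0 < q) : ∃ n : M.N, ε n < q := by
  obtain ⟨n, hn⟩ := exists_toQ_gt (fun a h => by simpa using S_le_iff.2 h) q⁻¹
  refine ⟨n, inv_lt_of_inv_lt₀ hq (hn.trans_le (toQ_le.2 (le_pow2 n)))⟩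

@[simp] theorem qv_invPow2 (n : M.N) : qv (invPow2 n) = ε n := by
  simp only [invPow2, invPow2C, eval_lam, eval_mkQ, eval_one, eval_zero, eval_pow2, eval_v0]
  rw [qv_mkQ _ _ _ (pow2_pos n), map_one, map_zero, sub_zero, one_div, ε]

@[simp] theorem qv_zeroQ {Γ : Ctx} (e : M.Env Γ) : qv (eval e zeroQ) = 0 := by
  rw [zeroQ, eval_mkQ, eval_one, qv_mkQ _ _ _ one_pos]
  simp

@[simp] theorem qv_oneQ {Γ : Ctx} (e : M.Env Γ) : qv (eval e oneQ) = 1 := by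
  rw [oneQ, eval_mkQ, eval_one, qv_mkQ _ _ _ one_pos]
  simp

/-! ## Real numbers in a model -/

def hat (f : M.D .fn) (n : M.N) : M.N := eval nil hatC ⋆ f ⋆ n

@[simp] theorem eval_hat {Γ : Ctx} (e : M.Env Γ) (f : Tm Γ .fn) (s : Tm Γ .nat) :
    eval e (FinTypeArith.hat f s) = hat (eval e f) (eval e s) := by
  simp only [FinTypeArith.hat, eval_app, eval_cl]; rfl

/-- The condition under which `hat f` agrees with `f` one step further. -/
def Fast (f : M.D .fn) (n : M.N) : Prop := |qv (f ⋆ n) - qv (f ⋆ (n + 1))| < ε (n + 1)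

/-- Here `j` is the freezing index of `hat`. It runs along with `n` until the first violation of the
rate; afterwards it lags behind for good, and so it remains constant. -/
theorem exists_hat (f : M.D .fn) : ∃ j : M.D .fn, (∀ n, hat f n = f ⋆ (j ⋆ n)) ∧ j ⋆ 0 = 0 ∧
    ∀ n, (n ≤ j ⋆ n ∧ Fast f n ∧ j ⋆ (n + 1) = n + 1) ∨
      (¬ (n ≤ j ⋆ n ∧ Fast f n) ∧ j ⋆ (n + 1) = j ⋆ n) := by
  let s : Tm [.nat, .nat, .nat, .fn] .nat :=
    FinTypeArith.cond (add (FinTypeArith.monus v0 v1)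
      (FinTypeArith.ltQ (FinTypeArith.absQ (subQ (v3 ⬝ v0) (v3 ⬝ suc v0)))
        (FinTypeArith.invPow2 (suc v0)))) (suc v0) v1
  have h := rec_lam (M := M) (cons f nil) (z := zero) (s := s) 0 (fun x y => cond (monus y x +
    ltQ (absQ (addQ (f ⋆ y) (negQ (f ⋆ (y + 1))))) (invPow2 (y + 1))) (y + 1) x)
    (by simp) (by simp [s, S_eq])
  refine ⟨eval (cons f nil) (lam (prim v0 zero s)), fun n => ?_, h.1, fun n => ?_⟩
  · simp only [hat, hatC, eval_lam, eval_app, eval_v1]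
    congr 1
  · rw [h.2]
    generalize eval (cons f nil) (lam (prim v0 zero s)) ⋆ n = x
    by_cases hc : monus n x + ltQ (absQ (addQ (f ⋆ n) (negQ (f ⋆ (n + 1))))) (invPow2 (n + 1)) = 0
    · left
      rw [hc, cond_zero]
      rw [add_eq_zero, ← le_iff_monus, ltQ_eq_zero] at hc
      refine ⟨hc.1, ?_, rfl⟩
      simpa [Fast, sub_eq_add_neg] using hc.2
    · right
      rw [cond_of_ne_zero hc]
      refine ⟨fun h => hc ?_, rfl⟩
      rw [add_eq_zero, ← le_iff_monus, ltQ_eq_zero]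
      refine ⟨h.1, ?_⟩
      simpa [Fast, sub_eq_add_neg] using h.2

/-- The rational approximations of the real named by `f`. -/
noncomputable def ap (f : M.D .fn) (n : M.N) : M.Q := qv (hat f n)

theorem hat_eq_of_fast {f : M.D .fn} (hf : ∀ n, Fast f n) (n : M.N) : hat f n = f ⋆ n := by
  obtain ⟨j, hj, h0, hs⟩ := exists_hat f
  rw [hj]
  congr 1
  refine M.induction_add_one (P := fun n => j ⋆ n = n) (cons j nil) (.eq (v1 ⬝ v0) v0) trivial
    (fun n => by simp [Sat]) h0 (fun n ih => ?_) n
  rcases hs n with h | h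
  · exact h.2.2
  · exact (h.1 ⟨ih.ge, hf n⟩).elim

theorem hat_zero (f : M.D .fn) : hat f 0 = f ⋆ 0 := by
  obtain ⟨j, hj, h0, -⟩ := exists_hat f
  rw [hj, h0]

/-- A step either passes the test `Fast` or is stationary, so the approximations converge at the
required rate whatever the name `f` is. -/
theorem abs_ap_sub_lt (f : M.D .fn) (n : M.N) : |ap f n - ap f (n + 1)| < ε (n + 1) := by
  obtain ⟨j, hj, h0, hs⟩ := exists_hat f
  have hle : j ⋆ n ≤ n := by
    rw [le_iff_monus]
    refine M.induction_add_one (P := fun n => monus (j ⋆ n) n = 0) (cons j nil)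
      (.eq (FinTypeArith.monus (v1 ⬝ v0) v0) zero) trivial
      (fun n => by simp [Sat]) (by simp [h0]) (fun n ih => ?_) n
    rw [← le_iff_monus] at ih ⊢
    rcases hs n with h | h
    · exact h.2.2.le
    · rw [h.2]
      exact ih.trans le_self_add
  rw [ap, ap, hj, hj]
  rcases hs n with h | h
  · rw [h.2.2, le_antisymm hle h.1]
    exact h.2.1
  · rw [h.2, sub_self, abs_zero]
    exact ε_pos _

theorem abs_ap_sub_le {f : M.D .fn} {m n : M.N} (h : n ≤ m) : |ap f m - ap f n| ≤ ε n := by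
  obtain ⟨i, rfl⟩ := h
  -- The extra term is the part of the geometric series still to be spent; without it the induction
  -- would not close. The claim is proved as a negated strict inequality, since `ltQ` makes that
  -- quantifier-free.
  have key : |ap f n - ap f (n + i)| + ε (n + i) ≤ ε n := by
    rw [← not_lt]
    refine M.induction_add_one (P := fun i => ¬ ε n < |ap f n - ap f (n + i)| + ε (n + i))
      (cons n (cons f nil))
      (Fm.neg (.eq (FinTypeArith.ltQ (FinTypeArith.invPow2 v1) (FinTypeArith.addQ
        (FinTypeArith.absQ (subQ (FinTypeArith.hat v2 v1) (FinTypeArith.hat v2 (add v1 v0))))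
        (FinTypeArith.invPow2 (add v1 v0)))) zero)) (by simp [Fm.QF, Fm.neg])
      (fun i => by simp [Sat, ap, sub_eq_add_neg]) (by simp) (fun i ih => ?_) i
    rw [not_lt] at ih ⊢
    have h₁ := abs_ap_sub_lt f (n + i)
    have h₂ := abs_sub_le (ap f n) (ap f (n + i)) (ap f (n + i + 1))
    have h₃ := ε_add_one (n + i)
    rw [← add_assoc]
    linarith
  rw [abs_sub_comm]
  linarith [ε_pos (n + i)]

theorem isCauchy_ap (f : M.D .fn) : IsCauchy (ap f) := fun q hq => by
  obtain ⟨n, hn⟩ := exists_ε_lt hq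
  exact ⟨n, fun m hm => (abs_ap_sub_le hm).trans hn.le⟩

variable (M) in
/-- The reals of the model. -/
abbrev R : Type := RealOf M.N M.Q

/-- The embedding of the rationals. -/
noncomputable abbrev ofQ : M.Q →+* M.R := RealOf.ofQ M.N M.Q

/-- The real named by `f`. -/
noncomputable def val (f : M.D .fn) : M.R := .mk (ap f) (isCauchy_ap f)

theorem abs_val_sub_le (f : M.D .fn) (n : M.N) : |val f - ofQ (ap f n)| ≤ ofQ (ε n) :=
  RealOf.abs_mk_sub_ofQ_le _ fun _ hm => abs_ap_sub_le hm

theorem ofQ_abs (q : M.Q) : ofQ |q| = |ofQ q| := by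
  rcases le_total 0 q with h | h
  · rw [abs_of_nonneg h, abs_of_nonneg]
    rw [← map_zero ofQ]
    exact RealOf.ofQ_le.2 h
  · rw [abs_of_nonpos h, abs_of_nonpos, map_neg]
    rw [← map_zero ofQ]
    exact RealOf.ofQ_le.2 h

/-- The step from `n` to `n + 1` is strictly shorter than 2⁻⁽ⁿ⁺¹⁾ and the remaining error is at most
that much. The strictness is what `sat_leR` needs, since `leR` is defined by strict inequalities. -/
theorem abs_val_sub_lt (f : M.D .fn) (n : M.N) : |val f - ofQ (ap f n)| < ofQ (ε n) := by
  have h₁ := abs_val_sub_le f (n + 1)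
  have h₂ : |ofQ (ap f n) - ofQ (ap f (n + 1))| < ofQ (ε (n + 1)) := by
    rw [← map_sub, ← ofQ_abs]
    exact RealOf.ofQ_lt.2 (abs_ap_sub_lt f n)
  have h₃ : ofQ (ε (n + 1)) + ofQ (ε (n + 1)) = ofQ (ε n) := by
    rw [← map_add, ε_add_one, add_halves]
  have h₄ := abs_sub_le (val f) (ofQ (ap f (n + 1))) (ofQ (ap f n))
  rw [abs_sub_comm] at h₂
  linarith

theorem le_of_forall_ε {x y : M.R} (C : M.Q) (h : ∀ n, x ≤ y + ofQ (C * ε n)) : x ≤ y := by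
  refine RealOf.le_of_forall_ofQ fun δ hδ => ?_
  obtain ⟨n, hn⟩ := exists_ε_lt (q := δ / (|C| + 1)) (by positivity)
  refine (h n).trans (add_le_add_right (RealOf.ofQ_le.2 ?_) y)
  calc C * ε n ≤ (|C| + 1) * ε n := by
        gcongr
        · exact (ε_pos n).le
        · linarith [le_abs_self C]
    _ ≤ (|C| + 1) * (δ / (|C| + 1)) := by gcongr
    _ = δ := by field_simp

theorem eq_of_forall_ε {x y : M.R} (C : M.Q) (h : ∀ n, |x - y| ≤ ofQ (C * ε n)) : x = y :=
  le_antisymm (le_of_forall_ε C fun n => by linarith [le_abs_self (x - y), h n])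
    (le_of_forall_ε C fun n => by linarith [neg_abs_le (x - y), h n])

theorem val_eq_of_approx {f : M.D .fn} {x : M.R} (C : M.Q)
    (h : ∀ n, |x - ofQ (ap f n)| ≤ ofQ (C * ε n)) : val f = x := by
  refine eq_of_forall_ε (C + 1) fun n => ?_
  have h₁ := abs_val_sub_le f n
  have h₂ := abs_sub_le (val f) (ofQ (ap f n)) x
  have h₃ := h n
  rw [abs_sub_comm] at h₃
  rw [add_mul, one_mul, map_add]
  linarith

/-! ### Operations on reals -/

def addR (f g : M.D .fn) : M.D .fn := eval nil addRC ⋆ f ⋆ g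
def mulR (f g : M.D .fn) : M.D .fn := eval nil mulRC ⋆ f ⋆ g
def negR (f : M.D .fn) : M.D .fn := eval nil negRC ⋆ f
def absR (f : M.D .fn) : M.D .fn := eval nil absRC ⋆ f
def constR (q : M.N) : M.D .fn := eval nil constRC ⋆ q

section
variable {Γ : Ctx} (e : M.Env Γ) (f g : Tm Γ .fn)
@[simp] theorem eval_addR : eval e (FinTypeArith.addR f g) =
    addR (eval e f) (eval e g) := by
  simp only [FinTypeArith.addR, eval_app, eval_cl]; rfl
@[simp] theorem eval_mulR : eval e (FinTypeArith.mulR f g) =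
    mulR (eval e f) (eval e g) := by
  simp only [FinTypeArith.mulR, eval_app, eval_cl]; rfl
@[simp] theorem eval_negR : eval e (FinTypeArith.negR f) =
    negR (eval e f) := by
  simp only [FinTypeArith.negR, eval_app, eval_cl]; rfl
@[simp] theorem eval_absR : eval e (FinTypeArith.absR f) =
    absR (eval e f) := by
  simp only [FinTypeArith.absR, eval_app, eval_cl]; rfl
@[simp] theorem eval_subR : eval e (subR f g) = addR (eval e f) (negR (eval e g)) := by
  simp only [subR, eval_addR, eval_negR]
@[simp] theorem eval_constR (q : Tm Γ .nat) :
    eval e (FinTypeArith.constR q) = constR (eval e q) := by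
  simp only [FinTypeArith.constR, eval_app, eval_cl]; rfl
end

@[simp] theorem constR_app (q n : M.N) : constR q ⋆ n = q := by simp [constR, constRC]

@[simp] theorem val_constR (q : M.N) : val (constR q) = ofQ (qv q) := by
  refine val_eq_of_approx 0 fun n => ?_
  have : ap (constR q) n = qv q := by
    rw [ap, hat_eq_of_fast, constR_app]
    intro n
    simpa [Fast] using ε_pos _
  simp [this]

theorem ap_of_fast {f : M.D .fn} {s : M.N → M.Q} (hs : ∀ n, qv (f ⋆ n) = s n)
    (h : ∀ n, |s n - s (n + 1)| < ε (n + 1)) (n : M.N) : ap f n = s n := by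
  rw [ap, hat_eq_of_fast (fun n => ?_), hs]
  rw [Fast, hs, hs]
  exact h n

-- Taking both approximations one index further halves their errors, so their sum has the prescribed
-- rate and `hat` leaves it unchanged.
@[simp] theorem val_addR (f g : M.D .fn) : val (addR f g) = val f + val g := by
  have h : ∀ n, ap (addR f g) n = ap f (n + 1) + ap g (n + 1) := by
    refine ap_of_fast (fun n => by simp [addR, addRC, ap, S_eq]) fun n => ?_
    have h₁ := abs_ap_sub_lt f (n + 1)
    have h₂ := abs_ap_sub_lt g (n + 1)
    have h₃ := ε_add_one (n + 1)
    rw [add_sub_add_comm]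
    linarith [abs_add_le (ap f (n + 1) - ap f (n + 1 + 1)) (ap g (n + 1) - ap g (n + 1 + 1))]
  refine val_eq_of_approx 1 fun n => ?_
  have h₁ := abs_val_sub_le f (n + 1)
  have h₂ := abs_val_sub_le g (n + 1)
  have h₃ : ofQ (ε (n + 1)) + ofQ (ε (n + 1)) = ofQ (1 * ε n) := by
    rw [← map_add, ε_add_one, add_halves, one_mul]
  rw [h, map_add, add_sub_add_comm]
  linarith [abs_add_le (val f - ofQ (ap f (n + 1))) (val g - ofQ (ap g (n + 1)))]

@[simp] theorem val_negR (f : M.D .fn) : val (negR f) = -val f := by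
  have h : ∀ n, ap (negR f) n = -ap f n := by
    refine ap_of_fast (fun n => by simp [negR, negRC, ap]) fun n => ?_
    rw [neg_sub_neg, abs_sub_comm]
    exact abs_ap_sub_lt f n
  refine val_eq_of_approx 1 fun n => ?_
  rw [h, map_neg, neg_sub_neg, abs_sub_comm, one_mul]
  exact abs_val_sub_le f n

@[simp] theorem val_absR (f : M.D .fn) : val (absR f) = |val f| := by
  have h : ∀ n, ap (absR f) n = |ap f n| := by
    refine ap_of_fast (fun n => by simp [absR, absRC, ap]) fun n => ?_
    exact (abs_abs_sub_abs_le _ _).trans_lt (abs_ap_sub_lt f n)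
  refine val_eq_of_approx 1 fun n => ?_
  rw [h, ofQ_abs, one_mul]
  exact (abs_abs_sub_abs_le _ _).trans (abs_val_sub_le f n)

-- The number `K` bounds the sum of the bounds of both factors. As K ≤ 2ᴷ, shifting the index by `K`
-- absorbs the growth of the error under multiplication.
@[simp] theorem val_mulR (f g : M.D .fn) : val (mulR f g) = val f * val g := by
  obtain ⟨K, hK, hb⟩ : ∃ K : M.N, (|ap f 0| + 1) + (|ap g 0| + 1) ≤ toQ _ K ∧
      ∀ n, qv (mulR f g ⋆ n) = ap f (n + K) * ap g (n + K) := by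
    refine ⟨pos (f ⋆ 0) + ngt (f ⋆ 0) + (pos (g ⋆ 0) + ngt (g ⋆ 0)) + 2, ?_, fun n => ?_⟩
    · rw [map_add, map_add, map_ofNat, ap, ap, hat_zero, hat_zero]
      linarith [abs_qv_le (f ⋆ 0), abs_qv_le (g ⋆ 0)]
    · have h2 : ∀ {Γ : Ctx} (e : M.Env Γ) , eval e (num 2) = 2 := fun e => by
        change S (S 0) = 2
        rw [S_eq, S_eq, zero_add, one_add_one_eq_two]
      simp [mulR, mulRC, mulBound, h2, ap]
  have hf : ∀ n, |ap f n| ≤ |ap f 0| + 1 := fun n => by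
    have := abs_ap_sub_le (f := f) (zero_le (a := n))
    rw [ε_zero] at this
    linarith [abs_sub_abs_le_abs_sub (ap f n) (ap f 0)]
  have hg : ∀ n, |ap g n| ≤ |ap g 0| + 1 := fun n => by
    have := abs_ap_sub_le (f := g) (zero_le (a := n))
    rw [ε_zero] at this
    linarith [abs_sub_abs_le_abs_sub (ap g n) (ap g 0)]
  have hε : ∀ n, toQ _ K * ε (n + K) ≤ ε n := fun n => by
    rw [ε_add, mul_left_comm]
    exact mul_le_of_le_one_right (ε_pos n).le (toQ_mul_ε_le K)
  have h : ∀ n, ap (mulR f g) n = ap f (n + K) * ap g (n + K) := by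
    refine ap_of_fast hb fun n => ?_
    have e₁ : n + 1 + K = n + K + 1 := by ring
    rw [e₁]
    have h₁ := abs_ap_sub_lt f (n + K)
    have h₂ := abs_ap_sub_lt g (n + K)
    have h₃ := hε (n + 1)
    rw [e₁] at h₃
    set a := ap f (n + K)
    set a' := ap f (n + K + 1)
    set b := ap g (n + K)
    set b' := ap g (n + K + 1)
    set δ := ε (n + K + 1)
    have hδ : 0 < δ := ε_pos _
    have ha := hf (n + K)
    have hb' := hg (n + K + 1)
    calc |a * b - a' * b'| = |a * (b - b') + (a - a') * b'| := by ring_nf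
      _ ≤ |a| * |b - b'| + |a - a'| * |b'| := by
          rw [← abs_mul, ← abs_mul]; exact abs_add_le _ _
      _ ≤ (|ap f 0| + 1) * |b - b'| + |a - a'| * (|ap g 0| + 1) := by gcongr
      _ < (|ap f 0| + 1) * δ + δ * (|ap g 0| + 1) := by gcongr
      _ = ((|ap f 0| + 1) + (|ap g 0| + 1)) * δ := by ring
      _ ≤ toQ _ K * δ := by gcongr
      _ ≤ ε (n + 1) := h₃
  refine val_eq_of_approx 1 fun n => ?_
  have h₁ := abs_val_sub_le f (n + K)
  have h₂ := abs_val_sub_le g (n + K)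
  have hv : |val f| ≤ ofQ (|ap f 0| + 1) := by
    have := abs_val_sub_le f 0
    rw [ε_zero] at this
    rw [map_add, ofQ_abs]
    linarith [abs_sub_abs_le_abs_sub (val f) (ofQ (ap f 0))]
  have hb' : |ofQ (ap g (n + K))| ≤ ofQ (|ap g 0| + 1) := by
    rw [← ofQ_abs]
    exact RealOf.ofQ_le.2 (hg _)
  have hδ : 0 ≤ ofQ (ε (n + K)) := by
    rw [← map_zero ofQ]
    exact RealOf.ofQ_le.2 (ε_pos _).le
  have hf0 : 0 ≤ ofQ (|ap f 0| + 1) := (abs_nonneg _).trans hv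
  rw [h, map_mul]
  set a := ofQ (ap f (n + K))
  set b := ofQ (ap g (n + K))
  calc |val f * val g - a * b| = |val f * (val g - b) + (val f - a) * b| := by ring_nf
    _ ≤ |val f| * |val g - b| + |val f - a| * |b| := by
        rw [← abs_mul, ← abs_mul]; exact abs_add_le _ _
    _ ≤ ofQ (|ap f 0| + 1) * ofQ (ε (n + K)) + ofQ (ε (n + K)) * ofQ (|ap g 0| + 1) := by gcongr
    _ = ofQ (((|ap f 0| + 1) + (|ap g 0| + 1)) * ε (n + K)) := by
        simp only [map_add, map_mul]; ring
    _ ≤ ofQ (1 * ε n) := by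
        refine RealOf.ofQ_le.2 ?_
        rw [one_mul]
        refine le_trans ?_ (hε n)
        gcongr
        exact (ε_pos _).le

-- At index n + 1 each of the two approximations has an error strictly below half of 2⁻ⁿ. So an
-- inequality of values yields the strict rational test, and conversely the tests leave only errors
-- that tend to 0.
@[simp] theorem sat_leR {Γ : Ctx} (e : M.Env Γ) (f g : Tm Γ .fn) :
    Sat e (leR f g) ↔ val (eval e f) ≤ val (eval e g) := by
  have h : Sat e (leR f g) ↔
      ∀ n, ap (eval e f) (n + 1) - ap (eval e g) (n + 1) < ε n := by
    simp [leR, Sat, S_eq, ap, sub_eq_add_neg]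
  rw [h]
  generalize eval e f = f
  generalize eval e g = g
  have h₂ : ∀ n : M.N, ofQ (ε (n + 1)) + ofQ (ε (n + 1)) = ofQ (ε n) := fun n => by
    rw [← map_add, ε_add_one, add_halves]
  constructor
  · intro h
    refine le_of_forall_ε 2 fun n => ?_
    have h₁ := RealOf.ofQ_lt (ι := M.N).2 (h n)
    have h₃ := abs_le.1 (abs_val_sub_le f (n + 1))
    have h₄ := abs_le.1 (abs_val_sub_le g (n + 1))
    rw [map_sub] at h₁
    rw [two_mul, map_add]
    linarith [h₂ n, h₃.2, h₄.1]
  · intro h n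
    have h₃ := abs_lt.1 (abs_val_sub_lt f (n + 1))
    have h₄ := abs_lt.1 (abs_val_sub_lt g (n + 1))
    rw [← RealOf.ofQ_lt (ι := M.N), map_sub]
    linarith [h₂ n, h₃.1, h₄.2]

theorem sat_eqR_iff {Γ : Ctx} (e : M.Env Γ) (f g : Tm Γ .fn) :
    Sat e (eqR f g) ↔ Sat e (leR f g) ∧ Sat e (leR g f) := by
  simp only [leR, eqR, Sat, eval_ltQ, eval_absQ, eval_subQ, eval_hat, eval_suc, eval_v0, eval_wk,
    eval_invPow2, eval_zero, ltQ_eq_zero, qv_absQ, qv_addQ, qv_negQ, qv_invPow2, ← forall_and]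
  refine forall_congr' fun n => ?_
  rw [abs_lt]
  constructor <;> rintro ⟨h₁, h₂⟩ <;> constructor <;> linarith

@[simp] theorem sat_eqR {Γ : Ctx} (e : M.Env Γ) (f g : Tm Γ .fn) :
    Sat e (eqR f g) ↔ val (eval e f) = val (eval e g) := by
  rw [sat_eqR_iff, sat_leR, sat_leR, le_antisymm_iff]

end Model

end FinTypeArith

namespace FinTypeArith

namespace Model

open Interp

variable {M : Model}

/-! ## Choice and induction in a model -/

theorem choice {Γ : Ctx} {ρ τ : Ty} (e : M.Env Γ) (A : Fm (τ :: ρ :: Γ)) (hA : A.QF)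
    (h : ∀ x, ∃ y, Sat (cons y (cons x e)) A) :
    ∃ Y : M.D (ρ ⇒ τ), ∀ x, Sat (cons (Y ⋆ x) (cons x e)) A := by
  have h₁ := M.sound (.ax (PAwX.qf_ac A hA)) e
  simp only [Sat, sat_ex, sat_subst] at h₁
  obtain ⟨Y, hY⟩ := h₁ h
  refine ⟨Y, fun x => ?_⟩
  convert hY x using 1
  funext δ v
  rcases v with _ | v
  · rfl
  rcases v with _ | v <;> rfl

/-- Choice gives a function that sends a coded pair of an argument and a witness to a witness for
the next argument. Iterating it by ground-type recursion produces all witnesses, and their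
correctness is quantifier-free. -/
theorem sigma_induction (f : M.D (.nat ⇒ .nat ⇒ .nat)) (h0 : ∃ y, f ⋆ 0 ⋆ y = 0)
    (hs : ∀ n, (∃ y, f ⋆ n ⋆ y = 0) → ∃ y, f ⋆ (n + 1) ⋆ y = 0) (n : M.N) :
    ∃ y, f ⋆ n ⋆ y = 0 := by
  obtain ⟨y₀, hy₀⟩ := h0
  obtain ⟨Y, hY⟩ := M.choice (ρ := .nat) (τ := .nat) (cons f nil)
    (.eq (v2 ⬝ FinTypeArith.fst v1 ⬝ FinTypeArith.snd v1) zero ⇛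
      .eq (v2 ⬝ suc (FinTypeArith.fst v1) ⬝ v0) zero) (by simp [Fm.QF]) (by
        intro x
        by_cases hx : f ⋆ fst x ⋆ snd x = 0
        · obtain ⟨y, hy⟩ := hs _ ⟨_, hx⟩
          exact ⟨y, fun _ => by simpa [Sat, S_eq] using hy⟩
        · exact ⟨0, fun h => (hx (by simpa [Sat] using h)).elim⟩)
  simp only [Sat, eval_app, eval_v2, eval_v1, eval_v0, eval_fst, eval_snd, eval_suc, eval_zero,
    S_eq] at hY
  have hz := rec_lam (M := M) (cons Y (cons y₀ nil)) (z := v2)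
    (s := .var (.vs (.vs (.vs .vz))) ⬝ FinTypeArith.pair v0 v1) y₀ (fun x n => Y ⋆ pair n x)
    (fun _ => rfl) (fun n x y => by simp only [eval_app, eval_pair]; rfl)
  generalize eval (cons Y (cons y₀ nil)) (lam (prim v0 v2 _)) = z at hz
  refine ⟨z ⋆ n, ?_⟩
  refine M.induction_add_one (P := fun n => f ⋆ n ⋆ (z ⋆ n) = 0) (cons f (cons z nil))
    (.eq (v1 ⬝ v0 ⬝ (v2 ⬝ v0)) zero) trivial (fun n => by simp [Sat]) (by rw [hz.1, hy₀])
    (fun n ih => ?_) n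
  rw [hz.2]
  simpa using hY (pair n (z ⋆ n)) (by simpa using ih)

/-- Contraposition: a counterexample at `B` is carried down to 0 by Σ⁰₁-induction on the distance
from `B`. The step is needed below `B` only. -/
theorem pi_induction (f : M.D (.nat ⇒ .nat ⇒ .nat)) (h0 : ∀ y, f ⋆ 0 ⋆ y = 0) (B : M.N)
    (hs : ∀ n < B, (∀ y, f ⋆ n ⋆ y = 0) → ∀ y, f ⋆ (n + 1) ⋆ y = 0) :
    ∀ y, f ⋆ B ⋆ y = 0 := by
  by_contra! hB
  let g := eval (cons B (cons f nil))
    (lam (lam (FinTypeArith.cond (v3 ⬝ FinTypeArith.monus v2 v1 ⬝ v0) (num 1) zero)))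
  have hg : ∀ i y, g ⋆ i ⋆ y = 0 ↔ f ⋆ monus B i ⋆ y ≠ 0 := by
    intro i y
    simp only [g, eval_lam, eval_cond, eval_app, eval_monus, eval_v0, eval_v1, eval_v2, eval_v3,
      eval_one, eval_zero]
    by_cases h : f ⋆ monus B i ⋆ y = 0
    · simp [h]
    · simp [cond_of_ne_zero h, h]
  obtain ⟨y, hy⟩ := M.sigma_induction g (by simpa [hg] using hB) (fun n => by
    simp only [hg, ← S_eq, monus_S]
    rcases eq_zero_or_S (monus B n) with h | h
    · rw [h, pred_zero]
      exact id
    · have hlt : pred (monus B n) < B := by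
        rw [← S_le_iff, ← S_eq, ← h, le_iff_monus]
        have hne : monus B n ≠ 0 := by rw [h]; exact S_ne_zero _
        conv_lhs => rw [eq_add_monus_of_ne_zero hne]
        rw [← le_iff_monus, add_comm, add_monus]
        exact le_self_add
      intro h₁
      by_contra! h₂
      obtain ⟨y, hy⟩ := h₁
      apply hy
      rw [h, S_eq]
      exact hs _ hlt h₂ y) B
  rw [hg] at hy
  have h₁ : monus B B = 0 := by simpa using monus_add B 0
  exact hy (by rw [h₁, h0])

/-- Sequences of reals given by an object of the model. -/
def Internal (a : M.N → M.R) : Prop := ∃ F : M.D (.nat ⇒ .fn), ∀ n, val (F ⋆ n) = a n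

theorem Internal.of_tm {Γ : Ctx} (e : M.Env Γ) (t : Tm (.nat :: Γ) .fn) {a : M.N → M.R}
    (h : ∀ n, val (eval (cons n e) t) = a n) : Internal a :=
  ⟨eval e (lam t), fun n => by rw [eval_lam, h]⟩

theorem Internal.const (f : M.D .fn) : Internal fun _ => val f :=
  .of_tm (cons f nil) v1 fun _ => rfl

theorem Internal.rat (q : M.N) : Internal (M := M) fun _ => ofQ (qv q) :=
  .of_tm (cons q nil) (FinTypeArith.constR v1) fun _ => by simp

theorem Internal.eps : Internal (M := M) fun n => ofQ (ε n) :=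
  .of_tm nil (FinTypeArith.constR (FinTypeArith.invPow2 v0)) fun _ => by simp

theorem Internal.add {a b : M.N → M.R} (ha : Internal a) (hb : Internal b) :
    Internal fun n => a n + b n := by
  obtain ⟨F, hF⟩ := ha
  obtain ⟨G, hG⟩ := hb
  exact .of_tm (cons F (cons G nil)) (FinTypeArith.addR (v1 ⬝ v0) (v2 ⬝ v0))
    fun n => by simp [hF, hG]

theorem Internal.comp {a : M.N → M.R} (ha : Internal a) (h : M.D .fn) :
    Internal fun n => a (h ⋆ n) := by
  obtain ⟨F, hF⟩ := ha
  exact .of_tm (cons F (cons h nil)) (v1 ⬝ (v2 ⬝ v0)) fun n => by simp [hF]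

theorem Internal.shift {a : M.N → M.R} (ha : Internal a) (k : M.N) :
    Internal fun n => a (k + n) := by
  simpa using ha.comp (eval (cons k nil) (lam (FinTypeArith.add v1 v0)))

/-- Induction for inequalities between reals, up to a bound. -/
theorem real_induction {a b : M.N → M.R} (ha : Internal a) (hb : Internal b) (B : M.N)
    (h0 : a 0 ≤ b 0) (hs : ∀ n < B, a n ≤ b n → a (n + 1) ≤ b (n + 1)) : a B ≤ b B := by
  obtain ⟨F, hF⟩ := ha
  obtain ⟨G, hG⟩ := hb
  let f := eval (cons F (cons G nil)) (lam (lam (FinTypeArith.ltQ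
    (subQ (FinTypeArith.hat (v2 ⬝ v1) (suc v0)) (FinTypeArith.hat (v3 ⬝ v1) (suc v0)))
    (FinTypeArith.invPow2 v0))))
  -- An inequality between reals is Π⁰₁, and `f` is the characteristic function of its matrix.
  have hf : ∀ n, (∀ y, f ⋆ n ⋆ y = 0) ↔ a n ≤ b n := fun n => by
    rw [← hF, ← hG]
    have := sat_leR (cons n (cons F (cons G nil))) (v1 ⬝ v0) (v2 ⬝ v0)
    simp only [eval_app, eval_v1, eval_v2, eval_v0] at this
    rw [← this]
    simp only [f, leR, Sat, eval_lam, eval_ltQ, eval_subQ, eval_hat, eval_app, eval_wk, eval_suc,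
      eval_v0, eval_v1, eval_v2, eval_v3, eval_invPow2, eval_zero]
  rw [← hf] at h0 ⊢
  refine M.pi_induction f h0 B fun n hn => ?_
  rw [hf, hf]
  exact hs n hn

theorem real_induction_eq {a b : M.N → M.R} (ha : Internal a) (hb : Internal b) (B : M.N)
    (h0 : a 0 = b 0) (hs : ∀ n < B, a n = b n → a (n + 1) = b (n + 1)) : a B = b B := by
  obtain ⟨F, hF⟩ := ha
  obtain ⟨G, hG⟩ := hb
  have hd : Internal fun n => |a n - b n| :=
    .of_tm (cons F (cons G nil)) (FinTypeArith.absR (subR (v1 ⬝ v0) (v2 ⬝ v0)))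
      fun n => by simp [hF, hG, sub_eq_add_neg]
  have hz : Internal (M := M) fun _ => 0 := by
    simpa using Internal.rat (eval (nil : M.Env []) zeroQ)
  have key : ∀ n, |a n - b n| ≤ 0 ↔ a n = b n := fun n => by rw [abs_nonpos_iff, sub_eq_zero]
  rw [← key] at h0 ⊢
  refine real_induction hd hz B h0 fun n hn => ?_
  rw [key, key]
  exact hs n hn

end Model

end FinTypeArith

namespace FinTypeArith

/-! ## The sequence -/

section Terms

/-- The counter: `(t, n, p)` is sent to the number of arguments `x = 0, 1, …` for which a witness
`y` with `t x y n = 0` has been found, one after the other, in `p` steps. -/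
def countC : Tm [] ((.nat ⇒ .nat ⇒ .nat ⇒ .nat) ⇒ .nat ⇒ .nat ⇒ .nat) :=
  lam (lam (lam (prim v0 zero
    (cond (.var (.vs (.vs (.vs (.vs .vz)))) ⬝ v1 ⬝ snd v0 ⬝ v3) (suc v1) v1))))

/-- The summation step: `(t, e, p, x, m)` is sent to `x + 2⁻ᵐ e_{j(m, count t m p)}`. -/
def stepC : Tm [] ((.nat ⇒ .nat ⇒ .nat ⇒ .nat) ⇒ (.nat ⇒ .X) ⇒ .nat ⇒ .X ⇒ .nat ⇒ .X) :=
  lam (lam (lam (lam (lam (addX v1 (smulX (constR (invPow2 v0))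
    (v3 ⬝ pair v0 (countC.cl ⬝ .var (.vs (.vs (.vs (.vs .vz)))) ⬝ v0 ⬝ v2))))))))

/-- The `p`-th member of the sequence is `∑_{m ≤ p} 2⁻ᵐ e_{j(m, count t m p)}`. -/
def seqC : Tm [] ((.nat ⇒ .nat ⇒ .nat ⇒ .nat) ⇒ (.nat ⇒ .X) ⇒ .nat ⇒ .X) :=
  lam (lam (lam (.con .recX ⬝ suc v0 ⬝ zeroX ⬝ (stepC.cl ⬝ v2 ⬝ v1 ⬝ v0))))

end Terms

namespace Model

open Interp

variable {M : Model}

/-! ### The inner product -/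

noncomputable def ip (x y : M.D .X) : M.R := val (M.con .innerX ⋆ x ⋆ y)
noncomputable def nrm (x : M.D .X) : M.R := val (M.con .normX ⋆ x)

@[simp] theorem val_innerX {Γ : Ctx} (e : M.Env Γ) (x y : Tm Γ .X) :
    val (eval e (innerX x y)) = ip (eval e x) (eval e y) := rfl
@[simp] theorem val_normX {Γ : Ctx} (e : M.Env Γ) (x : Tm Γ .X) :
    val (eval e (normX x)) = nrm (eval e x) := rfl

instance : Zero (M.D .X) := ⟨M.con .zeroX⟩
instance : Add (M.D .X) := ⟨fun x y => M.con .addX ⋆ x ⋆ y⟩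
def smul (a : M.D .fn) (x : M.D .X) : M.D .X := M.con .smulX ⋆ a ⋆ x

@[simp] theorem eval_zeroX {Γ : Ctx} (e : M.Env Γ) : eval e zeroX = 0 := rfl
@[simp] theorem eval_addX {Γ : Ctx} (e : M.Env Γ) (x y : Tm Γ .X) :
    eval e (addX x y) = eval e x + eval e y := rfl
@[simp] theorem eval_smulX {Γ : Ctx} (e : M.Env Γ) (a : Tm Γ .fn) (x : Tm Γ .X) :
    eval e (smulX a x) = smul (eval e a) (eval e x) := rfl

theorem ip_comm (x y : M.D .X) : ip x y = ip y x := by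
  simpa using M.sound (.ax (PAwX.inner_symm v0 v1)) (cons x (cons y nil))

theorem ip_add_left (x y z : M.D .X) : ip (x + y) z = ip x z + ip y z := by
  simpa using M.sound (.ax (PAwX.inner_add v0 v1 v2)) (cons x (cons y (cons z nil)))

theorem ip_smul_left (a : M.D .fn) (x y : M.D .X) : ip (smul a x) y = val a * ip x y := by
  simpa using M.sound (.ax (PAwX.inner_smul v0 v1 v2)) (cons a (cons x (cons y nil)))

theorem ip_self (x : M.D .X) : ip x x = nrm x * nrm x := by
  simpa using M.sound (.ax (PAwX.inner_self v0)) (cons x nil)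

theorem ip_zero_left (y : M.D .X) : ip 0 y = 0 := by
  have h : (0 : M.D .X) + 0 = 0 :=
    eq_of_ax (ρ := .X) (PAwX.addX_zero (Γ := []) zeroX) nil
  have := ip_add_left 0 0 y
  rw [h] at this
  linarith

/-! ### The counter -/

def count (t : M.D (.nat ⇒ .nat ⇒ .nat ⇒ .nat)) (n p : M.N) : M.N := eval nil countC ⋆ t ⋆ n ⋆ p

theorem count_rec (t : M.D (.nat ⇒ .nat ⇒ .nat ⇒ .nat)) (n : M.N) :
    count t n 0 = 0 ∧ ∀ p, count t n (p + 1) =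
      cond (t ⋆ count t n p ⋆ snd p ⋆ n) (count t n p + 1) (count t n p) := by
  have h : ∀ p, count t n p = eval (cons n (cons t nil)) (lam (prim v0 zero
      (FinTypeArith.cond (.var (.vs (.vs (.vs (.vs .vz)))) ⬝ v1 ⬝ FinTypeArith.snd v0 ⬝ v3)
        (suc v1) v1))) ⋆ p := fun p => by simp only [count, countC, eval_lam]
  simp only [h]
  refine rec_lam (cons n (cons t nil)) 0 (fun x p => cond (t ⋆ x ⋆ snd p ⋆ n) (x + 1) x)
    (by simp) fun a x p => ?_
  simp only [eval_cond, eval_suc, eval_app, eval_snd, eval_v0, eval_v1, eval_v3, S_eq]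
  rfl

variable {t : M.D (.nat ⇒ .nat ⇒ .nat ⇒ .nat)}

theorem count_zero (n : M.N) : count t n 0 = 0 := (count_rec t n).1

theorem count_of_eq {n p : M.N} (h : t ⋆ count t n p ⋆ snd p ⋆ n = 0) :
    count t n (p + 1) = count t n p + 1 := by rw [(count_rec t n).2, h, cond_zero]

theorem count_of_ne {n p : M.N} (h : t ⋆ count t n p ⋆ snd p ⋆ n ≠ 0) :
    count t n (p + 1) = count t n p := by rw [(count_rec t n).2, cond_of_ne_zero h]

/-- The function `p ↦ count t n p` as a term with parameters `t` and `n`. -/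
theorem eval_count {Γ : Ctx} (e : M.Env Γ) (t : Tm Γ (.nat ⇒ .nat ⇒ .nat ⇒ .nat))
    (n p : Tm Γ .nat) :
    eval e (countC.cl ⬝ t ⬝ n ⬝ p) = count (eval e t) (eval e n) (eval e p) := by
  simp only [eval_app, eval_cl]; rfl

theorem count_mono (n : M.N) {p q : M.N} (h : p ≤ q) : count t n p ≤ count t n q := by
  obtain ⟨i, rfl⟩ := h
  rw [le_iff_monus]
  refine M.induction_add_one (P := fun i => monus (count t n p) (count t n (p + i)) = 0)
    (cons t (cons n (cons p nil))) (.eq (FinTypeArith.monus (countC.cl ⬝ v1 ⬝ v2 ⬝ v3)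
      (countC.cl ⬝ v1 ⬝ v2 ⬝ add v3 v0)) zero) trivial
    (fun i => by simp only [Sat, eval_monus, eval_count, eval_add, eval_v0, eval_v1, eval_v2,
      eval_v3, eval_zero])
    (by rw [← le_iff_monus, add_zero]) (fun i ih => ?_) i
  rw [← le_iff_monus] at ih ⊢
  rw [← add_assoc]
  by_cases h : t ⋆ count t n (p + i) ⋆ snd (p + i) ⋆ n = 0
  · rw [count_of_eq h]
    exact ih.trans le_self_add
  · rw [count_of_ne h]
    exact ih

/-- The counter for `n` finally takes the value `j`. -/
def CountLim (t : M.D (.nat ⇒ .nat ⇒ .nat ⇒ .nat)) (n j : M.N) : Prop :=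
  ∃ p₀, ∀ p, p₀ ≤ p → count t n p = j

/-- A monotone counter passes beyond `j`, or attains `j` and remains there, or never takes that
value; in each case the question whether it equals `j` has an eventually constant answer. -/
theorem countLim_or (n j : M.N) : CountLim t n j ∨ ∃ p₀, ∀ p, p₀ ≤ p → count t n p ≠ j := by
  by_cases h : ∃ p₀, j < count t n p₀
  · obtain ⟨p₀, h⟩ := h
    exact .inr ⟨p₀, fun p hp => (h.trans_le (count_mono n hp)).ne'⟩
  · push Not at h
    by_cases h' : ∃ p₀, count t n p₀ = j
    · obtain ⟨p₀, h'⟩ := h'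
      exact .inl ⟨p₀, fun p hp => le_antisymm (h p) (h'.ge.trans (count_mono n hp))⟩
    · push Not at h'
      exact .inr ⟨0, fun p _ => h' p⟩

theorem CountLim.unique {n i j : M.N} (hi : CountLim t n i) (hj : CountLim t n j) : i = j := by
  obtain ⟨p, hp⟩ := hi
  obtain ⟨q, hq⟩ := hj
  rw [← hp _ (le_max_left p q), hq _ (le_max_right p q)]

theorem CountLim.count_eq {n p q : M.N} (h : CountLim t n (count t n p)) (hpq : p ≤ q) :
    count t n q = count t n p := by
  obtain ⟨p₀, hp⟩ := h
  refine le_antisymm ?_ (count_mono n hpq)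
  rw [← hp _ (le_max_right q p₀)]
  exact count_mono n (le_max_left _ _)

/-- The counter for `n` converges unless `∀ x ∃ y t x y n = 0`. -/
theorem exists_countLim_iff (n : M.N) :
    (∃ j, CountLim t n j) ↔ ¬ ∀ x, ∃ y, t ⋆ x ⋆ y ⋆ n = 0 := by
  constructor
  · rintro ⟨j, p₀, hp⟩ h
    obtain ⟨y, hy⟩ := h j
    -- The step `pair p₀ y` comes no earlier than `p₀` and proposes the witness `y`, so it moves the
    -- counter away from its supposed limit.
    have h₁ := hp _ (le_pair p₀ y)
    have h₂ := count_of_eq (t := t) (n := n) (p := pair p₀ y) (by rw [h₁, snd_pair, hy])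
    rw [h₁, hp _ ((le_pair p₀ y).trans le_self_add)] at h₂
    exact absurd h₂.symm (by simp)
  · intro h
    by_contra hC
    apply h
    -- A counter without a limit leaves each value it attains, and it does so by one unit;
    -- Σ⁰₁-induction shows that it attains all values.
    have hreach : ∀ v, ∃ p, count t n p = v := by
      let f := eval (cons n (cons t nil)) (lam (lam (FinTypeArith.add
        (FinTypeArith.monus v1 (countC.cl ⬝ v3 ⬝ v2 ⬝ v0))
        (FinTypeArith.monus (countC.cl ⬝ v3 ⬝ v2 ⬝ v0) v1))))
      have hf : ∀ v p, f ⋆ v ⋆ p = 0 ↔ count t n p = v := fun v p => by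
        simp only [f, eval_lam, eval_add, eval_monus, eval_count, eval_v0, eval_v1, eval_v2,
          eval_v3, add_eq_zero, ← le_iff_monus, le_antisymm_iff (a := count t n p)]
        exact and_comm
      have := M.sigma_induction f ⟨0, by rw [hf, count_zero]⟩ (fun v => by
        simp only [hf]
        rintro ⟨p, hp⟩
        by_contra! hne
        refine hC ⟨v, p, ?_⟩
        rintro _ ⟨i, rfl⟩
        refine M.induction_add_one (P := fun i => count t n (p + i) = v)
          (cons t (cons n (cons p (cons v nil))))
          (.eq (countC.cl ⬝ v1 ⬝ v2 ⬝ add v3 v0) (.var (.vs (.vs (.vs (.vs .vz)))))) trivial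
          (fun i => by
            simp only [Sat, eval_count, eval_add, eval_v0, eval_v1, eval_v2, eval_v3]
            rfl)
          (by rw [add_zero, hp]) (fun i ih => ?_) i
        rw [← add_assoc]
        by_cases h : t ⋆ count t n (p + i) ⋆ snd (p + i) ⋆ n = 0
        · exact (hne _ (by rw [count_of_eq h, ih])).elim
        · rw [count_of_ne h, ih])
      simpa only [hf] using this
    intro x
    by_contra! hx
    obtain ⟨p, hp⟩ := hreach (x + 1)
    -- An argument `x` without a witness blocks the counter, which therefore cannot reach `x + 1`.
    have hle : count t n p ≤ x := by
      rw [le_iff_monus]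
      refine M.induction_add_one (P := fun p => monus (count t n p) x = 0)
        (cons t (cons n (cons x nil)))
        (.eq (FinTypeArith.monus (countC.cl ⬝ v1 ⬝ v2 ⬝ v0) v3) zero) trivial
        (fun i => by simp only [Sat, eval_monus, eval_count, eval_v0, eval_v1, eval_v2, eval_v3,
          eval_zero])
        (by rw [← le_iff_monus, count_zero]; exact zero_le) (fun p ih => ?_) p
      rw [← le_iff_monus] at ih ⊢
      by_cases h : t ⋆ count t n p ⋆ snd p ⋆ n = 0
      · rw [count_of_eq h, S_le_iff]
        refine lt_of_le_of_ne ih fun h' => hx (snd p) ?_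
        rwa [h'] at h
      · rw [count_of_ne h]
        exact ih
    rw [hp] at hle
    exact absurd (S_le_iff.1 hle) (lt_irrefl x)

end Model

end FinTypeArith

namespace FinTypeArith

namespace Model

open Interp

variable {M : Model}

/-! ### The partial sums -/

/-- The `m`-th vector occurring in the `p`-th member of the sequence. -/
def vec (t : M.D (.nat ⇒ .nat ⇒ .nat ⇒ .nat)) (e : M.D (.nat ⇒ .X)) (p m : M.N) : M.D .X :=
  e ⋆ pair m (count t m p)

/-- The sum of the first `q` summands of the `p`-th member of the sequence. -/
def part (t : M.D (.nat ⇒ .nat ⇒ .nat ⇒ .nat)) (e : M.D (.nat ⇒ .X)) (p q : M.N) : M.D .X :=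
  M.con .recX ⋆ q ⋆ 0 ⋆ (eval nil stepC ⋆ t ⋆ e ⋆ p)

variable {t : M.D (.nat ⇒ .nat ⇒ .nat ⇒ .nat)} {e : M.D (.nat ⇒ .X)}

theorem seqC_app (p : M.N) : eval nil seqC ⋆ t ⋆ e ⋆ p = part t e p (p + 1) := by
  simp only [seqC, eval_lam, eval_app, eval_con, eval_suc, eval_cl, eval_v0, eval_v1, eval_v2, S_eq]
  rfl

theorem part_zero (p : M.N) : part t e p 0 = 0 :=
  eq_of_ax (ρ := .X) (PAwX.recX_zero v0 v1)
    (cons (0 : M.D .X) (cons (eval nil stepC ⋆ t ⋆ e ⋆ p) nil))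

theorem part_add_one (p q : M.N) :
    part t e p (q + 1) = part t e p q + smul (constR (invPow2 q)) (vec t e p q) := by
  have h : part t e p (S q) = eval nil stepC ⋆ t ⋆ e ⋆ p ⋆ part t e p q ⋆ q :=
    eq_of_ax (ρ := .X) (PAwX.recX_succ v0 v1 v2)
      (cons q (cons (0 : M.D .X) (cons (eval nil stepC ⋆ t ⋆ e ⋆ p) nil)))
  rw [← S_eq, h]
  simp only [stepC, eval_lam, eval_addX, eval_smulX, eval_constR, eval_invPow2, eval_app, eval_pair,
    eval_cl, eval_v0, eval_v1, eval_v2, eval_v3]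
  rfl

theorem ip_part_zero (p : M.N) (y : M.D .X) : ip (part t e p 0) y = 0 := by
  rw [part_zero, ip_zero_left]

theorem ip_part_add_one (p q : M.N) (y : M.D .X) :
    ip (part t e p (q + 1)) y = ip (part t e p q) y + ofQ (ε q) * ip (vec t e p q) y := by
  rw [part_add_one, ip_add_left, ip_smul_left, val_constR, qv_invPow2]

theorem internal_ip_part (p : M.N) (y : M.D .X) : Internal fun q => ip (part t e p q) y :=
  .of_tm (cons (eval nil stepC ⋆ t ⋆ e ⋆ p) (cons y nil))
    (innerX (.con .recX ⬝ v0 ⬝ zeroX ⬝ v1) v2) fun _ => rfl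

theorem internal_ip_part_self (p : M.N) :
    Internal fun q => ip (part t e p q) (part t e p q) :=
  .of_tm (cons (eval nil stepC ⋆ t ⋆ e ⋆ p) nil)
    (innerX (.con .recX ⬝ v0 ⬝ zeroX ⬝ v1) (.con .recX ⬝ v0 ⬝ zeroX ⬝ v1)) fun _ => rfl

theorem internal_zero : Internal (M := M) fun _ => 0 := by
  simpa using Internal.rat (eval (nil : M.Env []) zeroQ)

theorem pair_inj {a b c d : M.N} (h : pair a b = pair c d) : a = c ∧ b = d :=
  ⟨by simpa using congrArg fst h, by simpa using congrArg snd h⟩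

theorem ofQ_ε_pos (n : M.N) : 0 < ofQ (ε n) := by
  rw [← map_zero ofQ]
  exact RealOf.ofQ_lt.2 (ε_pos n)

/-- `e` is orthonormal. -/
def Orthonormal (e : M.D (.nat ⇒ .X)) : Prop :=
  (∀ i, ip (e ⋆ i) (e ⋆ i) = 1) ∧ ∀ i j, i ≠ j → ip (e ⋆ i) (e ⋆ j) = 0

theorem ip_part_of_ne (he : Orthonormal e) {n j p : M.N} (h : count t n p ≠ j) (q : M.N) :
    ip (part t e p q) (e ⋆ pair n j) = 0 := by
  refine real_induction_eq (internal_ip_part p _) internal_zero q (ip_part_zero _ _)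
    fun q _ ih => ?_
  rw [ip_part_add_one, ih, vec, he.2, mul_zero, add_zero]
  intro h'
  obtain ⟨rfl, h''⟩ := pair_inj h'
  exact h h''

theorem ip_part_of_le (he : Orthonormal e) {n j p q : M.N} (h : q ≤ n) :
    ip (part t e p q) (e ⋆ pair n j) = 0 := by
  refine real_induction_eq (internal_ip_part p _) internal_zero q (ip_part_zero _ _)
    fun m hm ih => ?_
  rw [ip_part_add_one, ih, vec, he.2, mul_zero, add_zero]
  intro h'
  exact (hm.trans_le h).ne (pair_inj h').1

/-- Only the summand with number `n` has an index with first component `n`. Everything before it and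
after it is orthogonal to the given basis vector. -/
theorem ip_part_of_eq (he : Orthonormal e) {n p q : M.N} (h : n < q) :
    ip (part t e p q) (e ⋆ pair n (count t n p)) = ofQ (ε n) := by
  obtain ⟨i, rfl⟩ := S_le_iff.2 h
  refine real_induction_eq ((internal_ip_part p _).shift (n + 1))
    (b := fun _ => ofQ (ε n)) (by simpa using Internal.rat (invPow2 n)) i ?_ fun m _ ih => ?_
  · rw [add_zero, ip_part_add_one, ip_part_of_le he le_rfl, vec, he.1]
    ring
  · rw [← add_assoc, ip_part_add_one, ih, vec, he.2, mul_zero, add_zero]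
    intro h'
    have h₁ := (pair_inj h').1
    have h₂ : n < n + 1 + m := S_le_iff.1 le_self_add
    exact h₂.ne' h₁

/-- The new summand is orthogonal to the sum before it, so the squared norm is a partial sum of ∑
4⁻ᵐ, which stays below 2. -/
theorem ip_part_self_le (he : Orthonormal e) (p q : M.N) :
    ip (part t e p q) (part t e p q) ≤ 2 := by
  have h2 : (2 : M.R) = ofQ (qv (addQ (eval (nil : M.Env []) oneQ) (eval nil oneQ))) := by
    simp only [qv_addQ, qv_oneQ, one_add_one_eq_two]
    exact (map_ofNat ofQ 2).symm
  -- The added 2 · 4⁻q makes the claim inductive: each step spends 4⁻q, while this reserve shrinks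
  -- by more than that.
  have h := real_induction (a := fun q => ip (part t e p q) (part t e p q) +
      (ofQ (ε (q + q)) + ofQ (ε (q + q)))) (b := fun _ => 2)
    ((internal_ip_part_self p).add ?_) (by rw [h2]; exact Internal.rat _) q ?_ fun q _ ih => ?_
  · linarith [ofQ_ε_pos (q + q)]
  · have : Internal (M := M) fun q => ofQ (ε (q + q)) := by
      simpa using Internal.eps.comp (eval (nil : M.Env []) (lam (add v0 v0)))
    exact this.add this
  · simp [ip_part_zero, one_add_one_eq_two]
  · have h₁ : ip (part t e p (q + 1)) (part t e p (q + 1)) =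
        ip (part t e p q) (part t e p q) + ofQ (ε q) * ofQ (ε q) := by
      rw [ip_part_add_one, ip_comm _ (part t e p (q + 1)), ip_comm (vec t e p q), ip_part_add_one,
        ip_part_add_one, ip_comm (vec t e p q) (part t e p q), vec, ip_part_of_le he le_rfl, he.1]
      ring
    have h₂ : ofQ (ε q) * ofQ (ε q) = ofQ (ε (q + q)) := by rw [← map_mul, ε_add]
    have h₃ : ofQ (ε (q + q)) = 4 * ofQ (ε (q + 1 + (q + 1))) := by
      rw [show q + 1 + (q + 1) = q + q + 1 + 1 by ring, ε_add_one, ε_add_one, ← map_ofNat ofQ 4,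
        ← map_mul]
      congr 1
      ring
    rw [h₁, h₂, h₃]
    rw [h₃] at ih
    linarith [ofQ_ε_pos (q + 1 + (q + 1))]

theorem nrm_part_le (he : Orthonormal e) (p q : M.N) : nrm (part t e p q) ≤ 2 := by
  have h := ip_part_self_le he (t := t) p q
  rw [ip_self] at h
  by_contra! hlt
  nlinarith

/-! ### Weak limits -/

/-- `x` is the weak limit of the subsequence given by `h`. -/
def WeakLimit (φ : M.D (.nat ⇒ .X)) (h : M.D .fn) (x : M.D .X) : Prop :=
  ∀ y k, ∃ m, ∀ i, m ≤ i → |ip y (φ ⋆ (h ⋆ i)) - ip y x| ≤ ofQ (ε k)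

theorem le_of_strictIncr {h : M.D .fn} (hh : ∀ i, h ⋆ i + 1 ≤ h ⋆ (i + 1)) (i : M.N) :
    i ≤ h ⋆ i := by
  rw [le_iff_monus]
  refine M.induction_add_one (P := fun i => monus i (h ⋆ i) = 0) (cons h nil)
    (.eq (FinTypeArith.monus v0 (v1 ⬝ v0)) zero) trivial (fun n => by simp [Sat])
    (le_iff_monus.1 zero_le) (fun i ih => ?_) i
  rw [← le_iff_monus] at ih ⊢
  exact (add_le_add_left ih 1).trans (hh i)

variable {φ : M.D (.nat ⇒ .X)} {h : M.D .fn} {x : M.D .X}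

theorem WeakLimit.exists_ge (hx : WeakLimit φ h x)
    (hh : ∀ i, h ⋆ i + 1 ≤ h ⋆ (i + 1)) (y : M.D .X) (k p₀ : M.N) :
    ∃ p, p₀ ≤ p ∧ |ip y (φ ⋆ p) - ip y x| ≤ ofQ (ε k) := by
  obtain ⟨m, hm⟩ := hx y k
  exact ⟨h ⋆ max m p₀, (le_max_right m p₀).trans (le_of_strictIncr hh _), hm _ (le_max_left _ _)⟩

theorem WeakLimit.le_of_eventually (hx : WeakLimit φ h x)
    (hh : ∀ i, h ⋆ i + 1 ≤ h ⋆ (i + 1)) {y : M.D .X} {r : M.R} {p₀ : M.N}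
    (hr : ∀ p, p₀ ≤ p → r ≤ ip y (φ ⋆ p)) : r ≤ ip y x := by
  refine le_of_forall_ε 1 fun n => ?_
  obtain ⟨p, hp, h⟩ := hx.exists_ge hh y n p₀
  rw [one_mul]
  linarith [hr p hp, (abs_le.1 h).2]

theorem WeakLimit.eq_of_eventually (hx : WeakLimit φ h x)
    (hh : ∀ i, h ⋆ i + 1 ≤ h ⋆ (i + 1)) {y : M.D .X} {r : M.R} {p₀ : M.N}
    (hr : ∀ p, p₀ ≤ p → ip y (φ ⋆ p) = r) : ip y x = r := by
  refine le_antisymm (le_of_forall_ε 1 fun n => ?_) (hx.le_of_eventually hh fun p hp => (hr p hp).ge)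
  obtain ⟨p, hp, h⟩ := hx.exists_ge hh y n p₀
  rw [one_mul]
  linarith [hr p hp, (abs_le.1 h).1]

/-! ### Coefficients of the weak limit and the gap in ⟨x, x⟩. -/

theorem coeff_of_countLim (he : Orthonormal e) (hh : ∀ i, h ⋆ i + 1 ≤ h ⋆ (i + 1))
    (hx : WeakLimit (eval nil seqC ⋆ t ⋆ e) h x) {n j : M.N} (hj : CountLim t n j) :
    ip (e ⋆ pair n j) x = ofQ (ε n) := by
  obtain ⟨p₀, hp⟩ := hj
  refine hx.eq_of_eventually hh (p₀ := max p₀ n) fun p hp' => ?_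
  rw [seqC_app, ip_comm, ← hp p ((le_max_left _ _).trans hp')]
  exact ip_part_of_eq he (lt_S_iff.2 ((le_max_right _ _).trans hp'))

theorem coeff_of_not_countLim (he : Orthonormal e) (hh : ∀ i, h ⋆ i + 1 ≤ h ⋆ (i + 1))
    (hx : WeakLimit (eval nil seqC ⋆ t ⋆ e) h x) {n j : M.N} (hj : ¬ CountLim t n j) :
    ip (e ⋆ pair n j) x = 0 := by
  obtain ⟨p₀, hp⟩ := (countLim_or n j).resolve_left hj
  refine hx.eq_of_eventually hh (p₀ := p₀) fun p hp' => ?_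
  rw [seqC_app, ip_comm]
  exact ip_part_of_ne he (hp p hp') _

theorem coeff_nonneg (he : Orthonormal e) (hh : ∀ i, h ⋆ i + 1 ≤ h ⋆ (i + 1))
    (hx : WeakLimit (eval nil seqC ⋆ t ⋆ e) h x) (n j : M.N) : 0 ≤ ip (e ⋆ pair n j) x := by
  by_cases hj : CountLim t n j
  · rw [coeff_of_countLim he hh hx hj]
    exact (ofQ_ε_pos n).le
  · rw [coeff_of_not_countLim he hh hx hj]

/-- If the value of the counter at `p` is final, both sides agree; otherwise the left side vanishes
and the right side is nonnegative. This termwise comparison avoids waiting for all counters up to a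
bound at once. -/
theorem coeff_mono (he : Orthonormal e) (hh : ∀ i, h ⋆ i + 1 ≤ h ⋆ (i + 1))
    (hx : WeakLimit (eval nil seqC ⋆ t ⋆ e) h x) {p p' : M.N} (hp : p ≤ p') (m : M.N) :
    ip (vec t e p m) x ≤ ip (vec t e p' m) x := by
  by_cases hj : CountLim t m (count t m p)
  · rw [vec, vec, hj.count_eq hp]
  · rw [vec, coeff_of_not_countLim he hh hx hj]
    exact coeff_nonneg he hh hx _ _

theorem ip_part_mono (he : Orthonormal e) (hh : ∀ i, h ⋆ i + 1 ≤ h ⋆ (i + 1))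
    (hx : WeakLimit (eval nil seqC ⋆ t ⋆ e) h x) {p q q' : M.N} (hq : q ≤ q') :
    ip (part t e p q) x ≤ ip (part t e p q') x := by
  obtain ⟨i, rfl⟩ := hq
  refine real_induction (a := fun _ => ip (part t e p q) x)
    (Internal.const (M.con .innerX ⋆ part t e p q ⋆ x))
    ((internal_ip_part p x).shift q) i (by rw [add_zero]) fun m _ ih => ?_
  rw [← add_assoc, ip_part_add_one]
  have := mul_nonneg (ofQ_ε_pos (q + m)).le (coeff_nonneg he hh hx (q + m) (count t (q + m) p))
  rw [vec]
  linarith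

theorem ip_part_le_ip_part (he : Orthonormal e) (hh : ∀ i, h ⋆ i + 1 ≤ h ⋆ (i + 1))
    (hx : WeakLimit (eval nil seqC ⋆ t ⋆ e) h x) {p p' : M.N} (hp : p ≤ p') (q : M.N) :
    ip (part t e p q) x ≤ ip (part t e p' q) x := by
  refine real_induction (internal_ip_part p x) (internal_ip_part p' x) q
    (by rw [ip_part_zero, ip_part_zero]) fun m _ ih => ?_
  rw [ip_part_add_one, ip_part_add_one]
  have := mul_le_mul_of_nonneg_left (coeff_mono he hh hx hp m) (ofQ_ε_pos m).le
  linarith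

/-- If the counter for `n` converges, but has not reached its limit at `p`, then the `p`-th member
of the sequence is far from the weak limit in the direction of the limit. -/
theorem ip_seq_add_le (he : Orthonormal e) (hh : ∀ i, h ⋆ i + 1 ≤ h ⋆ (i + 1))
    (hx : WeakLimit (eval nil seqC ⋆ t ⋆ e) h x) {n j p : M.N}
    (hj : CountLim t n j) (hp : count t n p ≠ j) :
    ip x (eval nil seqC ⋆ t ⋆ e ⋆ p) + ofQ (ε (n + n)) ≤ ip x x := by
  have hj' := hj
  obtain ⟨p₀, hp₀⟩ := hj'
  refine hx.le_of_eventually hh (p₀ := max p₀ (max n p)) fun p' hp' => ?_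
  have h₀ : p₀ ≤ p' := (le_max_left _ _).trans hp'
  have hn : max n p ≤ p' := (le_max_right _ _).trans hp'
  have hpp : p ≤ p' := (le_max_right _ _).trans hn
  -- The two members have different lengths, so both are cut or extended to a common length that
  -- includes the summand `n`. There the earlier member contributes 0 and the later one 4⁻ⁿ; all
  -- other summands compare by `coeff_mono`.
  have key : ip (part t e p (max n p + 1)) x + ofQ (ε (n + n)) ≤
      ip (part t e p' (max n p + 1)) x := by
    obtain ⟨i, hi⟩ := add_le_add_left (le_max_left n p) 1
    rw [hi]
    refine real_induction (a := fun i => ip (part t e p (n + 1 + i)) x + ofQ (ε (n + n)))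
      (((internal_ip_part p x).shift (n + 1)).add (by simpa using Internal.rat (invPow2 (n + n))))
      ((internal_ip_part p' x).shift (n + 1)) i ?_ fun m _ ih => ?_
    · simp only [add_zero, ip_part_add_one]
      have h₁ : ip (vec t e p n) x = 0 :=
        coeff_of_not_countLim he hh hx fun h' => hp (h'.unique hj)
      have h₂ : ip (vec t e p' n) x = ofQ (ε n) := by
        rw [vec, hp₀ p' h₀]
        exact coeff_of_countLim he hh hx hj
      rw [h₁, h₂, ε_add, map_mul]
      linarith [ip_part_le_ip_part he hh hx hpp n]
    · simp only [← add_assoc, ip_part_add_one]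
      have := mul_le_mul_of_nonneg_left (coeff_mono he hh hx hpp (n + 1 + m))
        (ofQ_ε_pos (n + 1 + m)).le
      linarith
  rw [ip_comm x, ip_comm x, seqC_app, seqC_app]
  -- The summands added or cut off pair nonnegatively with `x`, so changing the lengths moves each
  -- bound in the favourable direction.
  have h₁ := ip_part_mono he hh hx (p := p) (add_le_add_left (le_max_right n p) 1)
  have h₂ := ip_part_mono he hh hx (p := p') (add_le_add_left hn 1)
  linarith

/-- Any step at which the member comes within 4⁻ⁿ of ⟨x, x⟩ in the direction `x` is a waiting time
for the counter of `n`; the coefficient of `x` at the value found there then reveals whether that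
value is final. -/
theorem exists_characteristic (he : Orthonormal e) (hh : ∀ i, h ⋆ i + 1 ≤ h ⋆ (i + 1))
    (hx : WeakLimit (eval nil seqC ⋆ t ⋆ e) h x) :
    ∃ g : M.D .fn, ∀ n, g ⋆ n = 0 ↔ ∀ x, ∃ y, t ⋆ x ⋆ y ⋆ n = 0 := by
  set φ := eval nil seqC ⋆ t ⋆ e with hφ
  have hhalf : ∀ n : M.N, ofQ (ε (n + 1)) + ofQ (ε (n + 1)) = ofQ (ε n) := fun n => by
    rw [← map_add, ε_add_one, add_halves]
  -- The real inequality is replaced by a rational one to make the matrix quantifier-free. Precision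
  -- 2n + 2 for both the limit and the approximation keeps the total error below 2⁻⁽²ⁿ⁺¹⁾.
  obtain ⟨Y, hY⟩ := M.choice (ρ := .nat) (τ := .nat) (cons x (cons φ nil))
    (.eq (FinTypeArith.ltQ (FinTypeArith.hat (subR (innerX v2 v2) (innerX v2 (v3 ⬝ v0)))
      (suc (suc (add v1 v1)))) (FinTypeArith.invPow2 (suc (add v1 v1)))) zero) trivial (by
      intro n
      obtain ⟨p, -, hp⟩ := hx.exists_ge hh x (n + n + 1 + 1) 0
      refine ⟨p, ?_⟩
      simp only [Sat, eval_ltQ, eval_hat, eval_subR, eval_suc, eval_add, eval_v1, eval_invPow2,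
        eval_zero, S_eq, ltQ_eq_zero, qv_invPow2]
      rw [← RealOf.ofQ_lt (ι := M.N)]
      have h₁ := (abs_lt.1 (abs_val_sub_lt (addR (M.con .innerX ⋆ x ⋆ x)
        (negR (M.con .innerX ⋆ x ⋆ (φ ⋆ p)))) (n + n + 1 + 1))).1
      rw [val_addR, val_negR] at h₁
      change _ < ip x x + - ip x (φ ⋆ p) - _ at h₁
      have h₂ := (abs_le.1 hp).1
      have h₃ := hhalf (n + n + 1)
      change ofQ (ap (addR (M.con .innerX ⋆ x ⋆ x) (negR (M.con .innerX ⋆ x ⋆ (φ ⋆ p)))) _) < _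
      linarith)
  -- Back to reals: the tested bound 2⁻⁽²ⁿ⁺¹⁾ and the approximation error 2⁻⁽²ⁿ⁺²⁾ together stay
  -- below 4⁻ⁿ.
  have hY' : ∀ n, ip x x < ip x (φ ⋆ (Y ⋆ n)) + ofQ (ε (n + n)) := by
    intro n
    have h := hY n
    simp only [Sat, eval_ltQ, eval_hat, eval_subR, eval_suc, eval_add, eval_v1, eval_invPow2,
      eval_zero, S_eq, ltQ_eq_zero, qv_invPow2] at h
    rw [← RealOf.ofQ_lt (ι := M.N)] at h
    change ofQ (ap (addR (M.con .innerX ⋆ x ⋆ x) (negR (M.con .innerX ⋆ x ⋆ (φ ⋆ (Y ⋆ n))))) _) < _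
      at h
    have h₁ := (abs_lt.1 (abs_val_sub_lt (addR (M.con .innerX ⋆ x ⋆ x)
      (negR (M.con .innerX ⋆ x ⋆ (φ ⋆ (Y ⋆ n))))) (n + n + 1 + 1))).2
    rw [val_addR, val_negR] at h₁
    change ip x x + - ip x (φ ⋆ (Y ⋆ n)) - _ < _ at h₁
    linarith [hhalf (n + n + 1), hhalf (n + n), ofQ_ε_pos (n + n + 1 + 1)]
  -- If the value at `Y n` were not the limit, `ip_seq_add_le` would leave a gap of 4⁻ⁿ, contrary to
  -- the choice of `Y`.
  have hlim : ∀ n, (∃ j, CountLim t n j) ↔ CountLim t n (count t n (Y ⋆ n)) := by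
    refine fun n => ⟨fun ⟨j, hj⟩ => ?_, fun h => ⟨_, h⟩⟩
    by_contra hne
    have h₁ := ip_seq_add_le he hh hx hj (p := Y ⋆ n) (fun h' => hne (h'.symm ▸ hj))
    exact absurd h₁ (hY' n).not_ge
  -- The coefficient is 2⁻ⁿ or 0; an approximation with error below 2⁻⁽ⁿ⁺²⁾, compared with the
  -- threshold 2⁻⁽ⁿ⁺¹⁾, separates these cases. Subtracting the test from 1 gives the value 0 exactly
  -- when the coefficient vanishes, that is, when the counter diverges.
  let g := eval (cons Y (cons t (cons e (cons x nil)))) (lam (FinTypeArith.monus (num 1)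
    (FinTypeArith.ltQ (FinTypeArith.invPow2 (suc v0)) (FinTypeArith.hat
      (innerX (v3 ⬝ FinTypeArith.pair v0 (countC.cl ⬝ v2 ⬝ v0 ⬝ (v1 ⬝ v0)))
        (.var (.vs (.vs (.vs (.vs .vz)))))) (suc (suc v0))))))
  refine ⟨g, fun n => ?_⟩
  rw [← not_iff_not, ← exists_countLim_iff, hlim]
  have hg : g ⋆ n = 0 ↔ ¬ ε (n + 1) <
      ap (M.con .innerX ⋆ (e ⋆ pair n (count t n (Y ⋆ n))) ⋆ x) (n + 1 + 1) := by
    have h₁ : g ⋆ n = monus 1 (ltQ (invPow2 (n + 1))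
        (hat (M.con .innerX ⋆ (e ⋆ pair n (count t n (Y ⋆ n))) ⋆ x) (n + 1 + 1))) := by
      simp only [g, eval_lam, eval_monus, eval_one, eval_ltQ, eval_invPow2, eval_suc, eval_v0,
        eval_hat, S_eq]
      simp only [innerX, eval_app, eval_con, eval_pair, eval_cl, eval_v0, eval_v1, eval_v2, eval_v3]
      rfl
    rw [h₁, ap, ← qv_invPow2, ← ltQ_eq_zero, ← le_iff_monus, ← ne_eq, ← pos_iff_ne_zero,
      ← S_le_iff, zero_add]
  rw [hg, not_not, ← RealOf.ofQ_lt (ι := M.N)]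
  have happ := abs_lt.1 (abs_val_sub_lt
    (M.con .innerX ⋆ (e ⋆ pair n (count t n (Y ⋆ n))) ⋆ x) (n + 1 + 1))
  change _ < ip (e ⋆ pair n (count t n (Y ⋆ n))) x - _ ∧
    ip (e ⋆ pair n (count t n (Y ⋆ n))) x - _ < _ at happ
  have h₁ := hhalf n
  have h₂ := hhalf (n + 1)
  have h₃ := ofQ_ε_pos (n + 1 + 1)
  by_cases hj : CountLim t n (count t n (Y ⋆ n))
  · rw [coeff_of_countLim he hh hx hj] at happ
    refine ⟨fun _ => hj, fun _ => ?_⟩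
    linarith [happ.2]
  · rw [coeff_of_not_countLim he hh hx hj] at happ
    refine ⟨fun h => ?_, fun h => (hj h).elim⟩
    linarith [happ.1]

end Model

end FinTypeArith

namespace FinTypeArith

namespace Model

open Interp

variable {M : Model} {Γ : Ctx} (e : M.Env Γ)

/-! ### The principles in a model -/

@[simp] theorem sat_le (s t : Tm Γ .nat) : Sat e (le s t) ↔ eval e s ≤ eval e t := by
  rw [le_iff_monus, le, Sat, eval_monus, eval_zero]

theorem Orthonormal.of_sat {s : Tm Γ (.nat ⇒ .X)} (h : Sat e (OrthonormalSeq s)) :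
    Orthonormal (eval e s) := by
  have h' : ∀ i j : M.N, ip (eval e s ⋆ i) (eval e s ⋆ j) =
      ofQ (qv (cond (monus i j + monus j i) (eval (cons j (cons i e)) oneQ)
        (eval (cons j (cons i e)) zeroQ))) := fun i j => by
    simpa [delta] using (sat_eqR _ _ _).1 (h i j)
  refine ⟨fun i => ?_, fun i j hij => ?_⟩
  · have hi : monus i i = 0 := le_iff_monus.1 le_rfl
    rw [h', hi, add_zero, cond_zero, qv_oneQ, map_one]
  · rw [h', cond_of_ne_zero, qv_zeroQ, map_zero]
    intro h0
    exact hij (le_antisymm (le_iff_monus.2 (eq_zero_of_add_eq_zero h0))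
      (le_iff_monus.2 (eq_zero_of_add_eq_zero ((add_comm _ _).trans h0))))

theorem sat_boundedSeq {s : Tm Γ (.nat ⇒ .X)} (h : ∀ i, nrm (eval e s ⋆ i) ≤ 2) :
    Sat e (BoundedSeq s) := by
  refine (sat_ex _ _).2 ⟨constR (addQ (eval e oneQ) (eval e oneQ)), fun i => (sat_leR _ _ _).2 ?_⟩
  simpa [one_add_one_eq_two, map_ofNat ofQ 2] using h i

theorem sat_strictIncr (s : Tm Γ .fn) :
    Sat e (StrictIncr s) ↔ ∀ i, eval e s ⋆ i + 1 ≤ eval e s ⋆ (i + 1) := by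
  refine forall_congr' fun i => (sat_le _ _ _).trans ?_
  simp [S_eq]

theorem subseqC_app (x : M.D (.nat ⇒ .X)) (h : M.D .fn) (i : M.N) :
    eval nil subseqC ⋆ x ⋆ h ⋆ i = x ⋆ (h ⋆ i) := by
  simp [subseqC]

theorem sat_weakLim (s : Tm Γ (.nat ⇒ .X)) (f : Tm Γ .fn) (z : Tm Γ .X) :
    Sat e (WeakLim (subseq s f) z) ↔ WeakLimit (eval e s) (eval e f) (eval e z) := by
  refine forall_congr' fun y => forall_congr' fun k => (sat_ex _ _).trans <|
    exists_congr fun m => forall_congr' fun i => imp_congr (sat_le _ _ _) <|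
      (sat_leR _ _ _).trans ?_
  simp [subseq, eval_cl, subseqC_app, sub_eq_add_neg]

theorem sat_pi02CA (t : Tm Γ (.nat ⇒ .nat ⇒ .nat ⇒ .nat)) :
    Sat e (Pi02CA t) ↔
      ∃ g : M.D .fn, ∀ n, g ⋆ n = 0 ↔ ∀ x, ∃ y, eval e t ⋆ x ⋆ y ⋆ n = 0 := by
  refine (sat_ex _ _).trans <| exists_congr fun g => forall_congr' fun n =>
    (sat_iff _ _ _).trans <| iff_congr (by simp [Sat]) <| forall_congr' fun x =>
      (sat_ex _ _).trans <| exists_congr fun y => ?_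
  simp [Sat]

/-- A weakly convergent subsequence of the sequence yields the characteristic function. -/
theorem sat_seqC {t : Tm Γ (.nat ⇒ .nat ⇒ .nat ⇒ .nat)} {a : M.D (.nat ⇒ .X)}
    (s : Tm Γ (.nat ⇒ .X)) (hs : eval e s = eval nil seqC ⋆ eval e t ⋆ a) (ha : Orthonormal a) :
    Sat e (.and (BoundedSeq s) (BWweak s ⇛ Pi02CA t)) := by
  have hb : Sat e (BoundedSeq s) := sat_boundedSeq e fun i => by
    rw [hs, seqC_app]
    exact nrm_part_le ha _ _
  refine (sat_and _ _ _).2 ⟨hb, fun h => (sat_pi02CA _ _).2 ?_⟩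
  obtain ⟨x, hx⟩ := (sat_ex _ _).1 (h hb)
  obtain ⟨f, hf⟩ := (sat_ex _ _).1 hx
  obtain ⟨hf, hw⟩ := (sat_and _ _ _).1 hf
  replace hf := (sat_strictIncr _ _).1 hf
  replace hw := (sat_weakLim _ _ _ _).1 hw
  simp only [eval_wk, hs, eval_v0, eval_v1] at hf hw
  exact exists_characteristic ha hf hw

end Model

end FinTypeArith

theorem mainTheorem5 :
    (∀ (Γ : Ctx) (t : Tm Γ (.nat ⇒ .nat ⇒ .nat ⇒ .nat)),
      Provable (.ex (.nat ⇒ .X) (OrthonormalSeq v0) ⇛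
        .ex (.nat ⇒ .X) (.and (BoundedSeq v0) (BWweak v0 ⇛ Pi02CA t.wk)))) ∧
    (∃ F : Tm [] ((.nat ⇒ .nat ⇒ .nat ⇒ .nat) ⇒ (.nat ⇒ .X) ⇒ .nat ⇒ .X),
      ∀ (Γ : Ctx) (t : Tm Γ (.nat ⇒ .nat ⇒ .nat ⇒ .nat)) (e : Tm Γ (.nat ⇒ .X)),
        Provable (OrthonormalSeq e ⇛
          .and (BoundedSeq (F.cl ⬝ t ⬝ e)) (BWweak (F.cl ⬝ t ⬝ e) ⇛ Pi02CA t))) := by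
  -- Both claims are checked in an arbitrary model with the closed term `seqC`; for the first, the
  -- orthonormal sequence is an element of the model and not the value of a given term.
  refine ⟨fun Γ t => provable_of_models fun M ν h => ?_, seqC, fun Γ t e =>
    provable_of_models fun M ν h => ?_⟩
  · obtain ⟨a, ha⟩ := (Interp.sat_ex _ _).1 h
    exact (Interp.sat_ex _ _).2 ⟨_, Model.sat_seqC _ v0 (by rw [Interp.eval_wk]; rfl)
      (Model.Orthonormal.of_sat _ ha)⟩
  · exact Model.sat_seqC ν _ (by rw [Model.eval_app, Model.eval_app, Interp.eval_cl])
      (Model.Orthonormal.of_sat ν h)
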